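/- Let $B=\{x\in\mathbb R^2 : |x|\le 1\}$, $B^c=\mathbb R^2\setminus B$, and let all functions be real-valued. Let $d\mu=(1+\log|x|)\,dx$ on $B^c$, let $L^1_{d\mu}=\{f\in L^1(B^c) : \|f\|_{L^1_{d\mu}}=\int_{B^c}|f|\,d\mu<\infty\}$, and let $L^2_{\rm rad}$ be the space of radially symmetric functions in $L^2(B^c)$. Let $\Delta_{B^c}$ be the Dirichlet Laplacian, with domain $H^2(B^c)\cap H^1_0(B^c)$, and let $(e^{t\mathcal L})_{t\ge0}$ be the $C_0$-semigroup on $H^1_0(B^c)\times L^2(B^c)$ generated by $\mathcal L(u,v)=(v,\Delta_{B^c}u-v)$ with domain $(H^2(B^c)\cap H_0^1(B^c))\times H^1_0(B^c)$. For $g\in L^2(B^c)$ let $S(t)g$ be the first component of $e^{t\mathcal L}(0,g)$, that is, the solution $u$ of the damped wave equation $\partial_t^2u-\Delta u+\partial_tu=0$ in $B^c$ with $u=0$ on $\partial B^c$ and $(u,\partial_tu)(0)=(0,g)$. For every $g\in L^2_{\rm rad}\cap L^1_{d\mu}$ one has $S(\cdot)g\in C([0,\infty);L^1_{d\mu})$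 and $$\|S(t)g\|_{L^1_{d\mu}}\le(1-e^{-t})\,\|g\|_{L^1_{d\mu}},\qquad t\ge0.$$ In particular, for every $t\ge0$, $S(t)$ is a bounded linear operator from $L^2_{\rm rad}\cap L^1_{d\mu}$ (with the norm $\max\{\|g\|_{L^2},\|g\|_{L^1_{d\mu}}\}$) to itself, and it extends to a bounded linear operator, of norm at most $1-e^{-t}$, from the space of radially symmetric functions in $L^1_{d\mu}$ to itself. -/

import Mathlib

open MeasureTheory Filter Topology Set
open scoped NNReal ENNReal ContDiff

noncomputable section

namespace ExteriorDampedWave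

/-- The plane with its Euclidean norm. -/
abbrev Plane : Type := EuclideanSpace ℝ (Fin 2)

/-- The exterior domain `Bᶜ`, the complement of the closed unit disc. -/
def Ext : Set Plane := {x | 1 < ‖x‖}

/-- Lebesgue measure on the exterior domain. -/
abbrev volExt : Measure Plane := volume.restrict Ext

/-- The weighted measure `dμ = (1 + log |x|) dx` on the exterior domain. -/
def muExt : Measure Plane := volExt.withDensity fun x => ENNReal.ofReal (1 + Real.log ‖x‖)

/-- The real space `L²(Bᶜ)`. -/
abbrev L2 : Type := Lp ℝ 2 volExt

/-- Square integrable vector fields on `Bᶜ`. -/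
abbrev L2Vec : Type := Lp Plane 2 volExt

/-- The weighted space `L¹_{dμ}`. Since `1 + log |x| ≥ 1` on `Bᶜ`, its elements are
automatically in `L¹(Bᶜ)`, and `μ` has the same null sets as Lebesgue measure on `Bᶜ`. -/
abbrev L1mu : Type := Lp ℝ 1 muExt

/-! ### Sobolev spaces and the Dirichlet Laplacian -/

/-- Test functions, `C_c^∞(Bᶜ)`. -/
structure IsTest (φ : Plane → ℝ) : Prop where
  smooth : ContDiff ℝ ∞ φ
  compact : HasCompactSupport φ
  supp : tsupport φ ⊆ Ext

theorem IsTest.differentiable {φ : Plane → ℝ} (h : IsTest φ) : Differentiable ℝ φ :=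
  h.smooth.differentiable (by simp)

/-- The pairs `(φ, ∇φ)` with `φ ∈ C_c^∞(Bᶜ)`, inside `L² × L²` with the Hilbert norm
`(‖u‖² + ‖∇u‖²)^{1/2}`. -/
def testGraph : Submodule ℝ (WithLp 2 (L2 × L2Vec)) where
  carrier := {p | ∃ φ : Plane → ℝ, IsTest φ ∧ p.fst =ᵐ[volExt] φ ∧
    p.snd =ᵐ[volExt] gradient φ}
  zero_mem' := by
    refine ⟨fun _ => 0, ⟨contDiff_const, HasCompactSupport.zero, ?_⟩, ?_, ?_⟩
    · simp [tsupport, Function.support]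
    · exact Lp.coeFn_zero ℝ 2 volExt
    · filter_upwards [Lp.coeFn_zero Plane 2 volExt] with x hx
      simpa [gradient] using hx
  add_mem' := by
    rintro p q ⟨φ, hφ, hp1, hp2⟩ ⟨ψ, hψ, hq1, hq2⟩
    refine ⟨φ + ψ, ⟨hφ.smooth.add hψ.smooth, hφ.compact.add hψ.compact,
      (tsupport_add φ ψ).trans (union_subset hφ.supp hψ.supp)⟩, ?_, ?_⟩
    · exact (Lp.coeFn_add p.fst q.fst).trans (hp1.add hq1)
    · refine (Lp.coeFn_add p.snd q.snd).trans ?_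
      filter_upwards [hp2, hq2] with x h1 h2
      simp only [Pi.add_apply, h1, h2, gradient]
      rw [fderiv_add (hφ.differentiable x) (hψ.differentiable x), map_add]
  smul_mem' := by
    rintro c p ⟨φ, hφ, hp1, hp2⟩
    refine ⟨c • φ, ⟨hφ.smooth.const_smul c, hφ.compact.smul_left (f := fun _ => c),
      (closure_mono (Function.support_const_smul_subset c φ)).trans hφ.supp⟩, ?_, ?_⟩
    · exact (Lp.coeFn_smul c p.fst).trans (hp1.const_smul c)
    · refine (Lp.coeFn_smul c p.snd).trans ?_
      filter_upwards [hp2] with x h1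
      simp only [Pi.smul_apply, h1, gradient]
      rw [fderiv_const_smul (hφ.differentiable x) c]
      simp

/-- The Hilbert space `H_0^1(Bᶜ)`, the closure of `C_c^∞(Bᶜ)` in the `H^1` norm. An element
is stored as the pair `(u, ∇u)`. -/
def H10 : Submodule ℝ (WithLp 2 (L2 × L2Vec)) := testGraph.topologicalClosure

/-- The underlying `L²` function of an element of `H_0^1(Bᶜ)`. -/
def H10.toL2 (u : H10) : L2 := (u : WithLp 2 (L2 × L2Vec)).fst

/-- `v` is the weak partial derivative of `u` in the `i`-th coordinate direction. -/
def HasWeakPartial (i : Fin 2) (u v : L2) : Prop :=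
  ∀ φ : Plane → ℝ, IsTest φ →
    ∫ x in Ext, u x * fderiv ℝ φ x (EuclideanSpace.single i 1) = -∫ x in Ext, v x * φ x

/-- `u ∈ H²(Bᶜ)` with `Δu = f`: all weak derivatives of `u` of order one (`p`) and two (`q`)
exist in `L²(Bᶜ)`, and `f` is the trace of the Hessian. -/
def H2Laplacian (u f : L2) : Prop :=
  ∃ (p : Fin 2 → L2) (q : Fin 2 → Fin 2 → L2),
    (∀ i, HasWeakPartial i u (p i)) ∧ (∀ i j, HasWeakPartial j (p i) (q i j)) ∧
      f = ∑ i, q i i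

/-! ### Strongly continuous semigroups -/

/-- Strongly continuous one-parameter semigroups of bounded operators. -/
structure IsC0Semigroup {X : Type*} [NormedAddCommGroup X] [NormedSpace ℝ X]
    (T : ℝ≥0 → X →L[ℝ] X) : Prop where
  zero : T 0 = ContinuousLinearMap.id ℝ X
  add : ∀ s t, T (s + t) = (T s).comp (T t)
  continuous : ∀ x, Continuous fun t => T t x

/-- The generator of `T`, as an unbounded operator, is the operator whose graph is `G`:
`x` is in the domain and is mapped to `y` iff `(T h x - x) / h → y` as `h ↓ 0`. -/
def IsGenerator {X : Type*} [NormedAddCommGroup X] [NormedSpace ℝ X]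
    (T : ℝ≥0 → X →L[ℝ] X) (G : X → X → Prop) : Prop :=
  ∀ x y, G x y ↔ Tendsto (fun h : ℝ≥0 => (h : ℝ)⁻¹ • (T h x - x)) (𝓝[>] 0) (𝓝 y)

open Classical in
/-- The `C₀`-semigroup generated by the operator with graph `G` (a semigroup is determined by
its generator; the value is `0` if the operator is not a generator). -/
def semigroupOf {X : Type*} [NormedAddCommGroup X] [NormedSpace ℝ X]
    (G : X → X → Prop) : ℝ≥0 → X →L[ℝ] X :=
  if h : ∃ T : ℝ≥0 → X →L[ℝ] X, IsC0Semigroup T ∧ IsGenerator T G then h.choose else 0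

/-! ### The linear damped wave equation -/

/-- The energy space `H_0^1(Bᶜ) × L²(Bᶜ)`. -/
abbrev Energy : Type := WithLp 2 (H10 × L2)

/-- The graph of `𝓛(u, v) = (v, Δu - v)` with domain `(H² ∩ H_0^1) × H_0^1`. -/
def waveOp (x y : Energy) : Prop :=
  H10.toL2 y.fst = x.snd ∧ ∃ f : L2, H2Laplacian (H10.toL2 x.fst) f ∧ y.snd = f - x.snd

/-- The solution map `S(t) g = P₁ e^{t𝓛} (0, g)`. -/
def solMap (t : ℝ≥0) (g : L2) : L2 :=
  H10.toL2 (semigroupOf waveOp t (WithLp.toLp 2 (0, g))).fst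

/-! ### Radial functions -/

/-- Radial symmetry of (a class of) functions on `Bᶜ`. -/
def IsRadial (g : Plane → ℝ) : Prop :=
  ∃ f : ℝ → ℝ, Measurable f ∧ ∀ᵐ x ∂volExt, g x = f ‖x‖

theorem IsRadial.zero_of_ae {g : Plane → ℝ} (h : g =ᵐ[volExt] 0) : IsRadial g :=
  ⟨fun _ => 0, measurable_const, h⟩

theorem IsRadial.add_of_ae {g h k : Plane → ℝ} (hg : IsRadial g) (hh : IsRadial h)
    (hk : k =ᵐ[volExt] g + h) : IsRadial k := by
  obtain ⟨a, ha, hga⟩ := hg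
  obtain ⟨b, hb, hhb⟩ := hh
  refine ⟨a + b, ha.add hb, ?_⟩
  filter_upwards [hga, hhb, hk] with x h1 h2 h3
  simp [h3, h1, h2]

theorem IsRadial.smul_of_ae {g k : Plane → ℝ} (c : ℝ) (hg : IsRadial g)
    (hk : k =ᵐ[volExt] c • g) : IsRadial k := by
  obtain ⟨a, ha, hga⟩ := hg
  refine ⟨c • a, ha.const_smul c, ?_⟩
  filter_upwards [hga, hk] with x h1 h3
  simp [h3, h1]

theorem volExt_ac_muExt : volExt ≪ muExt := by
  refine withDensity_absolutelyContinuous' ?_ ?_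
  · exact (ENNReal.measurable_ofReal.comp
      (measurable_const.add (Real.measurable_log.comp measurable_norm))).aemeasurable
  · have hE : MeasurableSet Ext := measurableSet_lt measurable_const measurable_norm
    filter_upwards [ae_restrict_mem hE] with x hx
    have : 0 < Real.log ‖x‖ := Real.log_pos hx
    simp only [ne_eq, ENNReal.ofReal_eq_zero, not_le]
    linarith

/-- The radial functions in `L¹_{dμ}`. -/
def radL1 : Submodule ℝ L1mu where
  carrier := {h | IsRadial h}
  zero_mem' := IsRadial.zero_of_ae (volExt_ac_muExt.ae_le (Lp.coeFn_zero ℝ 1 muExt))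
  add_mem' := fun {a b} ha hb =>
    IsRadial.add_of_ae ha hb (volExt_ac_muExt.ae_le (Lp.coeFn_add a b))
  smul_mem' := fun c a ha =>
    IsRadial.smul_of_ae c ha (volExt_ac_muExt.ae_le (Lp.coeFn_smul c a))

/-- The space `L²_rad ∩ L¹_{dμ}` with the intersection norm `max (‖g‖_{L²}, ‖g‖_{L¹_{dμ}})`:
an element is stored as the pair of its classes in `L²(Bᶜ)` and in `L¹_{dμ}`. -/
def radL2L1 : Submodule ℝ (L2 × L1mu) where
  carrier := {p | IsRadial p.1 ∧ p.1 =ᵐ[volExt] p.2}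
  zero_mem' := by
    have h1 : ((0 : L2) : Plane → ℝ) =ᵐ[volExt] 0 := Lp.coeFn_zero ℝ 2 volExt
    have h2 : ((0 : L1mu) : Plane → ℝ) =ᵐ[volExt] 0 :=
      volExt_ac_muExt.ae_le (Lp.coeFn_zero ℝ 1 muExt)
    exact ⟨IsRadial.zero_of_ae h1, h1.trans h2.symm⟩
  add_mem' := by
    rintro p q ⟨hp, hp'⟩ ⟨hq, hq'⟩
    have h1 := Lp.coeFn_add p.1 q.1
    have h2 : _ =ᵐ[volExt] _ := volExt_ac_muExt.ae_le (Lp.coeFn_add p.2 q.2)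
    exact ⟨IsRadial.add_of_ae hp hq h1, h1.trans ((hp'.add hq').trans h2.symm)⟩
  smul_mem' := by
    rintro c p ⟨hp, hp'⟩
    have h1 := Lp.coeFn_smul c p.1
    have h2 : _ =ᵐ[volExt] _ := volExt_ac_muExt.ae_le (Lp.coeFn_smul c p.2)
    exact ⟨IsRadial.smul_of_ae c hp h1, h1.trans ((hp'.const_smul c).trans h2.symm)⟩

end ExteriorDampedWave

end

open ExteriorDampedWave

noncomputable section

namespace ExteriorDampedWave

/-! ### Convergence in `Lᵖ` and elementary facts on the exterior domain -/

/-! For nonnegative radial data of bounded support the estimate is a duality argument. If `φ` is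
smooth, vanishes on the unit circle and is superharmonic where `u = S(·)g` lives, and if `u ≥ 0`,
then `b(t) = ∫ φ ∂ₜu` satisfies `b' = ∫ u Δφ - b ≤ -b`. Hence `b(t) ≤ e^{-t} ∫ φ g`, and one more
integration gives `∫ φ u(t) ≤ (1 - e^{-t}) ∫ φ g` (`inner_solCLM_le`). The weights `1 + log r -
r^{-(n+1)}` qualify and increase to the density `1 + log r` of `μ` (`lap_cutWeight_nonpos`,
`IsNice.eLpNorm_solCLM_le`).

What remains is positivity and finite speed (`solCLM_mem_cone`). Writing `u = e^{-t/2} r^{-1/2} w`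
turns the radial equation into `w_tt - w_rr = (1/4 + 1/(4r²)) w`, whose potential is positive.
Dropping the potential leaves the one-dimensional wave equation on a half line, which d'Alembert's
formula with odd reflection solves explicitly by nonnegative waves. This parametrix `v` satisfies
`S(t)g = v(t) + ∫₀ᵗ S(t-s)(V v(s)) ds` with `V = 1/4 + 1/(4r²)`. The source is again nonnegative and
radial with support controlled by unit speed, so iterating the formula shows that `S(t)g` belongs to
the same closed convex cone (`IsNice.duhamel`, `inner_solCLM_lower`).

General radial data follow by splitting into positive and negative parts and by truncation and
mollification. Continuity in time with values in `L¹_{dμ}` comes from `L²` continuity on balls and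
the uniform bound (`continuous_toLp_solCLM`). The bounded extension is by density.

The semigroup itself must also be shown to exist. The operator minus the identity is m-dissipative
on the energy space (`isMDissipative_waveOp`), and Yosida approximation produces the semigroup
(`IsMDissipative.exists_semigroup`). The range condition needs `H²` regularity of the Dirichlet
problem. It is proved by odd reflection through the inversion `y ↦ y/|y|²`, conformal in the plane,
which reduces the question to Fourier analysis on the whole plane (`h2Laplacian_of_weak`). -/

theorem tendsto_eLpNorm_of_dominated {α E ι : Type*} {m : MeasurableSpace α} {μ : Measure α}
    [NormedAddCommGroup E] {p : ℝ≥0∞} (hp0 : p ≠ 0) (hp : p ≠ ⊤) {l : Filter ι}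
    [l.IsCountablyGenerated] {F : ι → α → E} {f : α → E} {G : α → ℝ}
    (hF : ∀ᶠ n in l, AEStronglyMeasurable (F n) μ) (hf : AEStronglyMeasurable f μ)
    (hG : MemLp G p μ) (hbound : ∀ᶠ n in l, ∀ᵐ x ∂μ, ‖F n x - f x‖ ≤ G x)
    (hlim : ∀ᵐ x ∂μ, Tendsto (fun n => F n x) l (𝓝 (f x))) :
    Tendsto (fun n => eLpNorm (F n - f) p μ) l (𝓝 0) := by
  have hpr : 0 < p.toReal := ENNReal.toReal_pos hp0 hp
  have key : Tendsto (fun n => ∫⁻ x, ‖(F n - f) x‖ₑ ^ p.toReal ∂μ) l (𝓝 (∫⁻ _, 0 ∂μ)) := by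
    refine tendsto_lintegral_filter_of_dominated_convergence' (fun x => ‖G x‖ₑ ^ p.toReal) ?_ ?_ ?_ ?_
    · filter_upwards [hF] with n hn
      exact (hn.sub hf).enorm.pow_const _
    · filter_upwards [hbound] with n hn
      filter_upwards [hn] with x hx
      gcongr
      rw [enorm_le_iff_norm_le]
      exact hx.trans (le_abs_self _)
    · exact (lintegral_rpow_enorm_lt_top_of_eLpNorm_lt_top hp0 hp hG.2).ne
    · filter_upwards [hlim] with x hx
      have h1 : Tendsto (fun n => ‖F n x - f x‖ₑ) l (𝓝 0) := by
        have := (hx.sub_const (f x)).enorm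
        simpa using this
      have := (ENNReal.continuous_rpow_const (y := p.toReal)).tendsto 0 |>.comp h1
      simpa [ENNReal.zero_rpow_of_pos hpr, Function.comp_def] using this
  have h2 := (ENNReal.continuous_rpow_const (y := 1 / p.toReal)).tendsto 0
  simp only [lintegral_zero] at key
  have h3 := h2.comp key
  simp only [one_div, inv_pos, hpr, ENNReal.zero_rpow_of_pos] at h3
  refine h3.congr fun n => ?_
  rw [eLpNorm_eq_lintegral_rpow_enorm_toReal hp0 hp, one_div]
  rfl

theorem tendsto_toLp_of_dominated {α E ι : Type*} {m : MeasurableSpace α} {μ : Measure α}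
    [NormedAddCommGroup E] {p : ℝ≥0∞} [Fact (1 ≤ p)] (hp : p ≠ ⊤) {l : Filter ι}
    [l.IsCountablyGenerated] {F : ι → α → E} {f : α → E} {G : α → ℝ}
    (hF : ∀ n, MemLp (F n) p μ) (hf : MemLp f p μ)
    (hG : MemLp G p μ) (hbound : ∀ᶠ n in l, ∀ᵐ x ∂μ, ‖F n x - f x‖ ≤ G x)
    (hlim : ∀ᵐ x ∂μ, Tendsto (fun n => F n x) l (𝓝 (f x))) :
    Tendsto (fun n => (hF n).toLp (F n)) l (𝓝 (hf.toLp f)) := by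
  rw [Lp.tendsto_Lp_iff_tendsto_eLpNorm'']
  exact tendsto_eLpNorm_of_dominated (zero_lt_one.trans_le Fact.out).ne' hp
    (.of_forall fun n => (hF n).1) hf.1 hG hbound hlim

theorem isOpen_Ext : IsOpen Ext := isOpen_lt continuous_const continuous_norm

theorem measurableSet_Ext : MeasurableSet Ext := isOpen_Ext.measurableSet

theorem Ext.ne_zero {x : Plane} (hx : x ∈ Ext) : x ≠ 0 := by
  rintro rfl
  simp [Ext] at hx
  linarith

theorem memLp_volExt {E : Type*} [NormedAddCommGroup E] {φ : Plane → E} (hc : Continuous φ)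
    (hs : HasCompactSupport φ) (p : ℝ≥0∞) : MemLp φ p volExt :=
  hc.memLp_of_hasCompactSupport hs

/-- The `i`-th coordinate vector. -/
abbrev basisVec (i : Fin 2) : Plane := EuclideanSpace.single i 1

/-- The `i`-th partial derivative. -/
def partialD (i : Fin 2) (φ : Plane → ℝ) : Plane → ℝ := fun x => fderiv ℝ φ x (basisVec i)

/-- Smooth compactly supported functions on the plane. -/
structure IsSmoothCpt (φ : Plane → ℝ) : Prop where
  smooth : ContDiff ℝ ∞ φ
  compact : HasCompactSupport φ

theorem IsTest.isSmoothCpt {φ : Plane → ℝ} (h : IsTest φ) : IsSmoothCpt φ := ⟨h.smooth, h.compact⟩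

namespace IsSmoothCpt

variable {φ ψ : Plane → ℝ}

theorem differentiable (h : IsSmoothCpt φ) : Differentiable ℝ φ := h.smooth.differentiable (by simp)

theorem partialD (h : IsSmoothCpt φ) (i : Fin 2) : IsSmoothCpt (partialD i φ) :=
  ⟨(h.smooth.fderiv_right (m := ∞) (by simp)).clm_apply contDiff_const,
    h.compact.fderiv_apply (𝕜 := ℝ) _⟩

theorem memLp (h : IsSmoothCpt φ) : MemLp φ 2 volExt := memLp_volExt h.smooth.continuous h.compact 2

theorem gradient_continuous (h : IsSmoothCpt φ) : Continuous (gradient φ) :=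
  (InnerProductSpace.toDual ℝ Plane).symm.continuous.comp (h.smooth.continuous_fderiv (by simp))

theorem gradient_compact (h : IsSmoothCpt φ) : HasCompactSupport (gradient φ) :=
  h.compact.fderiv (𝕜 := ℝ) |>.comp_left (g := (InnerProductSpace.toDual ℝ Plane).symm) (map_zero _)

theorem memLp_gradient (h : IsSmoothCpt φ) : MemLp (gradient φ) 2 volExt :=
  memLp_volExt h.gradient_continuous h.gradient_compact 2

end IsSmoothCpt

theorem gradient_apply (φ : Plane → ℝ) (x : Plane) (i : Fin 2) :
    gradient φ x i = partialD i φ x := by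
  have := inner_gradient_left (𝕜 := ℝ) (f := φ) (x := x) (y := basisVec i)
  rw [partialD, ← this, EuclideanSpace.inner_single_right]
  simp

theorem inner_toLp_eq {φ : Plane → ℝ} (h : MemLp φ 2 volExt) (u : L2) :
    inner ℝ (h.toLp φ) u = ∫ x in Ext, u x * φ x := by
  rw [L2.inner_def]
  refine integral_congr_ae ?_
  filter_upwards [h.coeFn_toLp] with x hx
  simp [hx]

theorem inner_eq_integral (v u : L2) : inner ℝ v u = ∫ x in Ext, u x * v x := by
  rw [L2.inner_def]
  simp

theorem integrable_mul_volExt {u v : Plane → ℝ} (hu : MemLp u 2 volExt) (hv : MemLp v 2 volExt) :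
    Integrable (fun x => u x * v x) volExt := hu.integrable_mul hv

theorem memLp_smul_basisVec {φ : Plane → ℝ} (h : MemLp φ 2 volExt) (i : Fin 2) :
    MemLp (fun x => φ x • basisVec i) 2 volExt := by
  have hc : MemLp (fun _ : Plane => basisVec i) ∞ volExt := memLp_top_const _
  exact hc.smul h

/-- The vector field `φ eᵢ` as an element of `L²`. -/
def coordField {φ : Plane → ℝ} (h : MemLp φ 2 volExt) (i : Fin 2) : L2Vec :=
  (memLp_smul_basisVec h i).toLp _

theorem inner_coordField {φ : Plane → ℝ} (h : MemLp φ 2 volExt) (i : Fin 2) (u : L2Vec) :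
    inner ℝ (coordField h i) u = ∫ x in Ext, u x i * φ x := by
  rw [coordField, L2.inner_def]
  refine integral_congr_ae ?_
  filter_upwards [(memLp_smul_basisVec h i).coeFn_toLp] with x hx
  rw [hx, inner_smul_left, EuclideanSpace.inner_single_left]
  simp [mul_comm]

/-! ### Integration by parts -/

theorem integral_mul_partialD {φ ψ : Plane → ℝ} (hφ : IsSmoothCpt φ) (hψ : IsSmoothCpt ψ)
    (i : Fin 2) : ∫ x, φ x * partialD i ψ x = -∫ x, partialD i φ x * ψ x := by
  refine integral_mul_fderiv_eq_neg_fderiv_mul_of_integrable ?_ ?_ ?_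
    (fun x _ => hφ.differentiable x) (fun x _ => hψ.differentiable x)
  · exact ((hφ.partialD i).smooth.continuous.mul hψ.smooth.continuous).integrable_of_hasCompactSupport
      (hψ.compact.mul_left)
  · exact (hφ.smooth.continuous.mul (hψ.partialD i).smooth.continuous).integrable_of_hasCompactSupport
      (hφ.compact.mul_right)
  · exact (hφ.smooth.continuous.mul hψ.smooth.continuous).integrable_of_hasCompactSupport
      (hφ.compact.mul_right)

theorem setIntegral_Ext_eq {F : Plane → ℝ} (h : ∀ x ∉ Ext, F x = 0) :
    ∫ x in Ext, F x = ∫ x, F x :=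
  setIntegral_eq_integral_of_forall_compl_eq_zero h

theorem IsTest.eq_zero {φ : Plane → ℝ} (h : IsTest φ) {x : Plane} (hx : x ∉ Ext) : φ x = 0 :=
  image_eq_zero_of_notMem_tsupport fun hx' => hx (h.supp hx')

theorem IsTest.partialD_eq_zero {φ : Plane → ℝ} (h : IsTest φ) (i : Fin 2) {x : Plane}
    (hx : x ∉ Ext) : partialD i φ x = 0 := by
  rw [partialD, fderiv_of_notMem_tsupport (𝕜 := ℝ) fun hx' => hx (h.supp hx')]
  rfl

/-- Integration by parts against an element of `H_0^1`; the smooth function need not vanish on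
the boundary. -/
theorem H10.integral_fst_mul_partialD {p : WithLp 2 (L2 × L2Vec)} (hp : p ∈ H10) {φ : Plane → ℝ}
    (hφ : IsSmoothCpt φ) (i : Fin 2) :
    ∫ x in Ext, p.fst x * partialD i φ x = -∫ x in Ext, p.snd x i * φ x := by
  -- Both sides are continuous linear functionals of the pair `(u, ∇u)`, so it suffices to check
  -- pairs coming from test functions.
  have hclosed : IsClosed {p : WithLp 2 (L2 × L2Vec) |
      inner ℝ ((hφ.partialD i).memLp.toLp _) p.fst =
        -inner ℝ (coordField hφ.memLp i) p.snd} := by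
    refine isClosed_eq ?_ ?_
    · exact continuous_const.inner (WithLp.fstL 2 ℝ L2 L2Vec).continuous
    · exact (continuous_const.inner (WithLp.sndL 2 ℝ L2 L2Vec).continuous).neg
  have := closure_minimal (s := (testGraph : Set (WithLp 2 (L2 × L2Vec)))) ?_ hclosed hp
  · simpa only [mem_ofPred_eq, inner_toLp_eq, inner_coordField] using this
  rintro q ⟨ψ, hψ, h1, h2⟩
  simp only [mem_ofPred_eq, inner_toLp_eq, inner_coordField]
  have e1 : ∫ x in Ext, q.fst x * partialD i φ x = ∫ x in Ext, ψ x * partialD i φ x :=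
    integral_congr_ae (h1.mono fun x hx => by simp only [hx])
  have e2 : ∫ x in Ext, q.snd x i * φ x = ∫ x in Ext, partialD i ψ x * φ x :=
    integral_congr_ae (h2.mono fun x hx => by simp only [hx, gradient_apply])
  -- No boundary term appears: `ψ` and its derivatives vanish off `Ext`, so the integrals may be
  -- taken over the whole plane.
  rw [e1, e2, setIntegral_Ext_eq fun x hx => by rw [hψ.eq_zero hx, zero_mul],
    setIntegral_Ext_eq fun x hx => by rw [hψ.partialD_eq_zero i hx, zero_mul]]
  exact integral_mul_partialD hψ.isSmoothCpt hφ i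

/-! ### Uniqueness of weak derivatives and Green's identities. -/

theorem L2.ae_eq_of_forall_test {u v : Plane → ℝ} (hu : MemLp u 2 volExt) (hv : MemLp v 2 volExt)
    (h : ∀ φ : Plane → ℝ, IsTest φ → ∫ x in Ext, u x * φ x = ∫ x in Ext, v x * φ x) :
    u =ᵐ[volExt] v := by
  have hloc : LocallyIntegrable (u - v) volExt := (hu.sub hv).locallyIntegrable (by norm_num)
  have := isOpen_Ext.ae_eq_zero_of_integral_contDiff_smul_eq_zero (μ := volExt)
    (f := u - v) (hloc.locallyIntegrableOn _) ?_
  · filter_upwards [this, ae_restrict_mem measurableSet_Ext] with x hx hx'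
    simpa [sub_eq_zero] using hx hx'
  · intro g hg1 hg2 hg3
    have hg : IsTest g := ⟨hg1, hg2, hg3⟩
    have hgm := hg.isSmoothCpt.memLp
    have := h g hg
    have e : ∀ x, g x • (u - v) x = u x * g x - v x * g x := fun x => by simp; ring
    simp_rw [e]
    rw [integral_sub (integrable_mul_volExt hu hgm) (integrable_mul_volExt hv hgm), this, sub_self]

theorem memLp_coord {f : Plane → Plane} (h : MemLp f 2 volExt) (i : Fin 2) :
    MemLp (fun x => f x i) 2 volExt :=
  (EuclideanSpace.proj i : Plane →L[ℝ] ℝ).comp_memLp' h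

/-- The weak partial derivatives of an element of `H_0^1` are the components of its gradient. -/
theorem HasWeakPartial.eq_snd {p : WithLp 2 (L2 × L2Vec)} (hp : p ∈ H10) {i : Fin 2} {v : L2}
    (h : HasWeakPartial i p.fst v) : v =ᵐ[volExt] fun x => p.snd x i := by
  refine L2.ae_eq_of_forall_test (Lp.memLp v) (memLp_coord (Lp.memLp _) i) fun φ hφ => ?_
  have h1 := h φ hφ
  have h2 := H10.integral_fst_mul_partialD hp hφ.isSmoothCpt i
  simp only [partialD] at h2
  linarith

/-- The Laplacian of a smooth function. -/
def lap (φ : Plane → ℝ) : Plane → ℝ := fun x => ∑ i, partialD i (partialD i φ) x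

theorem IsSmoothCpt.lap {φ : Plane → ℝ} (h : IsSmoothCpt φ) : IsSmoothCpt (lap φ) := by
  have h0 := (h.partialD 0).partialD 0
  have h1 := (h.partialD 1).partialD 1
  have e : ExteriorDampedWave.lap φ = ExteriorDampedWave.partialD 0 (ExteriorDampedWave.partialD 0 φ)
      + ExteriorDampedWave.partialD 1 (ExteriorDampedWave.partialD 1 φ) := by
    ext x; simp [ExteriorDampedWave.lap, Fin.sum_univ_two]
  rw [e]
  exact ⟨h0.smooth.add h1.smooth, h0.compact.add h1.compact⟩

/-- Green's formula in weak form, for functions `u` with `Δu = f` and test functions in `H_0^1`. -/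
theorem H2Laplacian.integral_mul_fst {f : L2} {p : Fin 2 → L2} {q : Fin 2 → Fin 2 → L2}
    (hpq : ∀ i j, HasWeakPartial j (p i) (q i j)) (hf : f = ∑ i, q i i)
    {w : WithLp 2 (L2 × L2Vec)} (hw : w ∈ H10) :
    ∫ x in Ext, f x * w.fst x = -∑ i, ∫ x in Ext, w.snd x i * p i x := by
  have hclosed : IsClosed {w : WithLp 2 (L2 × L2Vec) |
      inner ℝ f w.fst =
        -∑ i, inner ℝ (coordField (Lp.memLp (p i)) i) w.snd} := by
    refine isClosed_eq ?_ ?_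
    · exact continuous_const.inner (WithLp.fstL 2 ℝ L2 L2Vec).continuous
    · exact (continuous_finsetSum _ fun i _ =>
        continuous_const.inner (WithLp.sndL 2 ℝ L2 L2Vec).continuous).neg
  have := closure_minimal (s := (testGraph : Set (WithLp 2 (L2 × L2Vec)))) ?_ hclosed hw
  · simp only [mem_ofPred_eq, inner_coordField, inner_eq_integral] at this
    rw [← this]
    exact integral_congr_ae (.of_forall fun x => mul_comm _ _)
  rintro w ⟨ψ, hψ, h1, h2⟩
  simp only [mem_ofPred_eq, inner_coordField, inner_eq_integral]
  have e1 : ∫ x in Ext, w.fst x * f x = ∑ i, ∫ x in Ext, q i i x * ψ x := by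
    rw [← integral_finsetSum _ fun i _ => integrable_mul_volExt (Lp.memLp (q i i)) hψ.isSmoothCpt.memLp]
    refine integral_congr_ae ?_
    have hs : f =ᵐ[volExt] fun x => ∑ i, q i i x := by
      rw [hf, Fin.sum_univ_two]
      filter_upwards [Lp.coeFn_add (q 0 0) (q 1 1)] with x hx
      rw [hx, Fin.sum_univ_two, Pi.add_apply]
    filter_upwards [h1, hs] with x hx hx'
    rw [hx, hx', ← Finset.sum_mul, mul_comm]
  have e2 : ∀ i, ∫ x in Ext, w.snd x i * p i x = ∫ x in Ext, p i x * partialD i ψ x := fun i =>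
    integral_congr_ae (h2.mono fun x hx => by simp only [hx, gradient_apply, mul_comm])
  rw [e1, Finset.sum_congr rfl fun i _ => e2 i, ← Finset.sum_neg_distrib]
  refine Finset.sum_congr rfl fun i _ => ?_
  have := hpq i i ψ hψ
  simp only [partialD]
  linarith

/-- Green's second identity, for `u ∈ H² ∩ H_0^1` and a smooth function in `H_0^1`. -/
theorem H2Laplacian.integral_mul_lap {w : WithLp 2 (L2 × L2Vec)} (hw : w ∈ H10) {f : L2}
    (hf : H2Laplacian w.fst f) {φ : Plane → ℝ} (hφ : IsSmoothCpt φ)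
    (hφ0 : WithLp.toLp 2 (hφ.memLp.toLp φ, hφ.memLp_gradient.toLp (gradient φ)) ∈ H10) :
    ∫ x in Ext, f x * φ x = ∫ x in Ext, w.fst x * lap φ x := by
  obtain ⟨p, q, hp, hpq, hf⟩ := hf
  have h1 := H2Laplacian.integral_mul_fst hpq hf hφ0
  have e1 : ∫ x in Ext, f x * φ x = ∫ x in Ext, f x * (hφ.memLp.toLp φ) x :=
    integral_congr_ae (hφ.memLp.coeFn_toLp.mono fun x hx => by simp only [hx])
  rw [e1]
  refine h1.trans ?_
  have e2 : ∫ x in Ext, w.fst x * lap φ x = ∑ i, ∫ x in Ext, w.fst x * partialD i (partialD i φ) x := by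
    rw [← integral_finsetSum _ fun i _ =>
      integrable_mul_volExt (Lp.memLp w.fst) ((hφ.partialD i).partialD i).memLp]
    simp only [lap, Finset.mul_sum]
  rw [e2, ← Finset.sum_neg_distrib]
  refine Finset.sum_congr rfl fun i _ => ?_
  -- The second integration by parts moves a derivative off `∂ᵢφ`, which need not vanish on the
  -- circle; here the boundary condition is carried by `w`.
  rw [H10.integral_fst_mul_partialD hw (hφ.partialD i) i, neg_inj]
  refine integral_congr_ae ?_
  filter_upwards [hφ.memLp_gradient.coeFn_toLp, (hp i).eq_snd hw] with x hx hx'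
  rw [hx', mul_comm]
  congr 1
  exact (congrFun (congrArg _ hx) i).trans (gradient_apply φ x i)

/-! ### Smooth functions vanishing on the unit circle belong to `H_0^1` -/

theorem exists_bound_deriv_smoothTransition :
    ∃ C : ℝ, 0 ≤ C ∧ ∀ x, |deriv Real.smoothTransition x| ≤ C := by
  have hc : Continuous (deriv Real.smoothTransition) :=
    (Real.smoothTransition.contDiff (n := 1)).continuous_deriv le_rfl
  obtain ⟨C, hC⟩ := (isCompact_Icc (a := (0 : ℝ)) (b := 1)).exists_bound_of_continuousOn
    hc.continuousOn
  have hC0 : 0 ≤ C := (norm_nonneg _).trans (hC 0 (by simp))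
  refine ⟨C, hC0, fun x => ?_⟩
  rcases lt_or_ge x 0 with hx | hx
  · have : Real.smoothTransition =ᶠ[𝓝 x] fun _ => 0 := by
      filter_upwards [Iio_mem_nhds hx] with y hy
      exact Real.smoothTransition.zero_of_nonpos (le_of_lt hy)
    rw [this.deriv_eq]
    simpa using hC0
  rcases lt_or_ge 1 x with hx1 | hx1
  · have : Real.smoothTransition =ᶠ[𝓝 x] fun _ => 1 := by
      filter_upwards [Ioi_mem_nhds hx1] with y hy
      exact Real.smoothTransition.one_of_one_le (le_of_lt hy)
    rw [this.deriv_eq]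
    simpa using hC0
  · exact hC x ⟨hx, hx1⟩

theorem deriv_smoothTransition_of_one_lt {x : ℝ} (hx : 1 < x) :
    deriv Real.smoothTransition x = 0 := by
  have : Real.smoothTransition =ᶠ[𝓝 x] fun _ => 1 := by
    filter_upwards [Ioi_mem_nhds hx] with y hy
    exact Real.smoothTransition.one_of_one_le (le_of_lt hy)
  rw [this.deriv_eq, deriv_const]

/-- A smooth function that vanishes for `|x|² ≤ 1 + 1/n` and is `1` for `|x|² ≥ 1 + 2/n`. -/
def bdryCutoff (n : ℝ) (x : Plane) : ℝ := Real.smoothTransition (n * (‖x‖ ^ 2 - 1) - 1)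

theorem contDiff_bdryCutoff (n : ℝ) : ContDiff ℝ ∞ (bdryCutoff n) :=
  Real.smoothTransition.contDiff.comp
    ((contDiff_const.mul ((contDiff_norm_sq ℝ).sub contDiff_const)).sub contDiff_const)

theorem hasFDerivAt_bdryCutoff (n : ℝ) (x : Plane) :
    HasFDerivAt (bdryCutoff n) ((deriv Real.smoothTransition (n * (‖x‖ ^ 2 - 1) - 1) * (n * 2)) •
      innerSL ℝ x) x := by
  have h1 : HasDerivAt Real.smoothTransition
      (deriv Real.smoothTransition (n * (‖x‖ ^ 2 - 1) - 1)) (n * (‖x‖ ^ 2 - 1) - 1) :=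
    ((Real.smoothTransition.contDiff (n := 1)).differentiable (by simp) _).hasDerivAt
  have h2 : HasFDerivAt (fun x : Plane => n * (‖x‖ ^ 2 - 1) - 1)
      ((n * 2) • innerSL ℝ x) x := by
    have := (((hasStrictFDerivAt_norm_sq x).hasFDerivAt.sub_const 1).const_mul n).sub_const 1
    refine this.congr_fderiv ?_
    ext y; simp; ring
  refine (h1.comp_hasFDerivAt x h2).congr_fderiv ?_
  rw [smul_smul]

theorem isTest_bdryCutoff_mul {φ : Plane → ℝ} (hφ : IsSmoothCpt φ) {n : ℝ} (hn : 0 < n) :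
    IsTest (fun x => bdryCutoff n x * φ x) := by
  refine ⟨(contDiff_bdryCutoff n).mul hφ.smooth, hφ.compact.mul_left, ?_⟩
  have hcl : IsClosed {x : Plane | 1 / n ≤ ‖x‖ ^ 2 - 1} :=
    isClosed_le continuous_const (by fun_prop)
  have : Function.support (fun x => bdryCutoff n x * φ x) ⊆ {x : Plane | 1 / n ≤ ‖x‖ ^ 2 - 1} := by
    intro x hx
    by_contra h
    simp only [mem_ofPred_eq, not_le] at h
    apply hx
    have : n * (‖x‖ ^ 2 - 1) - 1 ≤ 0 := by
      rw [lt_div_iff₀ hn] at h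
      linarith
    simp [bdryCutoff, Real.smoothTransition.zero_of_nonpos this]
  intro x hx
  have h1 : 1 / n ≤ ‖x‖ ^ 2 - 1 := closure_minimal this hcl hx
  have h2 : 0 < 1 / n := by positivity
  have : 1 < ‖x‖ ^ 2 := by linarith
  exact (one_lt_sq_iff₀ (norm_nonneg x)).1 this

/-- Compare `x` with its radial projection `x/|x|` on the circle: `φ` is Lipschitz, and the distance
`|x| - 1` is at most `|x|² - 1`. -/
theorem exists_bound_of_vanishing {φ : Plane → ℝ} (hφ : IsSmoothCpt φ)
    (h0 : ∀ x : Plane, ‖x‖ = 1 → φ x = 0) :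
    ∃ C : ℝ, 0 ≤ C ∧ ∀ x ∈ Ext, |φ x| ≤ C * (‖x‖ ^ 2 - 1) := by
  obtain ⟨C, hC⟩ := (hφ.smooth.of_le (m := 1) (by simp)).lipschitzWith_of_hasCompactSupport
    hφ.compact (by simp)
  refine ⟨C, C.2, fun x hx => ?_⟩
  have hx1 : 1 < ‖x‖ := hx
  have hxne : ‖x‖ ≠ 0 := by positivity
  have h1 := hC.dist_le_mul x (‖x‖⁻¹ • x)
  rw [h0 (‖x‖⁻¹ • x) (by rw [norm_smul, norm_inv, norm_norm, inv_mul_cancel₀ hxne]), dist_zero_right,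
    Real.norm_eq_abs] at h1
  refine h1.trans (mul_le_mul_of_nonneg_left ?_ C.2)
  have : x - ‖x‖⁻¹ • x = (1 - ‖x‖⁻¹) • x := by rw [sub_smul, one_smul]
  rw [dist_eq_norm, this, norm_smul, Real.norm_eq_abs,
    abs_of_nonneg (by rw [sub_nonneg]; exact inv_le_one_of_one_le₀ hx1.le), sub_mul,
    inv_mul_cancel₀ hxne]
  nlinarith

/-- The pair `(φ, ∇φ)`. -/
def IsSmoothCpt.pair {φ : Plane → ℝ} (hφ : IsSmoothCpt φ) : WithLp 2 (L2 × L2Vec) :=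
  WithLp.toLp 2 (hφ.memLp.toLp φ, hφ.memLp_gradient.toLp (gradient φ))

theorem IsTest.pair_mem {φ : Plane → ℝ} (hφ : IsTest φ) : hφ.isSmoothCpt.pair ∈ H10 :=
  subset_closure ⟨φ, hφ, hφ.isSmoothCpt.memLp.coeFn_toLp, hφ.isSmoothCpt.memLp_gradient.coeFn_toLp⟩

theorem gradient_bdryCutoff_mul {φ : Plane → ℝ} (hφ : IsSmoothCpt φ) (n : ℝ) (x : Plane) :
    gradient (fun x => bdryCutoff n x * φ x) x = bdryCutoff n x • gradient φ x +
      (φ x * (deriv Real.smoothTransition (n * (‖x‖ ^ 2 - 1) - 1) * (n * 2))) • x := by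
  have h : HasFDerivAt (fun x => bdryCutoff n x * φ x) _ x :=
    (hasFDerivAt_bdryCutoff n x).mul (hφ.differentiable x).hasFDerivAt
  rw [gradient, HasFDerivAt.fderiv h, map_add]
  congr 1
  · simp [gradient]
  · rw [smul_smul]
    refine ((InnerProductSpace.toDual ℝ Plane).symm_apply_eq).2 ?_
    ext y
    simp

/-- Multiply `φ` by `bdryCutoff (n + 1)`. The gradient of the cutoff has order `n` but lives where
`|x|² - 1` is of order `1/n`, and there `φ` is of order `1/n`. The extra term `φ ∇(cutoff)` is
therefore bounded uniformly in `n` and is eventually zero at each point, so dominated convergence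
gives convergence in `H¹`. -/
theorem pair_mem_H10 {φ : Plane → ℝ} (hφ : IsSmoothCpt φ)
    (h0 : ∀ x : Plane, ‖x‖ = 1 → φ x = 0) : hφ.pair ∈ H10 := by
  obtain ⟨C, hC0, hC⟩ := exists_bound_of_vanishing hφ h0
  obtain ⟨D, hD0, hD⟩ := exists_bound_deriv_smoothTransition
  obtain ⟨R, hR⟩ := hφ.compact.isCompact.isBounded.exists_norm_le
  obtain ⟨A, hA⟩ := hφ.compact.exists_bound_of_continuous hφ.smooth.continuous
  obtain ⟨A', hA'⟩ := hφ.gradient_compact.exists_bound_of_continuous hφ.gradient_continuous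
  have hpos : ∀ n : ℕ, (0 : ℝ) < n + 1 := fun n => by positivity
  set F : ℕ → Plane → ℝ := fun n x => bdryCutoff (n + 1) x * φ x with hF
  have hT : ∀ n, IsTest (F n) := fun n => isTest_bdryCutoff_mul hφ (hpos n)
  have hcut : ∀ n x, 0 ≤ bdryCutoff n x ∧ bdryCutoff n x ≤ 1 := fun n x =>
    ⟨Real.smoothTransition.nonneg _, Real.smoothTransition.le_one _⟩
  have hev : ∀ x ∈ Ext, ∀ᶠ n : ℕ in atTop, 1 < ((n : ℝ) + 1) * (‖x‖ ^ 2 - 1) - 1 := by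
    intro x hx
    have hx1 : 1 < ‖x‖ := hx
    have h1 : 0 < ‖x‖ ^ 2 - 1 := by nlinarith
    obtain ⟨N, hN⟩ := exists_nat_gt (2 / (‖x‖ ^ 2 - 1))
    filter_upwards [eventually_ge_atTop N] with n hn
    have hn' : (N : ℝ) ≤ n := by exact_mod_cast hn
    have : 2 / (‖x‖ ^ 2 - 1) < n + 1 := by linarith
    rw [div_lt_iff₀ h1] at this
    linarith
  have hK : MeasurableSet (tsupport φ) := hφ.compact.isCompact.measurableSet
  have hfin : ∀ c : ℝ, MemLp ((tsupport φ).indicator fun _ => c) 2 volExt := fun c => by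
    refine memLp_indicator_const 2 hK c (Or.inr ?_)
    exact (hφ.compact.isCompact.measure_lt_top (μ := volExt)).ne
  refine mem_closure_of_tendsto (b := atTop) (f := fun n => (hT n).isSmoothCpt.pair) ?_
    (.of_forall fun n => ⟨F n, hT n, (hT n).isSmoothCpt.memLp.coeFn_toLp,
      (hT n).isSmoothCpt.memLp_gradient.coeFn_toLp⟩)
  refine ((WithLp.prodContinuousLinearEquiv 2 ℝ L2 L2Vec).symm.continuous.tendsto _).comp
    (Tendsto.prodMk_nhds ?_ ?_)
  · refine tendsto_toLp_of_dominated (by simp) (fun n => (hT n).isSmoothCpt.memLp) hφ.memLp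
      (hfin A) (.of_forall fun n => .of_forall fun x => ?_) ?_
    · by_cases hx : x ∈ tsupport φ
      · rw [indicator_of_mem hx, hF]
        have : bdryCutoff (n + 1) x * φ x - φ x = -((1 - bdryCutoff (n + 1) x) * φ x) := by ring
        simp only [this, norm_neg, norm_mul, Real.norm_eq_abs,
          abs_of_nonneg (sub_nonneg.2 (hcut (n + 1) x).2)]
        have h1 := hA x
        rw [Real.norm_eq_abs] at h1
        nlinarith [abs_nonneg (φ x), hcut (n + 1) x]
      · simp [hF, indicator_of_notMem hx, image_eq_zero_of_notMem_tsupport hx]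
    · filter_upwards [ae_restrict_mem measurableSet_Ext] with x hx
      refine tendsto_const_nhds.congr' ?_
      filter_upwards [hev x hx] with n hn
      simp [hF, bdryCutoff, Real.smoothTransition.one_of_one_le hn.le]
  · refine tendsto_toLp_of_dominated (by simp) (fun n => (hT n).isSmoothCpt.memLp_gradient)
      hφ.memLp_gradient (hfin (A' + 4 * (C * D * R))) (.of_forall fun n => ?_) ?_
    · filter_upwards [ae_restrict_mem measurableSet_Ext] with x hx
      rw [gradient_bdryCutoff_mul hφ]
      by_cases hxs : x ∈ tsupport φ
      · rw [indicator_of_mem hxs]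
        have e : ∀ (a b : ℝ) (v w : Plane), a • v + b • w - v = b • w - (1 - a) • v := by
          intros; module
        rw [e, add_comm A']
        refine (norm_sub_le _ _).trans (add_le_add ?_ ?_)
        · rw [norm_smul, Real.norm_eq_abs, abs_mul, abs_mul]
          have hx1 : 1 < ‖x‖ := hx
          have hxp : 0 < ‖x‖ ^ 2 - 1 := by nlinarith
          have hn := hpos n
          have hRx := hR x hxs
          -- The derivative is nonzero only if `(n + 1)(|x|² - 1) ≤ 2`, which absorbs the large
          -- factor `n + 1`.
          have hd : |deriv Real.smoothTransition (((n : ℝ) + 1) * (‖x‖ ^ 2 - 1) - 1)| *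
              |((n : ℝ) + 1) * 2| * (‖x‖ ^ 2 - 1) ≤ 4 * D := by
            rw [abs_of_pos (a := ((n : ℝ) + 1) * 2) (by positivity)]
            rcases lt_or_ge 1 (((n : ℝ) + 1) * (‖x‖ ^ 2 - 1) - 1) with h | h
            · rw [deriv_smoothTransition_of_one_lt h]
              simp only [abs_zero, zero_mul]
              positivity
            · have := hD (((n : ℝ) + 1) * (‖x‖ ^ 2 - 1) - 1)
              calc _ = |deriv Real.smoothTransition (((n : ℝ) + 1) * (‖x‖ ^ 2 - 1) - 1)| *
                    (2 * (((n : ℝ) + 1) * (‖x‖ ^ 2 - 1))) := by ring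
                _ ≤ D * (2 * 2) := by
                    refine mul_le_mul this (by linarith) (by positivity) hD0
                _ = 4 * D := by ring
          calc _ ≤ C * (‖x‖ ^ 2 - 1) *
                (|deriv Real.smoothTransition (((n : ℝ) + 1) * (‖x‖ ^ 2 - 1) - 1)| *
                  |((n : ℝ) + 1) * 2|) * R := by
                refine mul_le_mul (mul_le_mul_of_nonneg_right (hC x hx) (by positivity)) hRx
                  (norm_nonneg _) (by positivity)
            _ = C * (|deriv Real.smoothTransition (((n : ℝ) + 1) * (‖x‖ ^ 2 - 1) - 1)| *
                  |((n : ℝ) + 1) * 2| * (‖x‖ ^ 2 - 1)) * R := by ring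
            _ ≤ C * (4 * D) * R := by
                refine mul_le_mul_of_nonneg_right (mul_le_mul_of_nonneg_left hd hC0)
                  ((norm_nonneg _).trans hRx)
            _ = 4 * (C * D * R) := by ring
        · rw [norm_smul, Real.norm_eq_abs, abs_of_nonneg (sub_nonneg.2 (hcut (n + 1) x).2)]
          have h1 := hA' x
          nlinarith [norm_nonneg (gradient φ x), hcut (n + 1) x]
      · have h1 : gradient φ x = 0 := by
          rw [gradient, fderiv_of_notMem_tsupport (𝕜 := ℝ) hxs, map_zero]
        simp [h1, image_eq_zero_of_notMem_tsupport hxs, indicator_of_notMem hxs]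
    · filter_upwards [ae_restrict_mem measurableSet_Ext] with x hx
      refine tendsto_const_nhds.congr' ?_
      filter_upwards [hev x hx] with n hn
      rw [gradient_bdryCutoff_mul hφ, deriv_smoothTransition_of_one_lt hn, bdryCutoff,
        Real.smoothTransition.one_of_one_le hn.le]
      simp

/-- `H²` functions from smooth functions on the whole plane. -/
theorem IsSmoothCpt.hasWeakPartial {φ : Plane → ℝ} (hφ : IsSmoothCpt φ) (i : Fin 2) :
    HasWeakPartial i (hφ.memLp.toLp φ) ((hφ.partialD i).memLp.toLp _) := by
  intro ψ hψ
  have e1 : ∫ x in Ext, (hφ.memLp.toLp φ) x * fderiv ℝ ψ x (EuclideanSpace.single i 1) =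
      ∫ x in Ext, φ x * ExteriorDampedWave.partialD i ψ x :=
    integral_congr_ae (hφ.memLp.coeFn_toLp.mono fun x hx => by
      simp only [hx, ExteriorDampedWave.partialD])
  have e2 : ∫ x in Ext, ((hφ.partialD i).memLp.toLp _) x * ψ x =
      ∫ x in Ext, ExteriorDampedWave.partialD i φ x * ψ x :=
    integral_congr_ae ((hφ.partialD i).memLp.coeFn_toLp.mono fun x hx => by simp only [hx])
  rw [e1, e2, setIntegral_Ext_eq fun x hx => by rw [hψ.partialD_eq_zero i hx, mul_zero],
    setIntegral_Ext_eq fun x hx => by rw [hψ.eq_zero hx, mul_zero]]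
  exact integral_mul_partialD hφ hψ.isSmoothCpt i

theorem IsSmoothCpt.h2Laplacian {φ : Plane → ℝ} (hφ : IsSmoothCpt φ) :
    H2Laplacian (hφ.memLp.toLp φ) (hφ.lap.memLp.toLp _) := by
  refine ⟨fun i => (hφ.partialD i).memLp.toLp _,
    fun i j => ((hφ.partialD i).partialD j).memLp.toLp _, fun i => hφ.hasWeakPartial i,
    fun i j => (hφ.partialD i).hasWeakPartial j, ?_⟩
  rw [Fin.sum_univ_two, ← MemLp.toLp_add]
  refine MemLp.toLp_congr _ _ (.of_forall fun x => ?_)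
  simp [ExteriorDampedWave.lap, Fin.sum_univ_two]

/-! ### Radial functions with a smooth profile -/

/-- Smooth profiles of radial functions: smooth functions supported in a bounded subset of
`[1/2, ∞)`. -/
structure IsProfile (f : ℝ → ℝ) : Prop where
  smooth : ContDiff ℝ ∞ f
  low : ∀ r ≤ 1 / 2, f r = 0
  high : ∃ R, ∀ r, R ≤ r → f r = 0

/-- The radial function with profile `f`. -/
def radial (f : ℝ → ℝ) : Plane → ℝ := fun x => f ‖x‖

theorem hasFDerivAt_norm {x : Plane} (hx : x ≠ 0) :
    HasFDerivAt (fun x : Plane => ‖x‖) (‖x‖⁻¹ • innerSL ℝ x) x := by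
  have h := (hasStrictFDerivAt_norm_sq x).hasFDerivAt.sqrt (by positivity)
  simp only [Real.sqrt_sq (norm_nonneg _)] at h
  refine h.congr_fderiv ?_
  ext y
  simp
  field_simp

namespace IsProfile

variable {f : ℝ → ℝ}

theorem differentiable (h : IsProfile f) : Differentiable ℝ f := h.smooth.differentiable (by simp)

theorem deriv_low (h : IsProfile f) : ∀ r ≤ 1 / 2, deriv f r = 0 := by
  have hc : Continuous (_root_.deriv f) := h.smooth.continuous_deriv (by simp)
  have hcl : IsClosed {r | _root_.deriv f r = 0} := isClosed_eq hc continuous_const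
  have hsub : Iio (1 / 2 : ℝ) ⊆ {r | _root_.deriv f r = 0} := fun r hr => by
    have : f =ᶠ[𝓝 r] fun _ => 0 := by
      filter_upwards [Iio_mem_nhds hr] with y hy
      exact h.low y (le_of_lt hy)
    simp [this.deriv_eq]
  intro r hr
  have := closure_minimal hsub hcl
  rw [closure_Iio] at this
  exact this hr

theorem deriv (h : IsProfile f) : IsProfile (deriv f) := by
  refine ⟨h.smooth.deriv' , h.deriv_low, ?_⟩
  obtain ⟨R, hR⟩ := h.high
  refine ⟨R + 1, fun r hr => ?_⟩
  have : f =ᶠ[𝓝 r] fun _ => 0 := by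
    filter_upwards [Ioi_mem_nhds (show R < r by linarith)] with y hy
    exact hR y (le_of_lt hy)
  simp [this.deriv_eq]

/-- Since profiles vanish for `r ≤ 1/2`, factors singular at the origin, such as `1/r` or `log r`,
do no harm. -/
theorem mul_smoothOn (h : IsProfile f) {g : ℝ → ℝ} (hg : ContDiffOn ℝ ∞ g (Ioi 0)) :
    IsProfile (fun r => f r * g r) := by
  refine ⟨contDiff_iff_contDiffAt.2 fun r => ?_, fun r hr => by rw [h.low r hr, zero_mul], ?_⟩
  · rcases lt_or_ge r (1 / 2) with hr | hr
    · refine (contDiffAt_const (c := (0 : ℝ))).congr_of_eventuallyEq ?_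
      filter_upwards [Iio_mem_nhds hr] with y hy
      rw [h.low y (le_of_lt hy), zero_mul]
    · exact h.smooth.contDiffAt.mul (hg.contDiffAt (Ioi_mem_nhds (by linarith)))
  · obtain ⟨R, hR⟩ := h.high
    exact ⟨R, fun r hr => by rw [hR r hr, zero_mul]⟩

theorem deriv_div (h : IsProfile f) : IsProfile (fun r => _root_.deriv f r / r) := by
  simp_rw [div_eq_mul_inv]
  exact h.deriv.mul_smoothOn (contDiffOn_id.inv fun x hx => (ne_of_gt hx))

theorem isSmoothCpt (h : IsProfile f) : IsSmoothCpt (radial f) := by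
  refine ⟨contDiff_iff_contDiffAt.2 fun x => ?_, ?_⟩
  · by_cases hx : x = 0
    · subst hx
      refine (contDiffAt_const (c := (0 : ℝ))).congr_of_eventuallyEq ?_
      filter_upwards [Metric.ball_mem_nhds (0 : Plane) (show (0 : ℝ) < 1 / 2 by norm_num)] with y hy
      exact h.low _ (by simpa using le_of_lt (mem_ball_zero_iff.1 hy))
    · exact h.smooth.contDiffAt.comp x (contDiffAt_norm ℝ hx)
  · obtain ⟨R, hR⟩ := h.high
    refine HasCompactSupport.intro (isCompact_closedBall (0 : Plane) R) fun x hx => ?_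
    exact hR _ (le_of_lt (by simpa using hx))

theorem hasFDerivAt (h : IsProfile f) (x : Plane) :
    HasFDerivAt (radial f) ((_root_.deriv f ‖x‖ / ‖x‖) • innerSL ℝ x) x := by
  by_cases hx : x = 0
  · subst hx
    have : radial f =ᶠ[𝓝 0] fun _ => 0 := by
      filter_upwards [Metric.ball_mem_nhds (0 : Plane) (show (0 : ℝ) < 1 / 2 by norm_num)] with y hy
      exact h.low _ (by simpa using le_of_lt (mem_ball_zero_iff.1 hy))
    simpa using (hasFDerivAt_const (0 : ℝ) (0 : Plane)).congr_of_eventuallyEq this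
  · have := ((h.differentiable ‖x‖).hasDerivAt).comp_hasFDerivAt x (hasFDerivAt_norm hx)
    rwa [smul_smul, ← div_eq_mul_inv] at this

theorem partialD (h : IsProfile f) (i : Fin 2) :
    partialD i (radial f) = fun x => radial (fun r => _root_.deriv f r / r) x * x i := by
  ext x
  rw [ExteriorDampedWave.partialD, (h.hasFDerivAt x).fderiv]
  simp [radial, basisVec, EuclideanSpace.inner_single_right]

/-- The first derivatives are `g(|x|) xᵢ` with `g = f'/r`. As `g` is again a profile, the gradient
formula for radial functions applies a second time. -/
theorem lap (h : IsProfile f) {x : Plane} (hx : x ≠ 0) :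
    lap (radial f) x = _root_.deriv (_root_.deriv f) ‖x‖ + _root_.deriv f ‖x‖ / ‖x‖ := by
  set g : ℝ → ℝ := fun r => _root_.deriv f r / r with hg
  have hgp : IsProfile g := h.deriv_div
  have hr : ‖x‖ ≠ 0 := by positivity
  have key : ∀ i, ExteriorDampedWave.partialD i (ExteriorDampedWave.partialD i (radial f)) x =
      _root_.deriv g ‖x‖ / ‖x‖ * x i * x i + g ‖x‖ := by
    intro i
    rw [h.partialD i, ExteriorDampedWave.partialD]
    have h2 : HasFDerivAt (fun x : Plane => x i) (EuclideanSpace.proj i : Plane →L[ℝ] ℝ) x :=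
      (EuclideanSpace.proj i : Plane →L[ℝ] ℝ).hasFDerivAt
    have h3 : HasFDerivAt (fun x => radial g x * x i) _ x := (hgp.hasFDerivAt x).mul h2
    rw [h3.fderiv]
    simp [radial, basisVec, EuclideanSpace.inner_single_right]
    ring
  have hd : _root_.deriv g ‖x‖ = (_root_.deriv (_root_.deriv f) ‖x‖ * ‖x‖ - _root_.deriv f ‖x‖) / ‖x‖ ^ 2 := by
    rw [hg, deriv_fun_div (h.deriv.differentiable _) differentiableAt_fun_id hr]
    simp
  have hn : ‖x‖ ^ 2 = x 0 * x 0 + x 1 * x 1 := by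
    rw [EuclideanSpace.norm_sq_eq, Fin.sum_univ_two]
    simp [sq]
  have e : ExteriorDampedWave.lap (radial f) x = _root_.deriv g ‖x‖ / ‖x‖ * ‖x‖ ^ 2 + 2 * g ‖x‖ := by
    rw [ExteriorDampedWave.lap, Fin.sum_univ_two, key, key, hn]
    ring
  rw [e, hd, hg]
  field_simp
  ring

theorem pair_mem_H10 (h : IsProfile f) (h1 : f 1 = 0) : h.isSmoothCpt.pair ∈ H10 :=
  ExteriorDampedWave.pair_mem_H10 _ fun x hx => by rw [radial, hx, h1]

end IsProfile

/-- A smooth function equal to `0` for `r ≤ 1/2` and to `1` for `r ≥ 3/4`. -/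
def innerCutoff (r : ℝ) : ℝ := Real.smoothTransition (4 * r - 2)

theorem innerCutoff_of_le {r : ℝ} (hr : r ≤ 1 / 2) : innerCutoff r = 0 :=
  Real.smoothTransition.zero_of_nonpos (by linarith)

theorem innerCutoff_of_ge {r : ℝ} (hr : 3 / 4 ≤ r) : innerCutoff r = 1 :=
  Real.smoothTransition.one_of_one_le (by linarith)

theorem contDiff_innerCutoff : ContDiff ℝ ∞ innerCutoff :=
  Real.smoothTransition.contDiff.comp ((contDiff_const.mul contDiff_id).sub contDiff_const)

/-- A smooth function equal to `1` for `r ≤ R` and to `0` for `r ≥ R + 1`. -/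
def outerCutoff (R r : ℝ) : ℝ := Real.smoothTransition (R + 1 - r)

theorem outerCutoff_of_le {R r : ℝ} (hr : r ≤ R) : outerCutoff R r = 1 :=
  Real.smoothTransition.one_of_one_le (by linarith)

theorem outerCutoff_of_ge {R r : ℝ} (hr : R + 1 ≤ r) : outerCutoff R r = 0 :=
  Real.smoothTransition.zero_of_nonpos (by linarith)

theorem contDiff_outerCutoff (R : ℝ) : ContDiff ℝ ∞ (outerCutoff R) :=
  Real.smoothTransition.contDiff.comp (contDiff_const.sub contDiff_id)

theorem isProfile_cutoff (R : ℝ) : IsProfile (fun r => innerCutoff r * outerCutoff R r) :=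
  ⟨contDiff_innerCutoff.mul (contDiff_outerCutoff R),
    fun r hr => by rw [innerCutoff_of_le hr, zero_mul],
    R + 1, fun r hr => by rw [outerCutoff_of_ge hr, mul_zero]⟩

/-! ### Strongly continuous semigroups: growth, orbits and Duhamel's formula -/

namespace IsC0Semigroup

variable {X : Type*} [NormedAddCommGroup X] [NormedSpace ℝ X] {T : ℝ≥0 → X →L[ℝ] X}

/-- Uniform boundedness principle: each orbit is bounded on the compact interval `[0, τ]`. -/
theorem exists_bound [CompleteSpace X] (hT : IsC0Semigroup T) (τ : ℝ≥0) :
    ∃ M : ℝ, 0 ≤ M ∧ ∀ t ≤ τ, ‖T t‖ ≤ M := by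
  obtain ⟨C, hC⟩ := banach_steinhaus (g := fun t : Iic τ => T t) fun x => by
    have hK : IsCompact (Iic τ) := by
      rw [← Icc_bot]
      exact isCompact_Icc
    obtain ⟨C, hC⟩ := hK.exists_bound_of_continuousOn (hT.continuous x).continuousOn
    exact ⟨C, fun t => hC t t.2⟩
  refine ⟨C, (norm_nonneg _).trans (hC ⟨0, by simp⟩), fun t ht => hC ⟨t, ht⟩⟩

/-- Strong continuity together with the local operator bound gives joint continuity in time and
vector. -/
theorem tendsto_apply [CompleteSpace X] (hT : IsC0Semigroup T) {ι : Type*} {l : Filter ι}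
    {a : ι → ℝ≥0} {x : ι → X} {a₀ : ℝ≥0} {x₀ : X} (ha : Tendsto a l (𝓝 a₀))
    (hx : Tendsto x l (𝓝 x₀)) : Tendsto (fun i => T (a i) (x i)) l (𝓝 (T a₀ x₀)) := by
  obtain ⟨M, hM0, hM⟩ := hT.exists_bound (a₀ + 1)
  have h1 : Tendsto (fun i => T (a i) x₀) l (𝓝 (T a₀ x₀)) :=
    ((hT.continuous x₀).tendsto a₀).comp ha
  have h2 : Tendsto (fun i => T (a i) (x i - x₀)) l (𝓝 0) := by
    have h3 : Tendsto (fun i => M * ‖x i - x₀‖) l (𝓝 0) := by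
      simpa using ((hx.sub_const x₀).norm).const_mul M
    refine squeeze_zero_norm' ?_ h3
    have : Iio (a₀ + 1) ∈ 𝓝 a₀ := Iio_mem_nhds (by simp)
    filter_upwards [ha this] with i hi
    exact (T (a i)).le_of_opNorm_le (hM _ (le_of_lt hi)) _
  simpa using h1.add h2

variable {G : X → X → Prop}

theorem generator_apply (hT : IsC0Semigroup T) (hG : IsGenerator T G) {x y : X} (h : G x y)
    (t : ℝ≥0) : G (T t x) (T t y) := by
  rw [hG] at h ⊢
  refine (((T t).continuous.tendsto y).comp h).congr fun s => ?_
  have e : T s (T t x) = T t (T s x) := by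
    rw [← ContinuousLinearMap.comp_apply, ← hT.add, add_comm, hT.add]
    rfl
  simp [e]

theorem tendsto_toNNReal_sub (s : ℝ) :
    Tendsto (fun z : ℝ => (z - s).toNNReal) (𝓝[>] s) (𝓝[>] 0) := by
  refine tendsto_nhdsWithin_iff.2 ⟨?_, ?_⟩
  · have : Continuous fun z : ℝ => (z - s).toNNReal := by fun_prop
    have h := this.tendsto s
    simp only [sub_self, Real.toNNReal_zero] at h
    exact h.mono_left nhdsWithin_le_nhds
  · filter_upwards [self_mem_nhdsWithin] with z hz
    simpa using hz

/-- Only the right derivative comes directly from the definition of the generator. It is all that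
the comparison lemmas for one-sided derivatives require. -/
theorem hasDerivWithinAt_orbit [CompleteSpace X] (hT : IsC0Semigroup T) (hG : IsGenerator T G)
    {x y : X} (h : G x y) {s : ℝ} (hs : 0 ≤ s) :
    HasDerivWithinAt (fun s : ℝ => T s.toNNReal x) (T s.toNNReal y) (Ici s) s := by
  rw [hasDerivWithinAt_iff_tendsto_slope, Ici_sdiff_left]
  have h1 := ((hG _ _).1 (hT.generator_apply hG h s.toNNReal)).comp (tendsto_toNNReal_sub s)
  refine h1.congr' ?_
  filter_upwards [self_mem_nhdsWithin] with z hz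
  have hz' : s < z := hz
  have e : z.toNNReal = (z - s).toNNReal + s.toNNReal := by
    rw [← Real.toNNReal_add (by linarith) hs]
    simp
  simp only [Function.comp, slope_def_module, e, hT.add, ContinuousLinearMap.comp_apply]
  rw [Real.coe_toNNReal _ (by linarith)]

/-- For `z > s`, factor out `T(t - z)`: the increment equals `T(t - z)` applied to `(k(z) - k(s)) -
(T(z - s) k(s) - k(s))`. Only `k(s)` itself has to lie in the domain. -/
theorem hasDerivWithinAt_duhamel [CompleteSpace X] (hT : IsC0Semigroup T) (hG : IsGenerator T G)
    {t s : ℝ} (hst : s < t) {k : ℝ → X} {k' y : X}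
    (hk : HasDerivWithinAt k k' (Ici s) s) (h : G (k s) y) :
    HasDerivWithinAt (fun s : ℝ => T (t - s).toNNReal (k s)) (T (t - s).toNNReal (k' - y))
      (Ici s) s := by
  rw [hasDerivWithinAt_iff_tendsto_slope, Ici_sdiff_left] at hk ⊢
  have h1 := ((hG _ _).1 h).comp (tendsto_toNNReal_sub s)
  have hc : Tendsto (fun z : ℝ => (t - z).toNNReal) (𝓝[>] s) (𝓝 (t - s).toNNReal) := by
    have : Continuous fun z : ℝ => (t - z).toNNReal := by fun_prop
    exact (this.tendsto s).mono_left nhdsWithin_le_nhds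
  refine (hT.tendsto_apply hc (hk.sub h1)).congr' ?_
  have hlt : ∀ᶠ z in 𝓝[>] s, z < t := nhdsWithin_le_nhds (Iio_mem_nhds hst)
  filter_upwards [self_mem_nhdsWithin, hlt] with z hz hzt
  have hz' : s < z := hz
  have e : (t - s).toNNReal = (t - z).toNNReal + (z - s).toNNReal := by
    rw [← Real.toNNReal_add (by linarith) (by linarith)]
    congr 1
    ring
  simp only [Function.comp, slope_def_module, e, hT.add, ContinuousLinearMap.comp_apply]
  rw [Real.coe_toNNReal _ (by linarith), ← smul_sub, map_smul]
  congr 1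
  simp only [map_sub]
  abel

theorem continuous_real (hT : IsC0Semigroup T) (x : X) :
    Continuous fun s : ℝ => T s.toNNReal x :=
  (hT.continuous x).comp continuous_real_toNNReal

end IsC0Semigroup

/-! ### The solution operators -/

instance : CompleteSpace H10 :=
  (Submodule.isClosed_topologicalClosure testGraph).completeSpace_coe

instance : CompleteSpace Energy := WithLp.instProdCompleteSpace 2 H10 L2

/-- The continuous linear inclusion `H_0^1 → L²`. -/
def toL2CLM : H10 →L[ℝ] L2 := (WithLp.fstL 2 ℝ L2 L2Vec).comp H10.subtypeL

theorem toL2CLM_apply (u : H10) : toL2CLM u = H10.toL2 u := rfl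

/-- The first component of an element of the energy space, as an `L²` function. -/
def posCLM : Energy →L[ℝ] L2 := toL2CLM.comp (WithLp.fstL 2 ℝ H10 L2)

/-- The second component of an element of the energy space. -/
def velCLM : Energy →L[ℝ] L2 := WithLp.sndL 2 ℝ H10 L2

/-- The initial datum `(0, g)`. -/
def dataCLM : L2 →L[ℝ] Energy :=
  ((WithLp.prodContinuousLinearEquiv 2 ℝ H10 L2).symm : H10 × L2 →L[ℝ] Energy).comp
    (ContinuousLinearMap.inr ℝ H10 L2)

/-- The solution operator `g ↦ P₁ T(t) (0, g)`. -/
def solCLM (T : ℝ≥0 → Energy →L[ℝ] Energy) (t : ℝ≥0) : L2 →L[ℝ] L2 :=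
  posCLM.comp ((T t).comp dataCLM)

theorem posCLM_dataCLM (g : L2) : posCLM (dataCLM g) = 0 := rfl

theorem velCLM_dataCLM (g : L2) : velCLM (dataCLM g) = g := rfl

section wave

variable {T : ℝ≥0 → Energy →L[ℝ] Energy}

theorem continuous_solCLM (hT : IsC0Semigroup T) (g : L2) : Continuous fun t => solCLM T t g :=
  posCLM.continuous.comp (hT.continuous _)

theorem exists_bound_solCLM (hT : IsC0Semigroup T) (τ : ℝ≥0) :
    ∃ M : ℝ, 0 ≤ M ∧ ∀ t ≤ τ, ‖solCLM T t‖ ≤ M := by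
  obtain ⟨M, hM0, hM⟩ := hT.exists_bound τ
  refine ⟨‖posCLM‖ * (M * ‖dataCLM‖), by positivity, fun t ht => ?_⟩
  refine (ContinuousLinearMap.opNorm_comp_le _ _).trans ?_
  gcongr
  refine (ContinuousLinearMap.opNorm_comp_le _ _).trans ?_
  gcongr
  exact hM t ht

/-- A test function as initial velocity is in the domain of the wave operator. -/
theorem waveOp_dataCLM {φ : Plane → ℝ} (hφ : IsTest φ) :
    waveOp (dataCLM (hφ.isSmoothCpt.memLp.toLp φ))
      (WithLp.toLp 2 (⟨hφ.isSmoothCpt.pair, hφ.pair_mem⟩, -hφ.isSmoothCpt.memLp.toLp φ)) := by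
  refine ⟨rfl, 0, ?_, ?_⟩
  · refine ⟨0, 0, fun i ψ _ => ?_, fun i j ψ _ => ?_, by simp⟩
    all_goals
      have e : ∀ F : Plane → ℝ, ∫ x in Ext, (0 : L2) x * F x = 0 := fun F => by
        rw [integral_congr_ae (g := fun _ => (0 : ℝ)), integral_zero]
        filter_upwards [Lp.coeFn_zero ℝ 2 volExt] with x hx
        rw [hx]
        simp
      exact (e _).trans (neg_eq_zero.2 (e ψ)).symm
  · change -hφ.isSmoothCpt.memLp.toLp φ = 0 - hφ.isSmoothCpt.memLp.toLp φ
    rw [zero_sub]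

/-- If `∫ u Δφ ≤ 0` up to time `t` for the solution `u` with initial velocity `g`, then
`∫ u(t) φ ≤ (1 - e^{-t}) ∫ g φ`. -/
theorem inner_solCLM_le (hT : IsC0Semigroup T) (hG : IsGenerator T waveOp) {g : Plane → ℝ}
    (hg : IsTest g) {φ : Plane → ℝ} (hφ : IsSmoothCpt φ) (hφ0 : hφ.pair ∈ H10)
    (t : ℝ≥0) (hneg : ∀ s ≤ t,
      inner ℝ (hφ.lap.memLp.toLp _) (solCLM T s (hg.isSmoothCpt.memLp.toLp g)) ≤ 0) :
    inner ℝ (hφ.memLp.toLp φ) (solCLM T t (hg.isSmoothCpt.memLp.toLp g)) ≤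
      (1 - Real.exp (-t)) * inner ℝ (hφ.memLp.toLp φ) (hg.isSmoothCpt.memLp.toLp g) := by
  set g₂ : L2 := hg.isSmoothCpt.memLp.toLp g
  set φ₂ : L2 := hφ.memLp.toLp φ
  set x₀ : Energy := dataCLM g₂
  obtain ⟨y₀, hy₀⟩ : ∃ y, waveOp x₀ y := ⟨_, waveOp_dataCLM hg⟩
  set a : ℝ → ℝ := fun s => inner ℝ φ₂ (posCLM (T s.toNNReal x₀)) with ha
  set b : ℝ → ℝ := fun s => inner ℝ φ₂ (velCLM (T s.toNNReal x₀)) with hb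
  have hac : Continuous a := continuous_const.inner (posCLM.continuous.comp (hT.continuous_real x₀))
  have hbc : Continuous b := continuous_const.inner (velCLM.continuous.comp (hT.continuous_real x₀))
  -- With `a = ⟨φ, u⟩` and `b = ⟨φ, ∂ₜu⟩` the equation becomes `a' = b`, `b' = ⟨Δφ, u⟩ - b`. Moving
  -- the Laplacian onto `φ` uses the boundary values of both `u` and `φ`.
  have hderiv : ∀ s : ℝ, 0 ≤ s → HasDerivWithinAt a (b s) (Ici s) s ∧
      HasDerivWithinAt b (inner ℝ (hφ.lap.memLp.toLp _) (posCLM (T s.toNNReal x₀)) - b s)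
        (Ici s) s := by
    intro s hs
    have h1 := hT.hasDerivWithinAt_orbit hG hy₀ hs
    obtain ⟨h2, f, hf, h3⟩ := hT.generator_apply hG hy₀ s.toNNReal
    have e1 : posCLM (T s.toNNReal y₀) = velCLM (T s.toNNReal x₀) := h2
    have e2 : velCLM (T s.toNNReal y₀) = f - velCLM (T s.toNNReal x₀) := h3
    constructor
    · have := ((innerSL ℝ φ₂).comp posCLM).hasFDerivAt.comp_hasDerivWithinAt s h1
      simp only [ContinuousLinearMap.comp_apply, e1] at this
      exact this
    · have := ((innerSL ℝ φ₂).comp velCLM).hasFDerivAt.comp_hasDerivWithinAt s h1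
      simp only [ContinuousLinearMap.comp_apply, e2, map_sub] at this
      have e3 : inner ℝ φ₂ f = inner ℝ (hφ.lap.memLp.toLp _) (posCLM (T s.toNNReal x₀)) := by
        rw [inner_toLp_eq, inner_toLp_eq]
        exact H2Laplacian.integral_mul_lap ((T s.toNNReal x₀).fst).2 hf hφ hφ0
      rw [innerSL_apply_apply, e3] at this
      exact this
  have hb0 : b 0 = inner ℝ φ₂ g₂ := by
    simp [hb, hT.zero, x₀, velCLM_dataCLM]
  have ha0 : a 0 = 0 := by simp [ha, hT.zero, x₀, posCLM_dataCLM]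
  -- The integrating factor gives `(e^s b)' = e^s ⟨Δφ, u⟩ ≤ 0`. Integrating the resulting bound on
  -- `a'` then yields the factor `1 - e^{-t}`.
  have hble : ∀ s : ℝ, 0 ≤ s → s ≤ t → b s ≤ Real.exp (-s) * b 0 := by
    intro s hs hst
    have h := image_le_of_deriv_right_le_deriv_boundary (a := 0) (b := s)
      (f := fun s => Real.exp s * b s) (B := fun _ => b 0) (B' := fun _ => 0)
      (f' := fun s => Real.exp s * b s +
        Real.exp s * (inner ℝ (hφ.lap.memLp.toLp _) (posCLM (T s.toNNReal x₀)) - b s))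
      (Real.continuous_exp.mul hbc).continuousOn
      (fun z hz => (Real.hasDerivAt_exp z).hasDerivWithinAt.mul (hderiv z hz.1).2)
      (by simp) continuousOn_const (fun z _ => hasDerivWithinAt_const _ _ _)
      (fun z hz => ?_) (right_mem_Icc.2 hs)
    · rw [Real.exp_neg, ← div_eq_inv_mul, le_div_iff₀ (Real.exp_pos s), mul_comm]
      exact h
    · have := hneg z.toNNReal (Real.toNNReal_le_iff_le_coe.2 (hz.2.le.trans hst))
      have h4 : inner ℝ (hφ.lap.memLp.toLp _) (posCLM (T z.toNNReal x₀)) ≤ 0 := this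
      nlinarith [Real.exp_pos z]
  have := image_le_of_deriv_right_le_deriv_boundary (a := 0) (b := t)
      (f := a) (B := fun s => (1 - Real.exp (-s)) * b 0)
      (B' := fun s => Real.exp (-s) * b 0) (f' := b) hac.continuousOn
      (fun z hz => (hderiv z hz.1).1) (by simp [ha0]) (by fun_prop)
      (fun z _ => ?_) (fun z hz => hble z hz.1 hz.2.le) (right_mem_Icc.2 t.2)
  · simp only [ha, hb0, Real.toNNReal_coe] at this
    exact this
  · have h1 : HasDerivAt (fun s : ℝ => (1 - Real.exp (-s)) * b 0) (Real.exp (-z) * b 0) z := by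
      have h2 : HasDerivAt (fun s : ℝ => Real.exp (-s)) (-Real.exp (-z)) z := by
        simpa using (hasDerivAt_neg z).exp
      simpa using (h2.const_sub 1).mul_const (b 0)
    exact h1.hasDerivWithinAt

end wave

/-! ### Differentiation of `L²`-valued curves -/

/-- Curves of compactly supported functions that are pointwise `C¹` in the parameter are
differentiable in `L²`. -/
theorem hasDerivAt_toLp {E : Type*} [NormedAddCommGroup E] [NormedSpace ℝ E]
    {H H' : ℝ → Plane → E} (hd : ∀ s x, HasDerivAt (fun s => H s x) (H' s x) s)
    (hc' : Continuous (Function.uncurry H'))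
    (hsupp : ∀ S, ∃ R, ∀ s, |s| ≤ S → ∀ x, R ≤ ‖x‖ → H s x = 0 ∧ H' s x = 0)
    (hm : ∀ s, MemLp (H s) 2 volExt) (hm' : ∀ s, MemLp (H' s) 2 volExt) (s : ℝ) :
    HasDerivAt (fun s => (hm s).toLp (H s)) ((hm' s).toLp (H' s)) s := by
  obtain ⟨R, hR⟩ := hsupp (|s| + 1)
  obtain ⟨C, hC⟩ := ((isCompact_Icc (a := s - 1) (b := s + 1)).prod
    (isCompact_closedBall (0 : Plane) R)).exists_bound_of_continuousOn hc'.continuousOn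
  have habs : ∀ z ∈ Icc (s - 1) (s + 1), |z| ≤ |s| + 1 := fun z hz => by
    have : |z - s| ≤ 1 := abs_le.2 ⟨by linarith [hz.1], by linarith [hz.2]⟩
    calc |z| = |(z - s) + s| := by ring_nf
      _ ≤ |z - s| + |s| := abs_add_le _ _
      _ ≤ _ := by linarith
  have hbd : ∀ z ∈ Icc (s - 1) (s + 1), ∀ x : Plane, ‖x‖ ≤ R → ‖H' z x‖ ≤ C := fun z hz x hx =>
    hC (z, x) ⟨hz, by simpa using hx⟩
  rw [hasDerivAt_iff_tendsto_slope]
  have hsl : ∀ z, MemLp (fun x => slope (fun s => H s x) s z) 2 volExt := fun z => by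
    simp only [slope_def_module]
    exact ((hm z).sub (hm s)).const_smul _
  -- One `C` bounds the difference quotient, by the mean value inequality, and the other bounds the
  -- derivative; both vanish outside a fixed ball for times near `s`.
  have hG : MemLp ((Metric.closedBall (0 : Plane) R).indicator fun _ => C + C) 2 volExt :=
    memLp_indicator_const 2 Metric.isClosed_closedBall.measurableSet _
      (Or.inr ((isCompact_closedBall (0 : Plane) R).measure_lt_top (μ := volExt)).ne)
  have := tendsto_toLp_of_dominated (μ := volExt) (p := 2) (by simp) (l := 𝓝[≠] s) hsl (hm' s) hG
    ?_ (.of_forall fun x => hasDerivAt_iff_tendsto_slope.1 (hd s x))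
  · refine this.congr fun z => ?_
    rw [slope_def_module, ← MemLp.toLp_sub, ← MemLp.toLp_const_smul]
    rfl
  have hnear : ∀ᶠ z in 𝓝[≠] s, z ∈ Icc (s - 1) (s + 1) :=
    nhdsWithin_le_nhds (Icc_mem_nhds (by linarith) (by linarith))
  filter_upwards [hnear] with z hz
  refine .of_forall fun x => ?_
  have hs : s ∈ Icc (s - 1) (s + 1) := ⟨by linarith, by linarith⟩
  by_cases hx : ‖x‖ ≤ R
  · rw [indicator_of_mem (by simpa using hx)]
    refine (norm_sub_le _ _).trans (add_le_add ?_ (hbd s hs x hx))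
    have hC0 : 0 ≤ C := (norm_nonneg _).trans (hbd s hs x hx)
    have h1 := (convex_Icc (s - 1) (s + 1)).norm_image_sub_le_of_norm_hasDerivWithin_le
      (f := fun s => H s x) (fun y _ => (hd y x).hasDerivWithinAt)
      (fun y hy => hbd y hy x hx) hs hz
    rw [slope_def_module, norm_smul, norm_inv]
    rcases eq_or_ne z s with rfl | hzs
    · simpa using hC0
    · rw [inv_mul_le_iff₀ (norm_pos_iff.2 (sub_ne_zero.2 hzs)), mul_comm]
      exact h1
  · have hx' : R ≤ ‖x‖ := le_of_lt (not_le.1 hx)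
    rw [indicator_of_notMem (by simpa using hx), slope_def_module, (hR z (habs z hz) x hx').1,
      (hR s (habs s hs) x hx').1, (hR s (habs s hs) x hx').2]
    simp

/-! ### Damped travelling waves -/

/-- Pairs of smooth functions that cancel near `+∞`. -/
structure IsWavePair (P Q : ℝ → ℝ) : Prop where
  smooth_left : ContDiff ℝ ∞ P
  smooth_right : ContDiff ℝ ∞ Q
  cancel : ∃ B, ∀ y z, B ≤ y → B ≤ z → P y + Q z = 0

namespace IsWavePair

variable {P Q : ℝ → ℝ}

/-- If `P y = -Q z` for all large `y` and `z` independently, then `P` and `Q` are constant near `+∞`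
with opposite values. -/
theorem eventually_const (h : IsWavePair P Q) :
    ∃ B, (∀ y, B ≤ y → deriv P y = 0 ∧ deriv Q y = 0) ∧
      ∀ y z, B ≤ y → B ≤ z → P y + Q z = 0 := by
  obtain ⟨B, hB⟩ := h.cancel
  refine ⟨B + 1, fun y hy => ⟨?_, ?_⟩, fun y z hy hz => hB y z (by linarith) (by linarith)⟩
  · have : P =ᶠ[𝓝 y] fun _ => -Q B := by
      filter_upwards [Ioi_mem_nhds (show B < y by linarith)] with z hz
      linarith [hB z B (le_of_lt hz) le_rfl]
    simp [this.deriv_eq]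
  · have : Q =ᶠ[𝓝 y] fun _ => -P B := by
      filter_upwards [Ioi_mem_nhds (show B < y by linarith)] with z hz
      linarith [hB B z le_rfl (le_of_lt hz)]
    simp [this.deriv_eq]

theorem deriv (h : IsWavePair P Q) : IsWavePair (deriv P) (deriv Q) := by
  obtain ⟨B, hB, -⟩ := h.eventually_const
  exact ⟨h.smooth_left.deriv', h.smooth_right.deriv', B, fun y z hy hz => by
    rw [(hB y hy).1, (hB z hz).2, add_zero]⟩

theorem damp (h : IsWavePair P Q) :
    IsWavePair (fun y => _root_.deriv P y - P y / 2) (fun y => -_root_.deriv Q y - Q y / 2) := by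
  obtain ⟨B, hB, hB'⟩ := h.eventually_const
  refine ⟨h.smooth_left.deriv'.sub (h.smooth_left.div_const _),
    h.smooth_right.deriv'.neg.sub (h.smooth_right.div_const _), B, fun y z hy hz => ?_⟩
  rw [(hB y hy).1, (hB z hz).2]
  linarith [hB' y z hy hz]

theorem deriv_damp_left (h : IsWavePair P Q) : _root_.deriv (fun y => _root_.deriv P y - P y / 2) =
    fun y => _root_.deriv (_root_.deriv P) y - _root_.deriv P y / 2 := by
  ext y
  rw [deriv_fun_sub (h.deriv.smooth_left.differentiable (by simp) y)
    ((h.smooth_left.differentiable (by simp) y).div_const _), deriv_div_const]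

theorem deriv_damp_right (h : IsWavePair P Q) :
    _root_.deriv (fun y => -_root_.deriv Q y - Q y / 2) =
      fun y => -_root_.deriv (_root_.deriv Q) y - _root_.deriv Q y / 2 := by
  ext y
  rw [deriv_fun_sub (h.deriv.smooth_right.differentiable (by simp) y).fun_neg
    ((h.smooth_right.differentiable (by simp) y).div_const _), deriv_div_const, deriv.fun_neg]

end IsWavePair

/-- The function `½ e^{-s/2} ρ(r) (P(r - 1 + s) + Q(r - 1 - s))`. -/
def wave (ρ P Q : ℝ → ℝ) (s r : ℝ) : ℝ :=
  1 / 2 * Real.exp (-s / 2) * ρ r * (P (r - 1 + s) + Q (r - 1 - s))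

/-- The family is closed under time differentiation: the new pair is the one of `IsWavePair.damp`,
where `-1/2` comes from the factor `e^{-s/2}`. Velocity and acceleration of the parametrix are thus
waves of the same form. -/
theorem hasDerivAt_wave_time (ρ : ℝ → ℝ) {P Q : ℝ → ℝ} (h : IsWavePair P Q) (s r : ℝ) :
    HasDerivAt (fun s => wave ρ P Q s r)
      (wave ρ (fun y => deriv P y - P y / 2) (fun y => -deriv Q y - Q y / 2) s r) s := by
  have hP := ((h.smooth_left.differentiable (by simp) (r - 1 + s)).hasDerivAt).comp_const_add
    (r - 1) s
  have hQ := ((h.smooth_right.differentiable (by simp) (r - 1 - s)).hasDerivAt).comp_const_sub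
    (r - 1) s
  have he : HasDerivAt (fun s : ℝ => 1 / 2 * Real.exp (-s / 2) * ρ r)
      (1 / 2 * (Real.exp (-s / 2) * (-1 / 2)) * ρ r) s :=
    ((((hasDerivAt_neg s).div_const 2).exp).const_mul (1 / 2)).mul_const (ρ r)
  refine (he.mul (hP.add hQ)).congr_deriv ?_
  simp only [wave, Pi.add_apply]
  ring

theorem hasDerivAt_wave_space {ρ P Q : ℝ → ℝ} (h : IsWavePair P Q) (s : ℝ) {r : ℝ}
    (hρ : DifferentiableAt ℝ ρ r) :
    HasDerivAt (wave ρ P Q s)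
      (wave (deriv ρ) P Q s r + wave ρ (deriv P) (deriv Q) s r) r := by
  have hP : HasDerivAt (fun r => P (r - 1 + s)) (deriv P (r - 1 + s)) r := by
    have h1 : HasDerivAt (fun r : ℝ => r - 1 + s) 1 r := ((hasDerivAt_id r).sub_const 1).add_const s
    have := ((h.smooth_left.differentiable (by simp) (r - 1 + s)).hasDerivAt).comp r h1
    exact this.congr_deriv (mul_one _)
  have hQ : HasDerivAt (fun r => Q (r - 1 - s)) (deriv Q (r - 1 - s)) r := by
    have h1 : HasDerivAt (fun r : ℝ => r - 1 - s) 1 r := ((hasDerivAt_id r).sub_const 1).sub_const s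
    have := ((h.smooth_right.differentiable (by simp) (r - 1 - s)).hasDerivAt).comp r h1
    exact this.congr_deriv (mul_one _)
  refine ((hρ.hasDerivAt.const_mul (1 / 2 * Real.exp (-s / 2))).mul (hP.add hQ)).congr_deriv ?_
  simp only [wave, Pi.add_apply]

theorem continuous_wave {ρ P Q : ℝ → ℝ} (hρ : Continuous ρ) (hP : Continuous P)
    (hQ : Continuous Q) : Continuous fun p : ℝ × Plane => wave ρ P Q p.1 ‖p.2‖ := by
  unfold wave
  fun_prop

theorem wave_eq_zero {ρ P Q : ℝ → ℝ} {B s r : ℝ} (hB : ∀ y z, B ≤ y → B ≤ z → P y + Q z = 0)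
    (hr : B + 1 + |s| ≤ r) : wave ρ P Q s r = 0 := by
  have h1 := neg_abs_le s
  have h2 := le_abs_self s
  rw [wave, hB _ _ (by linarith) (by linarith), mul_zero]

theorem isProfile_wave {ρ P Q : ℝ → ℝ} (hρ : ContDiff ℝ ∞ ρ) (hρ0 : ∀ r ≤ 1 / 2, ρ r = 0)
    (h : IsWavePair P Q) (s : ℝ) : IsProfile (wave ρ P Q s) := by
  refine ⟨?_, fun r hr => by simp [wave, hρ0 r hr], ?_⟩
  · exact (contDiff_const.mul hρ).mul
      ((h.smooth_left.comp ((contDiff_id.sub contDiff_const).add contDiff_const)).add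
        (h.smooth_right.comp ((contDiff_id.sub contDiff_const).sub contDiff_const)))
  · obtain ⟨B, hB⟩ := h.cancel
    exact ⟨B + 1 + |s|, fun r hr => wave_eq_zero hB hr⟩

/-- Travelling waves multiplied by a continuous field are differentiable in `L²`. -/
theorem hasDerivAt_toLp_wave {E : Type*} [NormedAddCommGroup E] [NormedSpace ℝ E] {v : Plane → E}
    (hv : Continuous v) {ρ P Q : ℝ → ℝ} (hρ : Continuous ρ) (h : IsWavePair P Q)
    (hm : ∀ s, MemLp (fun x => wave ρ P Q s ‖x‖ • v x) 2 volExt)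
    (hm' : ∀ s, MemLp (fun x => wave ρ (fun y => deriv P y - P y / 2)
      (fun y => -deriv Q y - Q y / 2) s ‖x‖ • v x) 2 volExt) (s : ℝ) :
    HasDerivAt (fun s => (hm s).toLp _) ((hm' s).toLp _) s := by
  obtain ⟨B, hB⟩ := h.cancel
  obtain ⟨B', hB'⟩ := h.damp.cancel
  have c1 := h.damp.smooth_left.continuous
  have c2 := h.damp.smooth_right.continuous
  refine hasDerivAt_toLp (fun s x => (hasDerivAt_wave_time ρ h s ‖x‖).smul_const (v x)) ?_ ?_ hm hm' s
  · exact (continuous_wave hρ c1 c2).smul (hv.comp continuous_snd)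
  · intro S
    refine ⟨max B B' + 1 + S, fun s hs x hx => ?_⟩
    have h1 := le_max_left B B'
    have h2 := le_max_right B B'
    rw [wave_eq_zero hB (by linarith), wave_eq_zero hB' (by linarith)]
    simp

theorem memLp_wave {E : Type*} [NormedAddCommGroup E] [NormedSpace ℝ E] {v : Plane → E}
    (hv : Continuous v) {ρ P Q : ℝ → ℝ} (hρ : Continuous ρ) (h : IsWavePair P Q) (s : ℝ) :
    MemLp (fun x => wave ρ P Q s ‖x‖ • v x) 2 volExt := by
  obtain ⟨B, hB⟩ := h.cancel
  have c1 := h.smooth_left.continuous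
  have c2 := h.smooth_right.continuous
  refine memLp_volExt (by simp only [wave]; fun_prop)
    (HasCompactSupport.intro (isCompact_closedBall (0 : Plane) (B + 1 + |s|)) fun x hx => ?_) 2
  rw [wave_eq_zero hB (le_of_lt (by simpa using hx)), zero_smul]

/-- The gradient of a radial function. -/
theorem IsProfile.gradient_eq {f : ℝ → ℝ} (h : IsProfile f) (x : Plane) :
    gradient (radial f) x = (_root_.deriv f ‖x‖ / ‖x‖) • x := by
  rw [gradient, (h.hasFDerivAt x).fderiv]
  refine ((InnerProductSpace.toDual ℝ Plane).symm_apply_eq).2 ?_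
  ext y
  simp

/-! ### Weights, and travelling waves as curves in `H¹`. -/

/-- Smooth weights vanishing near the origin. -/
structure IsWeight (ρ : ℝ → ℝ) : Prop where
  smooth : ContDiff ℝ ∞ ρ
  low : ∀ r ≤ 1 / 2, ρ r = 0

theorem IsWeight.mul_smoothOn {ρ g : ℝ → ℝ} (h : IsWeight ρ) (hg : ContDiffOn ℝ ∞ g (Ioi 0)) :
    IsWeight (fun r => ρ r * g r) := by
  refine ⟨contDiff_iff_contDiffAt.2 fun r => ?_, fun r hr => by rw [h.low r hr, zero_mul]⟩
  rcases lt_or_ge r (1 / 2) with hr | hr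
  · refine (contDiffAt_const (c := (0 : ℝ))).congr_of_eventuallyEq ?_
    filter_upwards [Iio_mem_nhds hr] with y hy
    rw [h.low y (le_of_lt hy), zero_mul]
  · exact h.smooth.contDiffAt.mul (hg.contDiffAt (Ioi_mem_nhds (by linarith)))

theorem IsWeight.deriv {ρ : ℝ → ℝ} (h : IsWeight ρ) : IsWeight (deriv ρ) := by
  refine ⟨h.smooth.deriv', ?_⟩
  have hcl : IsClosed {r | _root_.deriv ρ r = 0} :=
    isClosed_eq (h.smooth.continuous_deriv (by simp)) continuous_const
  have hsub : Iio (1 / 2 : ℝ) ⊆ {r | _root_.deriv ρ r = 0} := fun r hr => by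
    have : ρ =ᶠ[𝓝 r] fun _ => 0 := by
      filter_upwards [Iio_mem_nhds hr] with y hy
      exact h.low y (le_of_lt hy)
    simp [this.deriv_eq]
  intro r hr
  have := closure_minimal hsub hcl
  rw [closure_Iio] at this
  exact this hr

theorem IsWeight.div_id {ρ : ℝ → ℝ} (h : IsWeight ρ) : IsWeight (fun r => ρ r / r) := by
  simp_rw [div_eq_mul_inv]
  exact h.mul_smoothOn (contDiffOn_id.inv fun x hx => (ne_of_gt hx))

theorem gradient_wave {ρ P Q : ℝ → ℝ} (hρ : IsWeight ρ) (h : IsWavePair P Q) (s : ℝ) (x : Plane) :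
    gradient (radial (wave ρ P Q s)) x =
      wave (fun r => deriv ρ r / r) P Q s ‖x‖ • x +
        wave (fun r => ρ r / r) (deriv P) (deriv Q) s ‖x‖ • x := by
  rw [(isProfile_wave hρ.smooth hρ.low h s).gradient_eq,
    (hasDerivAt_wave_space h s (hρ.smooth.differentiable (by simp) _)).deriv, ← add_smul]
  congr 1
  simp only [wave]
  ring

/-- A travelling wave as a curve in `H¹`. -/
theorem hasDerivAt_pair_wave {ρ P Q : ℝ → ℝ} (hρ : IsWeight ρ) (h : IsWavePair P Q) (s : ℝ) :
    HasDerivAt (fun s => (isProfile_wave hρ.smooth hρ.low h s).isSmoothCpt.pair)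
      (isProfile_wave hρ.smooth hρ.low h.damp s).isSmoothCpt.pair s := by
  have hρ1 := hρ.deriv.div_id.smooth.continuous
  have hρ2 := hρ.div_id.smooth.continuous
  have e1 := hasDerivAt_toLp_wave (v := fun _ => (1 : ℝ)) continuous_const hρ.smooth.continuous h
    (memLp_wave continuous_const hρ.smooth.continuous h)
    (memLp_wave continuous_const hρ.smooth.continuous h.damp) s
  have e2 := (hasDerivAt_toLp_wave (v := fun x => x) continuous_id hρ1 h
    (memLp_wave continuous_id hρ1 h) (memLp_wave continuous_id hρ1 h.damp) s).add
    (hasDerivAt_toLp_wave (v := fun x => x) continuous_id hρ2 h.deriv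
    (memLp_wave continuous_id hρ2 h.deriv) (memLp_wave continuous_id hρ2 h.deriv.damp) s)
  have e3 := (WithLp.prodContinuousLinearEquiv 2 ℝ L2 L2Vec).symm.hasFDerivAt.comp_hasDerivAt s
    (e1.prodMk e2)
  refine (e3.congr_of_eventuallyEq (.of_forall fun s => ?_)).congr_deriv ?_
  · refine congrArg (WithLp.toLp 2) (Prod.ext ?_ ?_)
    · exact MemLp.toLp_congr (isProfile_wave hρ.smooth hρ.low h s).isSmoothCpt.memLp
        (memLp_wave continuous_const hρ.smooth.continuous h s)
        (.of_forall fun x => by simp [radial])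
    · refine Eq.trans ?_ (MemLp.toLp_add _ _)
      exact MemLp.toLp_congr (isProfile_wave hρ.smooth hρ.low h s).isSmoothCpt.memLp_gradient
        ((memLp_wave continuous_id hρ1 h s).add (memLp_wave continuous_id hρ2 h.deriv s))
        (.of_forall fun x => gradient_wave hρ h s x)
  · refine congrArg (WithLp.toLp 2) (Prod.ext ?_ ?_)
    · exact MemLp.toLp_congr (memLp_wave continuous_const hρ.smooth.continuous h.damp s)
        (isProfile_wave hρ.smooth hρ.low h.damp s).isSmoothCpt.memLp
        (.of_forall fun x => by simp [radial])
    · refine (MemLp.toLp_add _ _).symm.trans ?_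
      refine MemLp.toLp_congr
        ((memLp_wave continuous_id hρ1 h.damp s).add (memLp_wave continuous_id hρ2 h.deriv.damp s))
        (isProfile_wave hρ.smooth hρ.low h.damp s).isSmoothCpt.memLp_gradient
        (.of_forall fun x => ?_)
      have := gradient_wave hρ h.damp s x
      rw [h.deriv_damp_left, h.deriv_damp_right] at this
      exact this.symm

/-! ### The explicit parametrix -/

/-- Smooth nonnegative profiles with compact support in `(1, R]`. -/
structure IsNice (R : ℝ) (γ : ℝ → ℝ) : Prop where
  smooth : ContDiff ℝ ∞ γ
  nonneg : ∀ r, 0 ≤ γ r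
  one_le : 1 ≤ R
  low : ∃ a, 1 < a ∧ ∀ r ≤ a, γ r = 0
  high : ∀ r, R ≤ r → γ r = 0

/-- The profile on the half line: `√(1 + x) γ(1 + x)`. -/
def halfLine (γ : ℝ → ℝ) (x : ℝ) : ℝ := √(1 + x) * γ (1 + x)

/-- The even primitive of the odd extension of `halfLine γ`. -/
def evenPrim (γ : ℝ → ℝ) (x : ℝ) : ℝ :=
  (∫ y in (0 : ℝ)..x, halfLine γ y) + ∫ y in (0 : ℝ)..-x, halfLine γ y

namespace IsNice

variable {R : ℝ} {γ : ℝ → ℝ}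

theorem isProfile (h : IsNice R γ) : IsProfile γ := by
  obtain ⟨a, ha, hl⟩ := h.low
  exact ⟨h.smooth, fun r hr => hl r (by linarith), R, h.high⟩

theorem isTest (h : IsNice R γ) : IsTest (radial γ) := by
  refine ⟨h.isProfile.isSmoothCpt.smooth, h.isProfile.isSmoothCpt.compact, ?_⟩
  obtain ⟨a, ha, hl⟩ := h.low
  have hcl : IsClosed {x : Plane | a ≤ ‖x‖} := isClosed_le continuous_const continuous_norm
  have hsub : Function.support (radial γ) ⊆ {x : Plane | a ≤ ‖x‖} := fun x hx => by
    by_contra hlt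
    exact hx (hl _ (le_of_lt (not_le.1 hlt)))
  exact fun x hx => lt_of_lt_of_le ha (closure_minimal hsub hcl hx)

theorem halfLine_of_nonpos (h : IsNice R γ) {x : ℝ} (hx : x ≤ 0) : halfLine γ x = 0 := by
  obtain ⟨a, ha, hl⟩ := h.low
  rw [halfLine, hl _ (by linarith), mul_zero]

theorem halfLine_of_ge (h : IsNice R γ) {x : ℝ} (hx : R - 1 ≤ x) : halfLine γ x = 0 := by
  rw [halfLine, h.high _ (by linarith), mul_zero]

theorem halfLine_nonneg (h : IsNice R γ) (x : ℝ) : 0 ≤ halfLine γ x :=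
  mul_nonneg (Real.sqrt_nonneg _) (h.nonneg _)

theorem contDiff_halfLine (h : IsNice R γ) : ContDiff ℝ ∞ (halfLine γ) := by
  refine contDiff_iff_contDiffAt.2 fun x => ?_
  rcases lt_or_ge x 0 with hx | hx
  · refine (contDiffAt_const (c := (0 : ℝ))).congr_of_eventuallyEq ?_
    filter_upwards [Iio_mem_nhds hx] with y hy
    exact h.halfLine_of_nonpos (le_of_lt hy)
  · have h1 : ContDiffAt ℝ ∞ (fun x : ℝ => 1 + x) x := contDiffAt_const.add contDiffAt_id
    exact ((Real.contDiffAt_sqrt (by linarith)).comp x h1).mul (h.smooth.contDiffAt.comp x h1)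

theorem continuous_halfLine (h : IsNice R γ) : Continuous (halfLine γ) :=
  h.contDiff_halfLine.continuous

theorem hasDerivAt_prim (h : IsNice R γ) (x : ℝ) :
    HasDerivAt (fun x => ∫ y in (0 : ℝ)..x, halfLine γ y) (halfLine γ x) x :=
  h.continuous_halfLine.integral_hasStrictDerivAt 0 x |>.hasDerivAt

theorem hasDerivAt_evenPrim (h : IsNice R γ) (x : ℝ) :
    HasDerivAt (evenPrim γ) (halfLine γ x - halfLine γ (-x)) x := by
  have := (h.hasDerivAt_prim x).add ((h.hasDerivAt_prim (-x)).comp x (hasDerivAt_neg x))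
  exact this.congr_deriv (by ring)

theorem deriv_evenPrim (h : IsNice R γ) :
    deriv (evenPrim γ) = fun x => halfLine γ x - halfLine γ (-x) :=
  funext fun x => (h.hasDerivAt_evenPrim x).deriv

theorem contDiff_evenPrim (h : IsNice R γ) : ContDiff ℝ ∞ (evenPrim γ) := by
  refine contDiff_infty_iff_deriv.2 ⟨fun x => (h.hasDerivAt_evenPrim x).differentiableAt, ?_⟩
  rw [h.deriv_evenPrim]
  exact h.contDiff_halfLine.sub (h.contDiff_halfLine.comp contDiff_neg)

theorem evenPrim_sub (h : IsNice R γ) (y z : ℝ) :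
    evenPrim γ z - evenPrim γ y = ∫ x in y..z, (halfLine γ x - halfLine γ (-x)) := by
  refine (intervalIntegral.integral_eq_sub_of_hasDerivAt
    (fun x _ => h.hasDerivAt_evenPrim x) ?_).symm
  exact (h.continuous_halfLine.sub (h.continuous_halfLine.comp continuous_neg)).intervalIntegrable
    _ _

/-- On the positive half line the odd extension of `halfLine γ` is nonnegative. With evenness this
makes `evenPrim γ` an increasing function of `|x|`, the source of positivity of the parametrix. -/
theorem evenPrim_le (h : IsNice R γ) {y z : ℝ} (hy : 0 ≤ y) (hyz : y ≤ z) :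
    evenPrim γ y ≤ evenPrim γ z := by
  rw [← sub_nonneg, h.evenPrim_sub]
  refine intervalIntegral.integral_nonneg hyz fun x hx => ?_
  rw [h.halfLine_of_nonpos (show -x ≤ 0 by linarith [hx.1]), sub_zero]
  exact h.halfLine_nonneg x

/-- The integrand vanishes beyond `R - 1`. This yields unit speed of propagation for the parametrix.
-/
theorem evenPrim_eq (h : IsNice R γ) {y z : ℝ} (hy : R - 1 ≤ y) (hz : R - 1 ≤ z) :
    evenPrim γ y = evenPrim γ z := by
  have h1 := h.one_le
  rw [← sub_eq_zero, h.evenPrim_sub]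
  refine intervalIntegral.integral_zero_ae (.of_forall fun x hx => ?_)
  have hx' : R - 1 ≤ x := by
    rcases le_total z y with hzy | hzy
    · rw [uIoc_of_le hzy] at hx
      linarith [hx.1]
    · rw [uIoc_of_ge hzy] at hx
      linarith [hx.1]
  rw [h.halfLine_of_nonpos (show -x ≤ 0 by linarith), h.halfLine_of_ge hx', sub_zero]

end IsNice

theorem evenPrim_neg (γ : ℝ → ℝ) (x : ℝ) : evenPrim γ (-x) = evenPrim γ x := by
  simp [evenPrim, add_comm]

theorem IsNice.isWavePair {R : ℝ} {γ : ℝ → ℝ} (h : IsNice R γ) :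
    IsWavePair (evenPrim γ) (fun x => -evenPrim γ x) :=
  ⟨h.contDiff_evenPrim, h.contDiff_evenPrim.neg, R - 1, fun y z hy hz => by
    rw [h.evenPrim_eq hy hz, add_neg_cancel]⟩

/-! ### The weight `r^{-1/2}` and the equation satisfied by the travelling waves. -/

/-- The weight `r^{-1/2}`, cut off near the origin. -/
def sqrtWeight (r : ℝ) : ℝ := innerCutoff r * (√r)⁻¹

theorem isWeight_innerCutoff : IsWeight innerCutoff :=
  ⟨contDiff_innerCutoff, fun _ hr => innerCutoff_of_le hr⟩

theorem isWeight_sqrtWeight : IsWeight sqrtWeight :=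
  isWeight_innerCutoff.mul_smoothOn fun _ hx =>
    ((Real.contDiffAt_sqrt (ne_of_gt hx)).inv (Real.sqrt_pos.2 hx).ne').contDiffWithinAt

theorem sqrtWeight_of_ge {r : ℝ} (hr : 3 / 4 ≤ r) : sqrtWeight r = (√r)⁻¹ := by
  rw [sqrtWeight, innerCutoff_of_ge hr, one_mul]

/-- The weight `r^{-1/2} (1/4 + 1/(4r²))`. -/
def potWeight (r : ℝ) : ℝ := sqrtWeight r * (1 / 4 + 1 / (4 * r ^ 2))

theorem isWeight_potWeight : IsWeight potWeight := by
  refine isWeight_sqrtWeight.mul_smoothOn (contDiffOn_const.add (contDiffOn_const.div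
    (contDiffOn_const.mul (contDiffOn_id.pow 2)) fun x hx => ?_))
  have : (0 : ℝ) < x := hx
  positivity

theorem hasDerivAt_sqrtWeight {r : ℝ} (hr : 3 / 4 < r) :
    HasDerivAt sqrtWeight (-1 / (2 * r * √r)) r := by
  have hr0 : 0 < r := by linarith
  have h1 : HasDerivAt (fun r => (√r)⁻¹) (-(1 / (2 * √r)) / √r ^ 2) r :=
    (Real.hasDerivAt_sqrt hr0.ne').inv (Real.sqrt_pos.2 hr0).ne'
  have h2 : sqrtWeight =ᶠ[𝓝 r] fun r => (√r)⁻¹ := by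
    filter_upwards [Ioi_mem_nhds hr] with y hy using sqrtWeight_of_ge (le_of_lt hy)
  refine (h1.congr_of_eventuallyEq h2).congr_deriv ?_
  rw [Real.sq_sqrt hr0.le]
  have := Real.sqrt_pos.2 hr0
  field_simp

theorem hasDerivAt_deriv_sqrtWeight {r : ℝ} (hr : 3 / 4 < r) :
    HasDerivAt (deriv sqrtWeight) (3 / (4 * r ^ 2 * √r)) r := by
  have hr0 : 0 < r := by linarith
  have hq := Real.sqrt_pos.2 hr0
  have h1 : HasDerivAt (fun r => -1 / (2 * r * √r)) _ r :=
    (hasDerivAt_const r (-1 : ℝ)).div (((hasDerivAt_id r).const_mul 2).mul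
      (Real.hasDerivAt_sqrt hr0.ne')) (show 2 * r * √r ≠ 0 by positivity)
  have h2 : deriv sqrtWeight =ᶠ[𝓝 r] fun r => -1 / (2 * r * √r) := by
    filter_upwards [Ioi_mem_nhds hr] with y hy using (hasDerivAt_sqrtWeight hy).deriv
  refine (h1.congr_of_eventuallyEq h2).congr_deriv ?_
  simp only [id]
  have hs : √r ^ 2 = r := Real.sq_sqrt hr0.le
  set q := √r
  rw [← hs]
  field_simp
  ring

/-- The travelling waves solve the damped wave equation up to a potential term. -/
theorem wave_equation {P Q : ℝ → ℝ} (h : IsWavePair P Q) (s : ℝ) {x : Plane} (hx : x ∈ Ext) :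
    lap (radial (wave sqrtWeight P Q s)) x =
      radial (wave sqrtWeight (fun y => deriv (fun y => deriv P y - P y / 2) y -
          (deriv P y - P y / 2) / 2)
        (fun y => -deriv (fun y => -deriv Q y - Q y / 2) y - (-deriv Q y - Q y / 2) / 2) s) x +
      radial (wave sqrtWeight (fun y => deriv P y - P y / 2) (fun y => -deriv Q y - Q y / 2) s) x +
      radial (wave potWeight P Q s) x := by
  have hr : 1 < ‖x‖ := hx
  have hw := isWeight_sqrtWeight
  have hd : ∀ r, DifferentiableAt ℝ sqrtWeight r := hw.smooth.differentiable (by simp)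
  have hd' : ∀ r, DifferentiableAt ℝ (deriv sqrtWeight) r :=
    hw.deriv.smooth.differentiable (by simp)
  have e1 : deriv (wave sqrtWeight P Q s) = fun r =>
      wave (deriv sqrtWeight) P Q s r + wave sqrtWeight (deriv P) (deriv Q) s r :=
    funext fun r => (hasDerivAt_wave_space h s (hd r)).deriv
  have e2 : deriv (deriv (wave sqrtWeight P Q s)) ‖x‖ =
      (wave (deriv (deriv sqrtWeight)) P Q s ‖x‖ + wave (deriv sqrtWeight) (deriv P) (deriv Q) s ‖x‖)
      + (wave (deriv sqrtWeight) (deriv P) (deriv Q) s ‖x‖ +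
        wave sqrtWeight (deriv (deriv P)) (deriv (deriv Q)) s ‖x‖) := by
    rw [e1]
    exact ((hasDerivAt_wave_space h s (hd' _)).add
      (hasDerivAt_wave_space h.deriv s (hd _))).deriv
  rw [(isProfile_wave hw.smooth hw.low h s).lap (Ext.ne_zero hx), e2, e1, h.deriv_damp_left,
    h.deriv_damp_right]
  have hr34 : 3 / 4 < ‖x‖ := by linarith
  have hr0 : 0 < ‖x‖ := by linarith
  have hq := Real.sqrt_pos.2 hr0
  -- For `u = e^{-s/2} r^{-1/2} w` with `w_ss = w_rr`, removing the damping produces the term `1/4`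
  -- and removing the first-order radial term produces `1/(4r²)`. In total `u_ss + u_s - Δu = -(1/4
  -- + 1/(4r²)) u`.
  simp only [radial, wave, potWeight]
  rw [(hasDerivAt_deriv_sqrtWeight hr34).deriv, (hasDerivAt_sqrtWeight hr34).deriv,
    sqrtWeight_of_ge hr34.le]
  field_simp
  ring

theorem IsSmoothCpt.pair_eq_zero {φ : Plane → ℝ} (hφ : IsSmoothCpt φ) (h0 : ∀ x, φ x = 0) :
    hφ.pair = 0 := by
  obtain rfl : φ = fun _ => 0 := funext h0
  refine congrArg (WithLp.toLp 2) (Prod.ext ?_ ?_)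
  · exact MemLp.toLp_zero hφ.memLp
  · have : gradient (fun _ : Plane => (0 : ℝ)) = 0 := by
      ext1 x
      simp [gradient]
    refine (Lp.eq_zero_iff_ae_eq_zero).2 (hφ.memLp_gradient.coeFn_toLp.trans ?_)
    rw [this]

theorem hasDerivAt_subtype {E : Type*} [NormedAddCommGroup E] [NormedSpace ℝ E]
    {S : Submodule ℝ E} {f : ℝ → S} {f' : S} {s : ℝ}
    (h : HasDerivAt (fun s => (f s : E)) (f' : E) s) : HasDerivAt f f' s := by
  rw [hasDerivAt_iff_tendsto_slope] at h ⊢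
  rw [tendsto_subtype_rng]
  refine h.congr fun z => ?_
  simp [slope_def_module]

/-! ### The parametrix as a curve in the energy space. -/

namespace IsNice

variable {R : ℝ} {γ : ℝ → ℝ}

/-- Method of images: at `r = 1` the two arguments are `s` and `-s`, and the primitive is even, so
the incoming and the reflected wave cancel. -/
theorem wave_one (_h : IsNice R γ) (s : ℝ) :
    wave sqrtWeight (evenPrim γ) (fun x => -evenPrim γ x) s 1 = 0 := by
  have : evenPrim γ (1 - 1 - s) = evenPrim γ (1 - 1 + s) := by
    rw [← evenPrim_neg]
    congr 1
    ring
  rw [wave, this]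
  ring

/-- As for the position, now with the oddness of the derivative of `evenPrim γ`. The velocity must
also lie in `H_0^1` for the curve to stay in the domain of the generator. -/
theorem wave_damp_one (h : IsNice R γ) (s : ℝ) :
    wave sqrtWeight (fun y => deriv (evenPrim γ) y - evenPrim γ y / 2)
      (fun y => -deriv (fun x => -evenPrim γ x) y - -evenPrim γ y / 2) s 1 = 0 := by
  have h1 : evenPrim γ (1 - 1 - s) = evenPrim γ (1 - 1 + s) := by
    rw [← evenPrim_neg]
    congr 1
    ring
  rw [wave]
  simp only [deriv.fun_neg, h.deriv_evenPrim, h1]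
  have h2 : -(1 - 1 - s) = 1 - 1 + s := by ring
  have h3 : -(1 - 1 + s) = 1 - 1 - s := by ring
  rw [h2, h3]
  ring

/-- The position of the parametrix. -/
def pos (h : IsNice R γ) (s : ℝ) : H10 :=
  ⟨(isProfile_wave isWeight_sqrtWeight.smooth isWeight_sqrtWeight.low h.isWavePair
    s).isSmoothCpt.pair, (isProfile_wave isWeight_sqrtWeight.smooth isWeight_sqrtWeight.low
      h.isWavePair s).pair_mem_H10 (h.wave_one s)⟩

/-- The velocity of the parametrix. -/
def vel (h : IsNice R γ) (s : ℝ) : H10 :=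
  ⟨(isProfile_wave isWeight_sqrtWeight.smooth isWeight_sqrtWeight.low h.isWavePair.damp
    s).isSmoothCpt.pair, (isProfile_wave isWeight_sqrtWeight.smooth isWeight_sqrtWeight.low
      h.isWavePair.damp s).pair_mem_H10 (h.wave_damp_one s)⟩

/-- The acceleration of the parametrix. -/
def acc (h : IsNice R γ) (s : ℝ) : L2 :=
  (isProfile_wave isWeight_sqrtWeight.smooth isWeight_sqrtWeight.low h.isWavePair.damp.damp
    s).isSmoothCpt.memLp.toLp _

/-- The parametrix multiplied by the potential `1/4 + 1/(4r²)`. -/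
def pot (h : IsNice R γ) (s : ℝ) : L2 :=
  (isProfile_wave isWeight_potWeight.smooth isWeight_potWeight.low h.isWavePair
    s).isSmoothCpt.memLp.toLp _

/-- The parametrix as a curve in the energy space. -/
def curve (h : IsNice R γ) (s : ℝ) : Energy := WithLp.toLp 2 (h.pos s, H10.toL2 (h.vel s))

/-- The class of a nice radial function in `L²`. -/
def toL2 (h : IsNice R γ) : L2 := h.isTest.isSmoothCpt.memLp.toLp (radial γ)

theorem toL2_vel (h : IsNice R γ) (s : ℝ) : H10.toL2 (h.vel s) =
    (isProfile_wave isWeight_sqrtWeight.smooth isWeight_sqrtWeight.low h.isWavePair.damp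
      s).isSmoothCpt.memLp.toLp _ := rfl

theorem toL2_pos (h : IsNice R γ) (s : ℝ) : H10.toL2 (h.pos s) =
    (isProfile_wave isWeight_sqrtWeight.smooth isWeight_sqrtWeight.low h.isWavePair
      s).isSmoothCpt.memLp.toLp _ := rfl

theorem hasDerivAt_curve (h : IsNice R γ) (s : ℝ) :
    HasDerivAt h.curve (WithLp.toLp 2 (h.vel s, h.acc s)) s := by
  have e1 : HasDerivAt h.pos (h.vel s) s :=
    hasDerivAt_subtype (hasDerivAt_pair_wave isWeight_sqrtWeight h.isWavePair s)
  have e2 : HasDerivAt (fun s => H10.toL2 (h.vel s)) (h.acc s) s :=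
    (WithLp.fstL 2 ℝ L2 L2Vec).hasFDerivAt.comp_hasDerivAt s
      (hasDerivAt_pair_wave isWeight_sqrtWeight h.isWavePair.damp s)
  exact (WithLp.prodContinuousLinearEquiv 2 ℝ H10 L2).symm.hasFDerivAt.comp_hasDerivAt s
    (e1.prodMk e2)

/-- The parametrix fails to solve the equation only by the potential term, which acts as an initial
velocity in Duhamel's formula. -/
theorem waveOp_curve (h : IsNice R γ) (s : ℝ) :
    waveOp (h.curve s) (WithLp.toLp 2 (h.vel s, h.acc s) + dataCLM (h.pot s)) := by
  refine ⟨?_, _, (isProfile_wave isWeight_sqrtWeight.smooth isWeight_sqrtWeight.low h.isWavePair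
    s).isSmoothCpt.h2Laplacian, ?_⟩
  · change H10.toL2 (h.vel s + 0) = H10.toL2 (h.vel s)
    rw [add_zero]
  · change h.acc s + h.pot s = _ - H10.toL2 (h.vel s)
    rw [eq_sub_iff_add_eq]
    rw [acc, pot, toL2_vel, ← MemLp.toLp_add, ← MemLp.toLp_add]
    refine MemLp.toLp_congr _ _ ?_
    filter_upwards [ae_restrict_mem measurableSet_Ext] with x hx
    rw [wave_equation h.isWavePair s hx]
    simp only [Pi.add_apply]
    ring

/-- At time zero the two waves coincide and cancel. The velocity is `r^{-1/2}` times the derivative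
of the primitive at `r - 1`, that is `r^{-1/2} √r γ(r)`; this explains the square root in
`halfLine`. -/
theorem curve_zero (h : IsNice R γ) : h.curve 0 = dataCLM h.toL2 := by
  have e1 : h.pos 0 = 0 := by
    refine Subtype.ext (IsSmoothCpt.pair_eq_zero (isProfile_wave
      isWeight_sqrtWeight.smooth isWeight_sqrtWeight.low h.isWavePair 0).isSmoothCpt fun x => ?_)
    simp [radial, wave]
  have e2 : H10.toL2 (h.vel 0) = h.toL2 := by
    rw [toL2_vel, toL2]
    refine MemLp.toLp_congr _ _ ?_
    filter_upwards [ae_restrict_mem measurableSet_Ext] with x hx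
    have hr : 1 < ‖x‖ := hx
    have hr0 : 0 < ‖x‖ := by linarith
    simp only [radial, wave, deriv.fun_neg, h.deriv_evenPrim, sqrtWeight_of_ge
      (show 3 / 4 ≤ ‖x‖ by linarith), add_zero, sub_zero,
      h.halfLine_of_nonpos (show -(‖x‖ - 1) ≤ 0 by linarith)]
    rw [halfLine, show 1 + (‖x‖ - 1) = ‖x‖ by ring]
    have := Real.sqrt_pos.2 hr0
    simp only [neg_zero, zero_div, Real.exp_zero]
    field_simp
    ring
  rw [curve, e1, e2]
  rfl

end IsNice

/-! ### The `L²` bound for the parametrix -/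

/-- Cauchy–Schwarz, obtained by integrating the square of the deviation of `h` from its mean `m`. -/
theorem sq_intervalIntegral_le {h : ℝ → ℝ} (hc : Continuous h) {a b : ℝ} (hab : a ≤ b) :
    (∫ x in a..b, h x) ^ 2 ≤ (b - a) * ∫ x in a..b, h x ^ 2 := by
  rcases hab.eq_or_lt with rfl | hlt
  · simp
  set I := ∫ x in a..b, h x with hI
  set m := I / (b - a) with hm
  have hpos : 0 < b - a := sub_pos.2 hlt
  have h1 : 0 ≤ ∫ x in a..b, (h x - m) ^ 2 :=
    intervalIntegral.integral_nonneg hab fun x _ => sq_nonneg _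
  have h2 : ∫ x in a..b, (h x - m) ^ 2 = (∫ x in a..b, h x ^ 2) - 2 * m * I + m ^ 2 * (b - a) := by
    have e : ∀ x, (h x - m) ^ 2 = (h x ^ 2 - 2 * m * h x) + m ^ 2 := fun x => by ring
    simp_rw [e]
    rw [intervalIntegral.integral_add, intervalIntegral.integral_sub,
      intervalIntegral.integral_const_mul, intervalIntegral.integral_const, smul_eq_mul]
    · ring
    all_goals exact Continuous.intervalIntegrable (by fun_prop) _ _
  have h3 : m * (b - a) = I := div_mul_cancel₀ _ hpos.ne'
  nlinarith

/-- Cauchy–Schwarz on an interval of length `2s` gives one factor `2s`. Tonelli and translation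
invariance give the other. -/
theorem lintegral_sq_intervalIntegral_le {h : ℝ → ℝ} (hc : Continuous h) {s : ℝ} (hs : 0 ≤ s) :
    ∫⁻ x, ENNReal.ofReal ((∫ y in (x - s)..(x + s), h y) ^ 2) ≤
      ENNReal.ofReal (4 * s ^ 2) * ∫⁻ x, ENNReal.ofReal (h x ^ 2) := by
  have hle : -s ≤ s := by linarith
  have step : ∀ x, ENNReal.ofReal ((∫ y in (x - s)..(x + s), h y) ^ 2) ≤
      ENNReal.ofReal (2 * s) * ∫⁻ σ in Ioc (-s) s, ENNReal.ofReal (h (σ + x) ^ 2) := by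
    intro x
    have h1 := sq_intervalIntegral_le hc (show x - s ≤ x + s by linarith)
    have h2 : ∫ y in (x - s)..(x + s), h y ^ 2 = ∫ σ in (-s)..s, h (σ + x) ^ 2 := by
      rw [intervalIntegral.integral_comp_add_right (fun y => h y ^ 2)]
      congr 1 <;> ring
    rw [h2, show x + s - (x - s) = 2 * s by ring] at h1
    refine (ENNReal.ofReal_le_ofReal h1).trans ?_
    rw [ENNReal.ofReal_mul (by linarith), intervalIntegral.integral_of_le hle,
      ofReal_integral_eq_lintegral_ofReal]
    · exact (Continuous.integrableOn_Icc (by fun_prop)).mono_set Ioc_subset_Icc_self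
    · exact .of_forall fun σ => sq_nonneg _
  calc _ ≤ ∫⁻ x, ENNReal.ofReal (2 * s) * ∫⁻ σ in Ioc (-s) s, ENNReal.ofReal (h (σ + x) ^ 2) :=
        lintegral_mono step
    _ = ENNReal.ofReal (2 * s) * ∫⁻ x, ∫⁻ σ in Ioc (-s) s, ENNReal.ofReal (h (σ + x) ^ 2) :=
        lintegral_const_mul' _ _ ENNReal.ofReal_ne_top
    _ = ENNReal.ofReal (2 * s) * ∫⁻ σ in Ioc (-s) s, ∫⁻ x, ENNReal.ofReal (h (σ + x) ^ 2) := by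
        rw [lintegral_lintegral_swap]
        refine Measurable.aemeasurable ?_
        simp only [Function.uncurry_def]
        fun_prop
    _ = ENNReal.ofReal (2 * s) * ∫⁻ _ in Ioc (-s) s, ∫⁻ x, ENNReal.ofReal (h x ^ 2) := by
        congr 1
        refine lintegral_congr fun σ => ?_
        exact lintegral_add_left_eq_self (fun x => ENNReal.ofReal (h x ^ 2)) σ
    _ = _ := by
        rw [lintegral_const, Measure.restrict_apply_univ, Real.volume_Ioc, mul_comm (∫⁻ _, _),
          ← mul_assoc, ← ENNReal.ofReal_mul (by linarith)]
        congr 2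
        ring

/-- The constant in polar coordinates. -/
def polarConst : ℝ := 2 * (volume : Measure Plane).real (Metric.ball 0 1)

theorem polarConst_nonneg : 0 ≤ polarConst := by
  unfold polarConst
  positivity

theorem norm_sq_toLp_radial {f : ℝ → ℝ} (h : MemLp (radial f) 2 volExt) :
    ‖h.toLp (radial f)‖ ^ 2 = polarConst * ∫ r in Ioi (1 : ℝ), r * f r ^ 2 := by
  rw [← real_inner_self_eq_norm_sq, inner_toLp_eq]
  have e1 : ∫ x in Ext, (h.toLp (radial f)) x * radial f x =
      ∫ x : Plane, (Ioi (1 : ℝ)).indicator (fun r => f r ^ 2) ‖x‖ := by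
    rw [← integral_indicator measurableSet_Ext]
    have h1 := (ae_restrict_iff' measurableSet_Ext).1 h.coeFn_toLp
    refine integral_congr_ae ?_
    filter_upwards [h1] with x hx
    by_cases hxE : x ∈ Ext
    · rw [indicator_of_mem hxE, indicator_of_mem (show ‖x‖ ∈ Ioi (1 : ℝ) from hxE), hx hxE, radial, sq]
    · rw [indicator_of_notMem hxE, indicator_of_notMem (show ‖x‖ ∉ Ioi (1 : ℝ) from hxE)]
  rw [e1, integral_fun_norm_addHaar, finrank_euclideanSpace_fin]
  have e2 : ∫ y in Ioi (0 : ℝ), y ^ (2 - 1) • (Ioi (1 : ℝ)).indicator (fun r => f r ^ 2) y =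
      ∫ r in Ioi (1 : ℝ), r * f r ^ 2 := by
    have : ∀ y : ℝ, y ^ (2 - 1) • (Ioi (1 : ℝ)).indicator (fun r => f r ^ 2) y =
        (Ioi (1 : ℝ)).indicator (fun r => r * f r ^ 2) y := fun y => by
      by_cases hy : y ∈ Ioi (1 : ℝ) <;> simp [hy]
    simp_rw [this]
    rw [setIntegral_indicator measurableSet_Ioi]
    congr 2
    ext y
    simp only [mem_inter_iff, mem_Ioi]
    exact ⟨fun h => h.2, fun h => ⟨by linarith, h⟩⟩
  rw [e2, polarConst]
  simp [mul_assoc]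

namespace IsNice

variable {R : ℝ} {γ : ℝ → ℝ}

/-- The two halves of the odd function have disjoint supports, so there is no cross term and each
contributes the same integral. The square of `√(1 + x)` is the polar weight `r`. -/
theorem integral_odd_sq (h : IsNice R γ) :
    Integrable (fun x => (halfLine γ x - halfLine γ (-x)) ^ 2) ∧
    ∫ x, (halfLine γ x - halfLine γ (-x)) ^ 2 = 2 * ∫ r in Ioi (1 : ℝ), r * γ r ^ 2 := by
  have hsq : ∀ x, (halfLine γ x - halfLine γ (-x)) ^ 2 = halfLine γ x ^ 2 + halfLine γ (-x) ^ 2 := by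
    intro x
    rcases le_total x 0 with hx | hx
    · rw [h.halfLine_of_nonpos hx]; ring
    · rw [h.halfLine_of_nonpos (show -x ≤ 0 by linarith)]; ring
  have hint : Integrable fun x => halfLine γ x ^ 2 := by
    refine (h.continuous_halfLine.pow 2).integrable_of_hasCompactSupport
      (HasCompactSupport.intro (isCompact_Icc (a := 0) (b := R - 1)) fun x hx => ?_)
    simp only [mem_Icc, not_and_or, not_le] at hx
    rcases hx with hx | hx
    · rw [Pi.pow_apply, h.halfLine_of_nonpos hx.le]; ring
    · rw [Pi.pow_apply, h.halfLine_of_ge hx.le]; ring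
  have hint' : Integrable fun x => halfLine γ (-x) ^ 2 := hint.comp_neg
  simp_rw [hsq]
  refine ⟨hint.add hint', ?_⟩
  rw [integral_add hint hint', integral_neg_eq_self (fun x => halfLine γ x ^ 2), ← two_mul]
  congr 1
  rw [← integral_sub_right_eq_self (fun x => halfLine γ x ^ 2) 1,
    ← setIntegral_eq_integral_of_forall_compl_eq_zero (s := Ioi (1 : ℝ)) fun x hx => by
      rw [h.halfLine_of_nonpos (by linarith [not_lt.1 (show ¬(1 : ℝ) < x from hx)])]; ring]
  refine setIntegral_congr_fun measurableSet_Ioi fun r hr => ?_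
  have hr1 : (1 : ℝ) < r := hr
  simp only [halfLine, show 1 + (r - 1) = r by ring, mul_pow, Real.sq_sqrt (zero_le_one.trans hr1.le)]

/-- By d'Alembert's formula the wave is an integral of the odd extension over `[r - 1 - s, r - 1 +
s]`. On `r > 1` the potential is at most `1/2`, which with the prefactor `1/2` of the wave leaves
the constant `1/16` after squaring; the interval estimate contributes `4s²`. The result, `s²/2`
times the squared norm of the datum, is better than needed. -/
theorem norm_pot_le (h : IsNice R γ) {s : ℝ} (hs : 0 ≤ s) : ‖h.pot s‖ ≤ s * ‖h.toL2‖ := by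
  have hprof := isProfile_wave isWeight_potWeight.smooth isWeight_potWeight.low h.isWavePair s
  obtain ⟨hint, heq⟩ := h.integral_odd_sq
  set odd : ℝ → ℝ := fun x => halfLine γ x - halfLine γ (-x) with ho
  have hoc : Continuous odd := h.continuous_halfLine.sub (h.continuous_halfLine.comp continuous_neg)
  have key : ∫ r in Ioi (1 : ℝ), r * wave potWeight (evenPrim γ) (fun x => -evenPrim γ x) s r ^ 2 ≤
      s ^ 2 / 4 * ∫ x, odd x ^ 2 := by
    rw [integral_eq_lintegral_of_nonneg_ae, integral_eq_lintegral_of_nonneg_ae]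
    rotate_left
    · exact .of_forall fun x => sq_nonneg _
    · exact (hoc.pow 2).aestronglyMeasurable
    · filter_upwards [ae_restrict_mem measurableSet_Ioi] with r hr
      have : (1 : ℝ) < r := hr
      simp only [Pi.zero_apply]
      positivity
    · exact (continuous_id.mul (hprof.smooth.continuous.pow 2)).aestronglyMeasurable
    have hfin : ∫⁻ x, ENNReal.ofReal (odd x ^ 2) ≠ ⊤ := (hint.lintegral_lt_top).ne
    rw [show s ^ 2 / 4 = (ENNReal.ofReal (s ^ 2 / 4)).toReal from
      (ENNReal.toReal_ofReal (by positivity)).symm, ← ENNReal.toReal_mul]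
    refine ENNReal.toReal_mono (ENNReal.mul_ne_top ENNReal.ofReal_ne_top hfin) ?_
    have hpt : ∀ r ∈ Ioi (1 : ℝ), ENNReal.ofReal
        (r * wave potWeight (evenPrim γ) (fun x => -evenPrim γ x) s r ^ 2) ≤
        ENNReal.ofReal (1 / 16) * ENNReal.ofReal ((∫ y in (r - 1 - s)..(r - 1 + s), odd y) ^ 2) := by
      intro r hr
      have hr1 : 1 < r := hr
      have hr0 : 0 < r := by linarith
      rw [← ENNReal.ofReal_mul (by norm_num)]
      refine ENNReal.ofReal_le_ofReal ?_
      rw [← h.evenPrim_sub]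
      set D := evenPrim γ (r - 1 + s) - evenPrim γ (r - 1 - s) with hD
      have hq : √r ^ 2 = r := Real.sq_sqrt hr0.le
      have hq0 := Real.sqrt_pos.2 hr0
      have hV : 1 / 4 + 1 / (4 * r ^ 2) ≤ 1 / 2 := by
        have : 1 / (4 * r ^ 2) ≤ 1 / 4 := by
          apply one_div_le_one_div_of_le <;> nlinarith
        linarith
      have hV0 : 0 ≤ 1 / 4 + 1 / (4 * r ^ 2) := by positivity
      have he : Real.exp (-s / 2) ≤ 1 := Real.exp_le_one_iff.2 (by linarith)
      have he0 := (Real.exp_pos (-s / 2)).le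
      -- The polar weight `r` cancels the square of `r^{-1/2}`, leaving a one-dimensional integral
      -- without weight.
      have e : r * wave potWeight (evenPrim γ) (fun x => -evenPrim γ x) s r ^ 2 =
          (Real.exp (-s / 2) * (1 / 4 + 1 / (4 * r ^ 2))) ^ 2 / 4 * D ^ 2 := by
        rw [wave, potWeight, sqrtWeight_of_ge (by linarith), ← sub_eq_add_neg, ← hD]
        have : r * (1 / 2 * Real.exp (-s / 2) * ((√r)⁻¹ * (1 / 4 + 1 / (4 * r ^ 2))) * D) ^ 2 =
          (r * (√r)⁻¹ ^ 2) * ((Real.exp (-s / 2) * (1 / 4 + 1 / (4 * r ^ 2))) ^ 2 / 4 * D ^ 2) := by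
          ring
        rw [this, inv_pow, hq, mul_inv_cancel₀ hr0.ne', one_mul]
      rw [e]
      refine mul_le_mul_of_nonneg_right ?_ (sq_nonneg D)
      have : Real.exp (-s / 2) * (1 / 4 + 1 / (4 * r ^ 2)) ≤ 1 * (1 / 2) :=
        mul_le_mul he hV hV0 (by norm_num)
      have h0 : 0 ≤ Real.exp (-s / 2) * (1 / 4 + 1 / (4 * r ^ 2)) := mul_nonneg he0 hV0
      nlinarith
    calc _ ≤ ∫⁻ r in Ioi (1 : ℝ), ENNReal.ofReal (1 / 16) *
          ENNReal.ofReal ((∫ y in (r - 1 - s)..(r - 1 + s), odd y) ^ 2) :=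
          setLIntegral_mono' measurableSet_Ioi hpt
      _ ≤ ∫⁻ r, ENNReal.ofReal (1 / 16) *
          ENNReal.ofReal ((∫ y in (r - 1 - s)..(r - 1 + s), odd y) ^ 2) :=
          setLIntegral_le_lintegral _ _
      _ = ENNReal.ofReal (1 / 16) *
          ∫⁻ r, ENNReal.ofReal ((∫ y in (r - 1 - s)..(r - 1 + s), odd y) ^ 2) :=
          lintegral_const_mul' _ _ ENNReal.ofReal_ne_top
      _ = ENNReal.ofReal (1 / 16) *
          ∫⁻ r, ENNReal.ofReal ((∫ y in (r - s)..(r + s), odd y) ^ 2) := by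
          rw [lintegral_sub_right_eq_self
            (fun r => ENNReal.ofReal ((∫ y in (r - s)..(r + s), odd y) ^ 2)) 1]
      _ ≤ ENNReal.ofReal (1 / 16) * (ENNReal.ofReal (4 * s ^ 2) * ∫⁻ x, ENNReal.ofReal (odd x ^ 2)) := by
          gcongr
          exact lintegral_sq_intervalIntegral_le hoc hs
      _ = _ := by
          rw [← mul_assoc, ← ENNReal.ofReal_mul (by norm_num)]
          congr 2
          ring
  have h1 : ‖h.pot s‖ ^ 2 = _ := norm_sq_toLp_radial hprof.isSmoothCpt.memLp
  have h2 : ‖h.toL2‖ ^ 2 = _ := norm_sq_toLp_radial h.isTest.isSmoothCpt.memLp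
  refine abs_le_of_sq_le_sq' ?_ (by positivity) |>.2
  rw [h1, mul_pow, h2]
  have hc := polarConst_nonneg
  have hI : 0 ≤ ∫ r in Ioi (1 : ℝ), r * γ r ^ 2 := by
    refine setIntegral_nonneg measurableSet_Ioi fun r hr => ?_
    have : (1 : ℝ) < r := hr
    positivity
  rw [heq] at key
  calc _ ≤ polarConst * (s ^ 2 / 4 * (2 * ∫ r in Ioi (1 : ℝ), r * γ r ^ 2)) := by gcongr
    _ ≤ _ := by nlinarith [mul_nonneg (mul_nonneg hc (sq_nonneg s)) hI]

/-! ### Duhamel's formula -/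

/-- This is `S(t)g = v(t) + ∫₀ᵗ S(t - s)(V v(s)) ds` tested against `ψ`, with an exponential lower
bound inserted for the integrand. Comparing right derivatives of `s ↦ ⟨ψ, P₁ T(t - s) curve(s)⟩`
avoids vector-valued integrals. -/
theorem duhamel {T : ℝ≥0 → Energy →L[ℝ] Energy} (hT : IsC0Semigroup T)
    (hG : IsGenerator T waveOp) (h : IsNice R γ) (ψ : L2) (t : ℝ≥0) {c lam : ℝ} (hlam : 0 < lam)
    (hle : ∀ s ∈ Ico (0 : ℝ) t, -(c * Real.exp (lam * (t - s))) ≤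
      inner ℝ ψ (solCLM T (t - s).toNNReal (h.pot s))) :
    inner ℝ ψ (H10.toL2 (h.pos t)) - c / lam * Real.exp (lam * t) + c / lam ≤
      inner ℝ ψ (solCLM T t h.toL2) := by
  set F : ℝ → ℝ := fun s => inner ℝ ψ (posCLM (T (t - s).toNNReal (h.curve s))) with hF
  have hcont : Continuous F := by
    refine continuous_const.inner (posCLM.continuous.comp (continuous_iff_continuousAt.2 fun s => ?_))
    refine hT.tendsto_apply ?_ (h.hasDerivAt_curve s).continuousAt
    have : Continuous fun z : ℝ => ((t : ℝ) - z).toNNReal := by fun_prop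
    exact this.tendsto s
  have hder : ∀ s ∈ Ico (0 : ℝ) t, HasDerivWithinAt F
      (-inner ℝ ψ (solCLM T (t - s).toNNReal (h.pot s))) (Ici s) s := by
    intro s hs
    have h1 := hT.hasDerivWithinAt_duhamel hG hs.2 (h.hasDerivAt_curve s).hasDerivWithinAt
      (h.waveOp_curve s)
    have h2 := ((innerSL ℝ ψ).comp posCLM).hasFDerivAt.comp_hasDerivWithinAt s h1
    refine h2.congr_deriv ?_
    rw [sub_add_cancel_left, map_neg, map_neg]
    rfl
  -- The function `B` is `F 0` plus the integral of `c e^{lam (t - σ)}` over `σ` from `0` to `s`.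
  have := image_le_of_deriv_right_le_deriv_boundary (a := 0) (b := (t : ℝ)) (f := F)
    (B := fun s => F 0 + c / lam * (Real.exp (lam * t) - Real.exp (lam * (t - s))))
    (B' := fun s => c * Real.exp (lam * (t - s))) hcont.continuousOn hder (by simp) (by fun_prop)
    (fun s _ => ?_) (fun s hs => by linarith [hle s hs]) (right_mem_Icc.2 t.2)
  · have e0 : F 0 = inner ℝ ψ (solCLM T t h.toL2) := by
      simp only [hF, sub_zero, Real.toNNReal_coe, h.curve_zero]
      rfl
    have e1 : F t = inner ℝ ψ (H10.toL2 (h.pos t)) := by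
      simp only [hF, sub_self, Real.toNNReal_zero, hT.zero]
      rfl
    simp only [e0, e1, sub_self, mul_zero, Real.exp_zero] at this
    linarith
  · have h1 : HasDerivAt (fun s : ℝ => Real.exp (lam * (t - s)))
        (Real.exp (lam * (t - s)) * (lam * (-1))) s :=
      (((hasDerivAt_id s).const_sub (t : ℝ)).const_mul lam).exp
    have h2 := ((h1.const_sub (Real.exp (lam * t))).const_mul (c / lam)).const_add (F 0)
    refine (h2.congr_deriv ?_).hasDerivWithinAt
    field_simp

end IsNice

/-! ### Closed cones of radial functions -/

/-- The `σ`-algebra generated by the norm. -/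
abbrev normAlg : MeasurableSpace Plane := MeasurableSpace.comap (fun x : Plane => ‖x‖) inferInstance

theorem normAlg_le : normAlg ≤ (inferInstance : MeasurableSpace Plane) :=
  (measurable_norm (α := Plane)).comap_le

/-- Factorization of functions measurable for the algebra generated by the norm. In this form radial
functions are seen to be closed in the `Lp` spaces. -/
theorem isRadial_iff {g : Plane → ℝ} : IsRadial g ↔ AEStronglyMeasurable[normAlg] g volExt := by
  constructor
  · rintro ⟨f, hf, hg⟩
    have h1 : Measurable[normAlg] fun x : Plane => f ‖x‖ :=
      hf.comp (comap_measurable fun x : Plane => ‖x‖)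
    exact ⟨fun x => f ‖x‖, h1.stronglyMeasurable, hg⟩
  · rintro ⟨g', hg', h⟩
    obtain ⟨f, hf, rfl⟩ := StronglyMeasurable.exists_eq_measurable_comp
      (f := fun x : Plane => ‖x‖) hg'
    exact ⟨f, hf.measurable, h⟩

theorem isClosed_isRadial_L2 : IsClosed {u : L2 | IsRadial u} := by
  simp_rw [isRadial_iff]
  exact isClosed_aestronglyMeasurable normAlg_le

theorem muExt_ac_volExt : muExt ≪ volExt := withDensity_absolutelyContinuous _ _

theorem isRadial_iff_muExt {g : Plane → ℝ} :
    IsRadial g ↔ AEStronglyMeasurable[normAlg] g muExt := by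
  rw [isRadial_iff]
  exact ⟨fun h => h.mono_ac muExt_ac_volExt, fun h => h.mono_ac volExt_ac_muExt⟩

theorem isClosed_radL1 : IsClosed (radL1 : Set L1mu) := by
  have : (radL1 : Set L1mu) = {h : L1mu | AEStronglyMeasurable[normAlg] h muExt} := by
    ext h
    exact isRadial_iff_muExt
  rw [this]
  exact isClosed_aestronglyMeasurable normAlg_le

theorem IsRadial.congr {g h : Plane → ℝ} (hg : IsRadial g) (e : h =ᵐ[volExt] g) : IsRadial h := by
  obtain ⟨f, hf, hgf⟩ := hg
  exact ⟨f, hf, e.trans hgf⟩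

theorem isRadial_radial {f : ℝ → ℝ} (hf : Measurable f) : IsRadial (radial f) :=
  ⟨f, hf, .of_forall fun _ => rfl⟩

/-- A norm-convergent sequence has an almost everywhere convergent subsequence. -/
theorem isClosed_ae_mem {α : Type*} {m : MeasurableSpace α} {μ : Measure α} {p : ℝ≥0∞}
    [Fact (1 ≤ p)] {C : α → Set ℝ} (hC : ∀ x, IsClosed (C x)) :
    IsClosed {u : Lp ℝ p μ | ∀ᵐ x ∂μ, u x ∈ C x} := by
  refine IsSeqClosed.isClosed fun u v hu huv => ?_
  obtain ⟨ns, -, h⟩ := (tendstoInMeasure_of_tendsto_Lp huv).exists_seq_tendsto_ae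
  filter_upwards [h, ae_all_iff.2 fun n => hu (ns n)] with x hx hx'
  exact (hC x).mem_of_tendsto hx (.of_forall hx')

/-- Nonnegative radial functions supported in the ball of radius `R`. -/
def cone (R : ℝ) : ProperCone ℝ L2 where
  carrier := {u | IsRadial u ∧ ∀ᵐ x ∂volExt, u x ∈ {y : ℝ | 0 ≤ y ∧ (R < ‖x‖ → y = 0)}}
  add_mem' := by
    rintro u v ⟨hu, hu'⟩ ⟨hv, hv'⟩
    refine ⟨hu.add_of_ae hv (Lp.coeFn_add u v), ?_⟩
    filter_upwards [hu', hv', Lp.coeFn_add u v] with x h1 h2 h3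
    rw [h3]
    refine ⟨add_nonneg h1.1 h2.1, fun hx => ?_⟩
    rw [Pi.add_apply, h1.2 hx, h2.2 hx, add_zero]
  zero_mem' := by
    refine ⟨IsRadial.zero_of_ae (Lp.coeFn_zero ℝ 2 volExt), ?_⟩
    filter_upwards [Lp.coeFn_zero ℝ 2 volExt] with x hx
    rw [hx]
    exact ⟨le_rfl, fun _ => rfl⟩
  smul_mem' := by
    rintro ⟨c, hc⟩ u ⟨hu, hu'⟩
    refine ⟨hu.smul_of_ae c (Lp.coeFn_smul c u), ?_⟩
    filter_upwards [hu', Lp.coeFn_smul c u] with x h1 h3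
    change (c • u : L2) x ∈ {y : ℝ | 0 ≤ y ∧ (R < ‖x‖ → y = 0)}
    rw [h3]
    refine ⟨mul_nonneg hc h1.1, fun hx => ?_⟩
    rw [Pi.smul_apply, h1.2 hx, smul_zero]
  isClosed' := by
    refine isClosed_isRadial_L2.inter (isClosed_ae_mem fun x => ?_)
    by_cases hx : R < ‖x‖
    · have : {y : ℝ | 0 ≤ y ∧ (R < ‖x‖ → y = 0)} = {0} := by
        ext y
        simp only [hx, forall_const, mem_ofPred_eq, mem_singleton_iff]
        exact ⟨fun h => h.2, fun h => ⟨h.ge, h⟩⟩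
      rw [this]
      exact isClosed_singleton
    · have : {y : ℝ | 0 ≤ y ∧ (R < ‖x‖ → y = 0)} = Ici 0 := by
        ext y
        simp [hx]
      rw [this]
      exact isClosed_Ici

theorem mem_cone {R : ℝ} {u : L2} : u ∈ cone R ↔
    IsRadial u ∧ ∀ᵐ x ∂volExt, 0 ≤ u x ∧ (R < ‖x‖ → u x = 0) := Iff.rfl

theorem toLp_radial_mem_cone {R : ℝ} {f : ℝ → ℝ} (hf : Measurable f)
    (h : MemLp (radial f) 2 volExt) (h0 : ∀ r, 1 < r → 0 ≤ f r) (hR : ∀ r, 1 < r → R < r → f r = 0) :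
    h.toLp (radial f) ∈ cone R := by
  refine mem_cone.2 ⟨(isRadial_radial hf).congr h.coeFn_toLp, ?_⟩
  filter_upwards [h.coeFn_toLp, ae_restrict_mem measurableSet_Ext] with x hx hxE
  rw [hx]
  exact ⟨h0 _ hxE, hR _ hxE⟩

namespace IsNice

variable {R : ℝ} {γ : ℝ → ℝ}

/-- `evenPrim γ` increases with the absolute value of its argument, and `|r - 1 - s| ≤ r - 1 + s`
for `r > 1`, `s ≥ 0`. -/
theorem wave_nonneg (h : IsNice R γ) {ρ : ℝ → ℝ} {s r : ℝ} (hs : 0 ≤ s) (hr : 1 < r)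
    (hρ : 0 ≤ ρ r) : 0 ≤ wave ρ (evenPrim γ) (fun x => -evenPrim γ x) s r := by
  refine mul_nonneg (mul_nonneg (by positivity) hρ) ?_
  rw [← sub_eq_add_neg, sub_nonneg]
  rcases le_total 0 (r - 1 - s) with h1 | h1
  · exact h.evenPrim_le h1 (by linarith)
  · rw [← evenPrim_neg]
    exact h.evenPrim_le (by linarith) (by linarith)

/-- Both arguments `r - 1 ± s` exceed `R - 1`, where the primitive is constant. -/
theorem wave_eq_zero_of_gt (h : IsNice R γ) {ρ : ℝ → ℝ} {s r : ℝ} (hs : 0 ≤ s) (hr : R + s < r) :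
    wave ρ (evenPrim γ) (fun x => -evenPrim γ x) s r = 0 := by
  rw [wave, h.evenPrim_eq (z := r - 1 - s) (by linarith) (by linarith)]
  ring

theorem sqrtWeight_nonneg {r : ℝ} : 0 ≤ sqrtWeight r :=
  mul_nonneg (Real.smoothTransition.nonneg _) (by positivity)

theorem pos_mem_cone (h : IsNice R γ) {s : ℝ} (hs : 0 ≤ s) : H10.toL2 (h.pos s) ∈ cone (R + s) := by
  rw [toL2_pos]
  refine toLp_radial_mem_cone ?_ _ (fun r hr => h.wave_nonneg hs hr sqrtWeight_nonneg)
    (fun r _ hr => h.wave_eq_zero_of_gt hs hr)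
  exact (isProfile_wave isWeight_sqrtWeight.smooth isWeight_sqrtWeight.low
    h.isWavePair s).smooth.continuous.measurable

theorem pot_mem_cone (h : IsNice R γ) {s : ℝ} (hs : 0 ≤ s) : h.pot s ∈ cone (R + s) := by
  refine toLp_radial_mem_cone ?_ _ (fun r hr => h.wave_nonneg hs hr
    (mul_nonneg sqrtWeight_nonneg (by positivity))) (fun r _ hr => h.wave_eq_zero_of_gt hs hr)
  exact (isProfile_wave isWeight_potWeight.smooth isWeight_potWeight.low
    h.isWavePair s).smooth.continuous.measurable

theorem toL2_mem_cone (h : IsNice R γ) : h.toL2 ∈ cone R :=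
  toLp_radial_mem_cone h.smooth.continuous.measurable _ (fun r _ => h.nonneg r)
    (fun r _ hr => h.high r hr.le)

end IsNice

/-! ### Density of nice profiles -/

/-- Polar coordinates for indicator functions. The set is cut into bounded pieces because a
vanishing real-valued measure gives a null set only when the measure is finite. -/
theorem volume_norm_preimage {N : Set ℝ} (hN : MeasurableSet N) (h0 : volume N = 0) :
    (volume : Measure Plane) ((fun x => ‖x‖) ⁻¹' N) = 0 := by
  have hsub : (fun x : Plane => ‖x‖) ⁻¹' N ⊆ ⋃ k : ℕ, (fun x : Plane => ‖x‖) ⁻¹' (N ∩ Iic (k : ℝ)) := by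
    intro x hx
    obtain ⟨k, hk⟩ := exists_nat_ge ‖x‖
    exact mem_iUnion.2 ⟨k, hx, hk⟩
  refine measure_mono_null hsub (measure_iUnion_null fun k => ?_)
  have hm : MeasurableSet ((fun x : Plane => ‖x‖) ⁻¹' (N ∩ Iic (k : ℝ))) :=
    measurable_norm (hN.inter measurableSet_Iic)
  have hfin : (volume : Measure Plane) ((fun x : Plane => ‖x‖) ⁻¹' (N ∩ Iic (k : ℝ))) ≠ ⊤ := by
    refine ((measure_mono ?_).trans_lt
      (isCompact_closedBall (0 : Plane) (k : ℝ)).measure_lt_top).ne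
    intro x hx
    simpa using hx.2
  have h1 := integral_fun_norm_addHaar (volume : Measure Plane)
    (fun r => (N ∩ Iic (k : ℝ)).indicator (fun _ => (1 : ℝ)) r)
  have h2 : ∫ x : Plane, (N ∩ Iic (k : ℝ)).indicator (fun _ => (1 : ℝ)) ‖x‖ =
      (volume : Measure Plane).real ((fun x : Plane => ‖x‖) ⁻¹' (N ∩ Iic (k : ℝ))) := by
    rw [← integral_indicator_one hm]
    rfl
  have h3 : ∫ y in Ioi (0 : ℝ), y ^ (Module.finrank ℝ Plane - 1) •
      (N ∩ Iic (k : ℝ)).indicator (fun _ => (1 : ℝ)) y = 0 := by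
    refine integral_eq_zero_of_ae (ae_restrict_of_ae ?_)
    have : ∀ᵐ y : ℝ, y ∉ N := measure_eq_zero_iff_ae_notMem.1 h0
    filter_upwards [this] with y hy
    rw [indicator_of_notMem fun h => hy h.1, smul_zero]
    rfl
  rw [h2, h3, smul_zero, smul_zero] at h1
  exact (measureReal_eq_zero_iff hfin).1 h1

theorem ae_norm_of_ae {P : ℝ → Prop} (h : ∀ᵐ r : ℝ, P r) : ∀ᵐ x ∂volExt, P ‖x‖ := by
  refine ae_restrict_of_ae ?_
  obtain ⟨N, hsub, hN, h0⟩ := exists_measurable_superset_of_null (ae_iff.1 h)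
  refine measure_mono_null ?_ (volume_norm_preimage hN h0)
  intro x hx
  exact hsub hx

/-- Bounded profiles with compact support in `(1, R)` are limits of nice profiles. -/
theorem exists_nice_approx {R C a b : ℝ} {f : ℝ → ℝ} (hf : Measurable f) (ha : 1 < a) (hb : b < R)
    (hR : 1 ≤ R) (h0 : ∀ r, 0 ≤ f r) (hC : ∀ r, f r ≤ C) (hlow : ∀ r < a, f r = 0)
    (hhigh : ∀ r, b < r → f r = 0) :
    ∃ γ : ℕ → ℝ → ℝ, (∀ n, IsNice R (γ n)) ∧ (∀ n r, γ n r ≤ C) ∧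
      ∀ᵐ x ∂volExt, Tendsto (fun n => γ n ‖x‖) atTop (𝓝 (f ‖x‖)) := by
  -- The mollification radius: averaging over distance `d` keeps the support above `(1 + a)/2 > 1`
  -- and below `R`.
  set d : ℝ := min ((a - 1) / 2) (R - b) with hd
  have hd0 : 0 < d := lt_min (by linarith) (by linarith)
  have hd1 : d ≤ (a - 1) / 2 := min_le_left _ _
  have hd2 : d ≤ R - b := min_le_right _ _
  let φ : ℕ → ContDiffBump (0 : ℝ) := fun n =>
    ⟨d / (n + 1) / 2, d / (n + 1), by positivity, by
      have : 0 < d / ((n : ℝ) + 1) := by positivity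
      linarith⟩
  have hφd : ∀ n, (φ n).rOut ≤ d := fun n => by
    change d / ((n : ℝ) + 1) ≤ d
    exact div_le_self hd0.le (by linarith [n.cast_nonneg (α := ℝ)])
  have hint : Integrable f := by
    refine Integrable.mono' (g := (Icc a b).indicator fun _ => C) ?_ hf.aestronglyMeasurable ?_
    · exact (integrable_indicator_iff measurableSet_Icc).2 (integrableOn_const (by simp))
    · refine .of_forall fun r => ?_
      rw [Real.norm_eq_abs, abs_of_nonneg (h0 r)]
      by_cases hr : r ∈ Icc a b
      · rw [indicator_of_mem hr]
        exact hC r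
      · rw [indicator_of_notMem hr]
        simp only [mem_Icc, not_and_or, not_le] at hr
        rcases hr with hr | hr
        · exact (hlow r hr).le
        · exact (hhigh r hr).le
  set γ : ℕ → ℝ → ℝ := fun n =>
    convolution ((φ n).normed volume) f (ContinuousLinearMap.lsmul ℝ ℝ) volume with hγ
  have hexp : ∀ n r, γ n r = ∫ t, (φ n).normed volume t * f (r - t) := fun n r => rfl
  have hloc := hint.locallyIntegrable
  have hzero : ∀ n t, d ≤ |t| → (φ n).normed volume t = 0 := by
    intro n t ht
    have : t ∉ Function.support ((φ n).normed volume) := by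
      rw [(φ n).support_normed_eq]
      simp only [Metric.mem_ball, dist_zero_right, Real.norm_eq_abs, not_lt]
      exact (hφd n).trans ht
    simpa using this
  refine ⟨γ, fun n => ⟨?_, fun r => ?_, hR, ⟨(1 + a) / 2, by linarith, fun r hr => ?_⟩,
    fun r hr => ?_⟩, fun n r => ?_, ?_⟩
  · exact HasCompactSupport.contDiff_convolution_left _ (φ n).hasCompactSupport_normed
      (φ n).contDiff_normed hloc
  · rw [hexp]
    exact integral_nonneg fun t => mul_nonneg ((φ n).nonneg_normed t) (h0 _)
  · rw [hexp]
    refine integral_eq_zero_of_ae (.of_forall fun t => ?_)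
    rcases le_or_gt d |t| with ht | ht
    · simp [hzero n t ht]
    · have : -t ≤ |t| := neg_le_abs t
      simp [hlow (r - t) (by linarith)]
  · rw [hexp]
    refine integral_eq_zero_of_ae (.of_forall fun t => ?_)
    rcases le_or_gt d |t| with ht | ht
    · simp [hzero n t ht]
    · have : t ≤ |t| := le_abs_self t
      simp [hhigh (r - t) (by linarith)]
  · rw [hexp]
    calc _ ≤ ∫ t, (φ n).normed volume t * C := by
          refine integral_mono_of_nonneg (.of_forall fun t =>
            mul_nonneg ((φ n).nonneg_normed t) (h0 _)) ((φ n).integrable_normed.mul_const C)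
            (.of_forall fun t => mul_le_mul_of_nonneg_left (hC _) ((φ n).nonneg_normed t))
      _ = C := by rw [integral_mul_const, (φ n).integral_normed, one_mul]
  · refine ae_norm_of_ae (P := fun r => Tendsto (fun n => γ n r) atTop (𝓝 (f r))) ?_
    -- Lebesgue differentiation applies because the outer radius of each bump is twice the inner
    -- one.
    refine ContDiffBump.ae_convolution_tendsto_right_of_locallyIntegrable (K := 2) ?_ ?_ hloc
    · change Tendsto (fun n : ℕ => d / ((n : ℝ) + 1)) atTop (𝓝 0)
      exact tendsto_const_div_atTop_nhds_zero_nat d |>.comp (tendsto_add_atTop_nat 1) |>.congr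
        fun n => by simp
    · refine .of_forall fun n => ?_
      change d / ((n : ℝ) + 1) ≤ 2 * (d / (n + 1) / 2)
      linarith

theorem memLp_indicator_ball {p : ℝ≥0∞} (C R : ℝ) :
    MemLp ((Metric.closedBall (0 : Plane) R).indicator fun _ => C) p volExt :=
  memLp_indicator_const p Metric.isClosed_closedBall.measurableSet _
    (Or.inr ((isCompact_closedBall (0 : Plane) R).measure_lt_top (μ := volExt)).ne)

/-! ### Truncation of radial profiles. -/

/-- The truncations of a profile. -/
def trunc (R : ℝ) (f : ℝ → ℝ) (n : ℕ) (r : ℝ) : ℝ :=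
  (Icc (1 + 1 / ((n : ℝ) + 1)) (R - 1 / ((n : ℝ) + 1))).indicator
    (fun r => min (max (f r) 0) n) r

theorem measurable_trunc {R : ℝ} {f : ℝ → ℝ} (hf : Measurable f) (n : ℕ) :
    Measurable (trunc R f n) :=
  ((hf.max measurable_const).min measurable_const).indicator measurableSet_Icc

theorem trunc_nonneg {R : ℝ} {f : ℝ → ℝ} (n : ℕ) (r : ℝ) : 0 ≤ trunc R f n r :=
  indicator_nonneg (fun _ _ => le_min (le_max_right _ _) n.cast_nonneg) r

theorem trunc_le {R : ℝ} {f : ℝ → ℝ} (n : ℕ) (r : ℝ) : trunc R f n r ≤ max (f r) 0 :=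
  indicator_le_self' (fun _ _ => le_max_right _ _) r |>.trans' <| by
    refine indicator_le_indicator (min_le_left _ _)

theorem trunc_le_nat {R : ℝ} {f : ℝ → ℝ} (n : ℕ) (r : ℝ) : trunc R f n r ≤ n := by
  by_cases hr : r ∈ Icc (1 + 1 / ((n : ℝ) + 1)) (R - 1 / ((n : ℝ) + 1))
  · rw [trunc, indicator_of_mem hr]
    exact min_le_right _ _
  · rw [trunc, indicator_of_notMem hr]
    exact n.cast_nonneg

/-- At each `r` in `(1, R)` the truncation is eventually exact: the window exhausts `(1, R)` and the
cap `n` passes `f r`. -/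
theorem tendsto_trunc {R : ℝ} {f : ℝ → ℝ} {r : ℝ} (hr : 1 < r) (hR : r < R) (h0 : 0 ≤ f r) :
    Tendsto (fun n => trunc R f n r) atTop (𝓝 (f r)) := by
  refine tendsto_const_nhds.congr' ?_
  obtain ⟨N, hN⟩ := exists_nat_ge (f r)
  have h1 := tendsto_one_div_add_atTop_nhds_zero_nat (𝕜 := ℝ)
  filter_upwards [eventually_ge_atTop N, h1.eventually_lt_const (show 0 < r - 1 by linarith),
    h1.eventually_lt_const (show 0 < R - r by linarith)] with n hn h2 h3
  have hn' : (N : ℝ) ≤ n := by exact_mod_cast hn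
  rw [trunc, indicator_of_mem (show r ∈ Icc (1 + 1 / ((n : ℝ) + 1)) (R - 1 / ((n : ℝ) + 1)) from
    ⟨by linarith, by linarith⟩), max_eq_left h0,
    min_eq_left (hN.trans hn')]

theorem memLp_radial_trunc {R : ℝ} {f : ℝ → ℝ} (hf : Measurable f) (n : ℕ) (p : ℝ≥0∞) :
    MemLp (radial (trunc R f n)) p volExt := by
  refine (memLp_indicator_ball (p := p) (n : ℝ) R).mono
    ((measurable_trunc hf n).comp measurable_norm).aestronglyMeasurable (.of_forall fun x => ?_)
  rw [Real.norm_eq_abs, radial, abs_of_nonneg (trunc_nonneg n _)]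
  by_cases hx : ‖x‖ ≤ R
  · rw [indicator_of_mem (by simpa using hx), Real.norm_natCast]
    exact trunc_le_nat n _
  · have : trunc R f n ‖x‖ = 0 := by
      refine indicator_of_notMem (fun h => hx (h.2.trans ?_)) _
      have : (0 : ℝ) ≤ 1 / ((n : ℝ) + 1) := by positivity
      linarith
    rw [this]
    exact norm_nonneg _

/-! ### Invariance of the cones -/

theorem toLp_mem_closure_nice {R C a b : ℝ} {f : ℝ → ℝ} (hf : Measurable f) (ha : 1 < a)
    (hb : b < R) (hR : 1 ≤ R) (h0 : ∀ r, 0 ≤ f r) (hC : ∀ r, f r ≤ C) (hlow : ∀ r < a, f r = 0)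
    (hhigh : ∀ r, b < r → f r = 0) (hm : MemLp (radial f) 2 volExt) :
    ∃ γ : ℕ → ℝ → ℝ, ∃ h : ∀ n, IsNice R (γ n), (∀ n r, γ n r ≤ C) ∧
      (∀ᵐ x ∂volExt, Tendsto (fun n => γ n ‖x‖) atTop (𝓝 (f ‖x‖))) ∧
      Tendsto (fun n => (h n).toL2) atTop (𝓝 (hm.toLp (radial f))) := by
  obtain ⟨γ, h, hγC, hlim⟩ := exists_nice_approx hf ha hb hR h0 hC hlow hhigh
  refine ⟨γ, h, hγC, hlim, ?_⟩
  refine tendsto_toLp_of_dominated (by simp) (fun n => (h n).isTest.isSmoothCpt.memLp) hm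
    (memLp_indicator_ball C R) (.of_forall fun n => .of_forall fun x => ?_) hlim
  by_cases hx : ‖x‖ ≤ R
  · rw [indicator_of_mem (by simpa using hx), Real.norm_eq_abs, radial, radial, abs_le]
    constructor <;> linarith [(h n).nonneg ‖x‖, hγC n ‖x‖, h0 ‖x‖, hC ‖x‖]
  · rw [not_le] at hx
    rw [radial, radial, (h n).high _ hx.le, hhigh _ (hb.trans hx),
      indicator_of_notMem (by simpa using hx)]
    simp

theorem exists_tendsto_trunc {R : ℝ} {u : L2} (hu : u ∈ cone R) : ∃ f : ℝ → ℝ, ∃ hf : Measurable f,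
    Tendsto (fun n => (memLp_radial_trunc (R := R) hf n 2).toLp _) atTop (𝓝 u) ∧
      ∀ n, ∀ᵐ x ∂volExt, ‖radial (trunc R f n) x‖ₑ ≤ ‖u x‖ₑ := by
  obtain ⟨⟨f, hf, hfu⟩, hu⟩ := mem_cone.1 hu
  have hle : ∀ n, ∀ᵐ x ∂volExt, ‖radial (trunc R f n) x‖ ≤ ‖u x‖ := fun n => by
    filter_upwards [hfu, hu] with x h1 h2
    have h3 := trunc_nonneg (R := R) (f := f) n ‖x‖
    have h4 := trunc_le (R := R) (f := f) n ‖x‖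
    rw [← h1, max_eq_left h2.1] at h4
    rwa [Real.norm_of_nonneg h2.1, radial, Real.norm_of_nonneg h3]
  refine ⟨f, hf, ?_, fun n => (hle n).mono fun x hx => enorm_le_iff_norm_le.2 hx⟩
  rw [← Lp.toLp_coeFn u (Lp.memLp u)]
  refine tendsto_toLp_of_dominated (by simp) (fun n => memLp_radial_trunc hf n 2) (Lp.memLp u)
    (Lp.memLp u) (.of_forall fun n => ?_) ?_
  · filter_upwards [hfu, hu] with x h1 h2
    have h3 := trunc_nonneg (R := R) (f := f) n ‖x‖
    have h4 := trunc_le (R := R) (f := f) n ‖x‖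
    rw [← h1, max_eq_left h2.1] at h4
    rw [Real.norm_eq_abs, radial, abs_le]
    constructor <;> linarith
  · have hne : ∀ᵐ x ∂volExt, ‖x‖ ≠ R := ae_norm_of_ae (Measure.ae_ne volume R)
    filter_upwards [hfu, hu, hne, ae_restrict_mem measurableSet_Ext] with x h1 h2 h3 h4
    rw [h1]
    rcases lt_or_gt_of_ne h3 with h5 | h5
    · exact tendsto_trunc h4 h5 (h1 ▸ h2.1)
    · have h6 := h2.2 h5
      refine tendsto_const_nhds.congr fun n => ?_
      have h7 := trunc_nonneg (R := R) (f := f) n ‖x‖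
      have h8 := trunc_le (R := R) (f := f) n ‖x‖
      rw [← h1, h6, max_self] at h8
      rw [← h1, h6]
      exact le_antisymm h7 h8

/-- Density in two stages: truncation gives bounded profiles supported in a compact part of `(1,
R)`, and mollification makes these smooth. -/
theorem mem_closure_nice {R : ℝ} (hR : 1 ≤ R) {u : L2} (hu : u ∈ cone R) :
    u ∈ closure {v : L2 | ∃ γ, ∃ h : IsNice R γ, v = h.toL2} := by
  obtain ⟨f, hf, hlim, -⟩ := exists_tendsto_trunc hu
  refine mem_of_mem_of_subset (mem_closure_of_tendsto hlim (.of_forall fun n => ?_))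
    closure_closure.subset
  have hn : (0 : ℝ) < 1 / ((n : ℝ) + 1) := by positivity
  obtain ⟨γ, h, -, -, h3⟩ := toLp_mem_closure_nice (R := R) (measurable_trunc (R := R) hf n)
    (a := 1 + 1 / ((n : ℝ) + 1)) (b := R - 1 / ((n : ℝ) + 1)) (by linarith) (by linarith) hR
    (trunc_nonneg n) (trunc_le_nat n)
    (fun r hr => indicator_of_notMem (fun h => absurd h.1 (not_le.2 hr)) _)
    (fun r hr => indicator_of_notMem (fun h => absurd h.2 (not_le.2 hr)) _)
    (memLp_radial_trunc hf n 2)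
  exact mem_closure_of_tendsto h3 (.of_forall fun k => ⟨γ k, h k, rfl⟩)

section wave

variable {T : ℝ≥0 → Energy →L[ℝ] Energy}

/-- Iteration of Duhamel's formula. Against a `ψ` in the dual cone the parametrix contributes
nonnegatively, so only the integral can be negative; the previous bound applies to it because the
source at time `s` lies in `cone (R + s)`, with remaining time `t - s`. Each round halves the
constant. -/
theorem inner_solCLM_lower (hT : IsC0Semigroup T) (hG : IsGenerator T waveOp) {τ : ℝ≥0} {M : ℝ}
    (hM0 : 0 ≤ M) (hM : ∀ t ≤ τ, ‖solCLM T t‖ ≤ M) (n : ℕ) :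
    ∀ t ≤ τ, ∀ R : ℝ, 1 ≤ R → ∀ g ∈ cone R, ∀ ψ : L2, (∀ u ∈ cone (R + t), 0 ≤ inner ℝ u ψ) →
      -(M / 2 ^ n * ‖g‖ * ‖ψ‖ * Real.exp ((2 * τ + 1) * t)) ≤ inner ℝ ψ (solCLM T t g) := by
  induction n with
  | zero =>
    intro t ht R _ g _ ψ _
    have h1 : |inner ℝ ψ (solCLM T t g)| ≤ ‖ψ‖ * (M * ‖g‖) :=
      (abs_real_inner_le_norm _ _).trans (mul_le_mul_of_nonneg_left
        ((solCLM T t).le_of_opNorm_le (hM t ht) g) (norm_nonneg _))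
    have h2 : 1 ≤ Real.exp ((2 * τ + 1) * t) := Real.one_le_exp (by positivity)
    have h3 : 0 ≤ M * ‖g‖ * ‖ψ‖ := by positivity
    have h4 := (abs_le.1 h1).1
    simp only [pow_zero, div_one]
    nlinarith
  | succ n ih =>
    intro t ht R hR g hg ψ hψ
    have hcl : IsClosed {g : L2 | -(M / 2 ^ (n + 1) * ‖g‖ * ‖ψ‖ * Real.exp ((2 * τ + 1) * t)) ≤
        inner ℝ ψ (solCLM T t g)} := by
      refine isClosed_le ?_ ?_
      · fun_prop
      · exact continuous_const.inner (solCLM T t).continuous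
    refine closure_minimal ?_ hcl (mem_closure_nice hR hg)
    rintro _ ⟨γ, h, rfl⟩
    set A : ℝ := M / 2 ^ n * ‖h.toL2‖ * ‖ψ‖ with hA
    have hA0 : 0 ≤ A := by positivity
    have htr : (t : ℝ) ≤ τ := by exact_mod_cast ht
    -- The source has norm at most `τ ‖g‖`. The exponential rate `2τ + 1` is chosen so that
    -- integration yields the factor `τ / (2τ + 1) ≤ 1/2`.
    have hD := h.duhamel hT hG ψ t (c := τ * A) (lam := 2 * τ + 1) (by positivity) ?_
    · have hpos : 0 ≤ inner ℝ ψ (H10.toL2 (h.pos t)) := by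
        rw [real_inner_comm]
        exact hψ _ (h.pos_mem_cone t.2)
      have hc0 : 0 ≤ τ * A / (2 * τ + 1) := by positivity
      have hle : τ * A / (2 * τ + 1) ≤ A / 2 := by
        rw [div_le_div_iff₀ (by positivity) (by norm_num)]
        nlinarith
      have he := (Real.exp_pos ((2 * τ + 1) * t)).le
      have e : M / 2 ^ (n + 1) * ‖h.toL2‖ * ‖ψ‖ = A / 2 := by
        rw [hA, pow_succ]
        ring
      simp only [mem_ofPred_eq, e]
      nlinarith [mul_le_mul_of_nonneg_right hle he]
    · intro s hs
      have hts : ((t : ℝ) - s).toNNReal ≤ τ := by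
        rw [Real.toNNReal_le_iff_le_coe]
        linarith [hs.1]
      have hcoe : (((t : ℝ) - s).toNNReal : ℝ) = t - s := Real.coe_toNNReal _ (by linarith [hs.2])
      have := ih _ hts (R + s) (by linarith [hs.1]) (h.pot s) (h.pot_mem_cone hs.1) ψ (by
        rw [hcoe, show R + s + (t - s) = R + t by ring]
        exact hψ)
      rw [hcoe] at this
      refine le_trans (neg_le_neg ?_) this
      refine mul_le_mul_of_nonneg_right ?_ (Real.exp_pos _).le
      have h1 : ‖h.pot s‖ ≤ τ * ‖h.toL2‖ := (h.norm_pot_le hs.1).trans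
        (mul_le_mul_of_nonneg_right (by linarith [hs.2]) (norm_nonneg _))
      calc M / 2 ^ n * ‖h.pot s‖ * ‖ψ‖ ≤ M / 2 ^ n * (τ * ‖h.toL2‖) * ‖ψ‖ := by gcongr
        _ = τ * A := by rw [hA]; ring

/-- The solution operators map nonnegative radial functions to nonnegative radial functions, with
finite speed of propagation. -/
theorem solCLM_mem_cone (hT : IsC0Semigroup T) (hG : IsGenerator T waveOp) (t : ℝ≥0) {R : ℝ}
    (hR : 1 ≤ R) {g : L2} (hg : g ∈ cone R) : solCLM T t g ∈ cone (R + t) := by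
  obtain ⟨M, hM0, hM⟩ := exists_bound_solCLM hT t
  by_contra hcon
  -- A point outside the closed convex cone is separated from it by some `ψ` in the dual cone, and
  -- the lower bounds tend to zero as the iteration proceeds.
  obtain ⟨ψ, hψ, hneg⟩ := (cone (R + t)).hyperplane_separation' hcon
  rw [real_inner_comm] at hneg
  have h1 : Tendsto (fun n : ℕ => -(M / 2 ^ n * ‖g‖ * ‖ψ‖ * Real.exp ((2 * t + 1) * t))) atTop
      (𝓝 (-(0 * ‖g‖ * ‖ψ‖ * Real.exp ((2 * t + 1) * t)))) := by
    refine (((Tendsto.mul_const _ ?_).mul_const _).mul_const _).neg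
    exact tendsto_const_nhds.div_atTop (tendsto_pow_atTop_atTop_of_one_lt one_lt_two)
  have h2 := le_of_tendsto' h1 fun n => inner_solCLM_lower hT hG hM0 hM n t le_rfl R hR g hg ψ hψ
  simp only [zero_mul, neg_zero] at h2
  linarith

end wave

/-! ### The superharmonic weights -/

/-- The function `1 + log r - r^m`. -/
def superWeight (m : ℤ) (r : ℝ) : ℝ := 1 + Real.log r - r ^ m

/-- The weight `1 + log r - r^m`, cut off near the origin and near infinity. -/
def cutWeight (m : ℤ) (R r : ℝ) : ℝ := innerCutoff r * outerCutoff R r * superWeight m r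

theorem isProfile_cutWeight (m : ℤ) (R : ℝ) : IsProfile (cutWeight m R) := by
  refine (isProfile_cutoff R).mul_smoothOn fun r hr => ?_
  have hr0 : r ≠ 0 := ne_of_gt hr
  exact ((contDiffAt_const.add (Real.contDiffAt_log.2 hr0)).sub
    (analyticAt_id.zpow hr0).contDiffAt).contDiffWithinAt

/-- Subtracting `r^m` restores the Dirichlet condition, which `1 + log r` alone violates. -/
theorem cutWeight_one (m : ℤ) (R : ℝ) : cutWeight m R 1 = 0 := by simp [cutWeight, superWeight]

theorem cutWeight_eq {m : ℤ} {R r : ℝ} (h1 : 3 / 4 ≤ r) (hR : r ≤ R) :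
    cutWeight m R r = superWeight m r := by
  rw [cutWeight, innerCutoff_of_ge h1, outerCutoff_of_le hR, one_mul, one_mul]

theorem hasDerivAt_superWeight (m : ℤ) {r : ℝ} (hr : r ≠ 0) :
    HasDerivAt (superWeight m) (r⁻¹ - m * r ^ (m - 1)) r :=
  ((Real.hasDerivAt_log hr).const_add 1).sub (hasDerivAt_zpow m r (Or.inl hr))

/-- `1 + log r` is harmonic in the plane and the Laplacian of `r^m` is `m² r^{m-2}`. The cutoffs
play no role for `1 < |x| < R`. -/
theorem lap_cutWeight_nonpos (m : ℤ) {R : ℝ} {x : Plane} (hx : x ∈ Ext) (hR : ‖x‖ < R) :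
    lap (radial (cutWeight m R)) x ≤ 0 := by
  have hr1 : 1 < ‖x‖ := hx
  have hr0 : ‖x‖ ≠ 0 := by positivity
  have hmem : Ioo (3 / 4 : ℝ) R ∈ 𝓝 ‖x‖ := Ioo_mem_nhds (by linarith) hR
  have e1 : ∀ r ∈ Ioo (3 / 4 : ℝ) R, HasDerivAt (cutWeight m R) (r⁻¹ - m * r ^ (m - 1)) r := by
    intro r hr
    refine (hasDerivAt_superWeight m (by linarith [hr.1])).congr_of_eventuallyEq ?_
    filter_upwards [Ioo_mem_nhds hr.1 hr.2] with y hy using cutWeight_eq hy.1.le hy.2.le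
  have e2 : deriv (deriv (cutWeight m R)) ‖x‖ =
      -(‖x‖ ^ 2)⁻¹ - m * ((m - 1 : ℤ) * ‖x‖ ^ (m - 1 - 1)) := by
    have : deriv (cutWeight m R) =ᶠ[𝓝 ‖x‖] fun r => r⁻¹ - m * r ^ (m - 1) := by
      filter_upwards [hmem] with r hr using (e1 r hr).deriv
    rw [this.deriv_eq]
    exact ((hasDerivAt_inv hr0).sub
      ((hasDerivAt_zpow (m - 1) ‖x‖ (Or.inl hr0)).const_mul (m : ℝ))).deriv
  rw [(isProfile_cutWeight m R).lap (Ext.ne_zero hx), e2, (e1 _ ⟨by linarith, hR⟩).deriv]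
  have e3 : ‖x‖ ^ (m - 1) = ‖x‖ ^ (m - 1 - 1) * ‖x‖ := by
    rw [← zpow_add_one₀ hr0]
    congr 1
    ring
  rw [e3]
  have e4 : -(‖x‖ ^ 2)⁻¹ - m * ((m - 1 : ℤ) * ‖x‖ ^ (m - 1 - 1)) +
      (‖x‖⁻¹ - m * (‖x‖ ^ (m - 1 - 1) * ‖x‖)) / ‖x‖ = -(m ^ 2 * ‖x‖ ^ (m - 1 - 1)) := by
    push_cast
    field_simp
    ring
  rw [e4, neg_nonpos]
  positivity

/-! ### Integrals with respect to the weighted measure -/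

theorem lintegral_muExt (F : Plane → ℝ≥0∞) :
    ∫⁻ x, F x ∂muExt = ∫⁻ x, ENNReal.ofReal (1 + Real.log ‖x‖) * F x ∂volExt := by
  have hm : Measurable fun x : Plane => ENNReal.ofReal (1 + Real.log ‖x‖) :=
    ENNReal.measurable_ofReal.comp
      (measurable_const.add (Real.measurable_log.comp measurable_norm))
  rw [muExt, lintegral_withDensity_eq_lintegral_mul_non_measurable _ hm
    (.of_forall fun x => ENNReal.ofReal_lt_top)]
  rfl

theorem eLpNorm_one_muExt (u : Plane → ℝ) :
    eLpNorm u 1 muExt = ∫⁻ x, ENNReal.ofReal (1 + Real.log ‖x‖) * ‖u x‖ₑ ∂volExt := by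
  rw [eLpNorm_one_eq_lintegral_enorm, lintegral_muExt]

theorem muExt_closedBall_lt_top (R : ℝ) : muExt (Metric.closedBall (0 : Plane) R) < ⊤ := by
  have hB : MeasurableSet (Metric.closedBall (0 : Plane) R) :=
    Metric.isClosed_closedBall.measurableSet
  rw [← lintegral_indicator_one hB, lintegral_muExt]
  have hle : ∀ᵐ x ∂volExt, ENNReal.ofReal (1 + Real.log ‖x‖) *
      (Metric.closedBall (0 : Plane) R).indicator 1 x ≤
      (Metric.closedBall (0 : Plane) R).indicator (fun _ => ENNReal.ofReal (1 + Real.log R)) x := by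
    filter_upwards [ae_restrict_mem measurableSet_Ext] with x hx
    have hx1 : 1 < ‖x‖ := hx
    by_cases hxR : x ∈ Metric.closedBall (0 : Plane) R
    · rw [indicator_of_mem hxR, indicator_of_mem hxR, Pi.one_apply, mul_one]
      have : ‖x‖ ≤ R := by simpa using hxR
      exact ENNReal.ofReal_le_ofReal (by gcongr)
    · simp [indicator_of_notMem hxR]
  refine (lintegral_mono_ae hle).trans_lt ?_
  rw [lintegral_indicator_const hB]
  exact ENNReal.mul_lt_top ENNReal.ofReal_lt_top
    ((isCompact_closedBall (0 : Plane) R).measure_lt_top (μ := volExt))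

/-- Convergence in `L²` does not increase the `L¹_{dμ}` norm. -/
theorem eLpNorm_muExt_le_of_tendsto {u : ℕ → L2} {v : L2} (h : Tendsto u atTop (𝓝 v))
    {c : ℕ → ℝ≥0∞} {c₀ : ℝ≥0∞} (hc : Tendsto c atTop (𝓝 c₀))
    (hle : ∀ n, eLpNorm (u n) 1 muExt ≤ c n) : eLpNorm v 1 muExt ≤ c₀ := by
  -- Fatou's lemma along an almost everywhere convergent subsequence.
  obtain ⟨ns, hns, hlim⟩ := (tendstoInMeasure_of_tendsto_Lp h).exists_seq_tendsto_ae
  have h1 := Lp.eLpNorm_lim_le_liminf_eLpNorm (p := 1) (μ := muExt) (f := fun k => u (ns k))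
    (fun k => (Lp.aestronglyMeasurable (u (ns k))).mono_ac muExt_ac_volExt) v
    (muExt_ac_volExt.ae_le hlim)
  refine h1.trans ((liminf_le_liminf (.of_forall fun k => hle (ns k))).trans ?_)
  exact (hc.comp hns.tendsto_atTop).liminf_eq.le

section wave

variable {T : ℝ≥0 → Energy →L[ℝ] Energy}

/-- Test with the weights `1 + log r - r^{-(n+1)}`. On the exterior domain they increase to `1 + log
r`, so Fatou's lemma recovers the weighted norm of the nonnegative solution, while on the right each
weight is at most the density of `μ`. -/
theorem IsNice.eLpNorm_solCLM_le (hT : IsC0Semigroup T) (hG : IsGenerator T waveOp) {R : ℝ}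
    {γ : ℝ → ℝ} (h : IsNice R γ) (t : ℝ≥0) :
    eLpNorm (solCLM T t h.toL2) 1 muExt ≤
      ENNReal.ofReal (1 - Real.exp (-t)) * eLpNorm (radial γ) 1 muExt := by
  set u : L2 := solCLM T t h.toL2 with hu
  have he : 0 ≤ 1 - Real.exp (-(t : ℝ)) := by
    have : Real.exp (-(t : ℝ)) ≤ 1 := Real.exp_le_one_iff.2 (by simp)
    linarith
  -- Up to time `t` the solution lives in the ball of radius `R + t`, so an outer cutoff starting at
  -- `R'` is never seen.
  set R' : ℝ := R + t + 1 with hR'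
  have hcone : ∀ s ≤ t, solCLM T s h.toL2 ∈ cone (R + s) := fun s _ =>
    solCLM_mem_cone hT hG s h.one_le h.toL2_mem_cone
  have hpos := (mem_cone.1 (hcone t le_rfl)).2
  let φ : ℕ → Plane → ℝ := fun n => radial (cutWeight (-((n : ℤ) + 1)) R')
  have hφ : ∀ n, IsSmoothCpt (φ n) := fun n => (isProfile_cutWeight _ _).isSmoothCpt
  have hφx : ∀ n, ∀ x ∈ Ext, ‖x‖ ≤ R' →
      φ n x = 1 + Real.log ‖x‖ - ‖x‖ ^ (-((n : ℤ) + 1)) := fun n x hx hxR => by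
    have hx1 : 1 < ‖x‖ := hx
    exact cutWeight_eq (by linarith) hxR
  have hφ0 : ∀ n, ∀ x ∈ Ext, ‖x‖ ≤ R' → 0 ≤ φ n x ∧ φ n x ≤ 1 + Real.log ‖x‖ := fun n x hx hxR => by
    have hx1 : 1 < ‖x‖ := hx
    rw [hφx n x hx hxR]
    have h1 : ‖x‖ ^ (-((n : ℤ) + 1)) ≤ 1 := zpow_le_one_of_nonpos₀ hx1.le (by lia)
    have h2 : 0 ≤ ‖x‖ ^ (-((n : ℤ) + 1)) := by positivity
    have h3 := Real.log_pos hx1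
    constructor <;> linarith
  have key : ∀ n, inner ℝ ((hφ n).memLp.toLp _) u ≤
      (1 - Real.exp (-(t : ℝ))) * inner ℝ ((hφ n).memLp.toLp _) h.toL2 := fun n => by
    refine inner_solCLM_le hT hG h.isTest (hφ n)
      ((isProfile_cutWeight _ _).pair_mem_H10 (cutWeight_one _ _)) t fun s hs => ?_
    rw [inner_toLp_eq]
    refine integral_nonpos_of_ae ?_
    filter_upwards [(mem_cone.1 (hcone s hs)).2, ae_restrict_mem measurableSet_Ext] with x hx hxE
    rcases lt_or_ge (R + s) ‖x‖ with hxs | hxs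
    · have e := hx.2 hxs
      simp only [Pi.zero_apply]
      exact (mul_eq_zero_of_left e _).le
    · have hs' : (s : ℝ) ≤ t := by exact_mod_cast hs
      exact mul_nonpos_of_nonneg_of_nonpos hx.1 (lap_cutWeight_nonpos _ hxE (by linarith))
  have hgle : ∀ n, ENNReal.ofReal (inner ℝ ((hφ n).memLp.toLp _) h.toL2) ≤
      eLpNorm (radial γ) 1 muExt := fun n => by
    rw [real_inner_comm]
    have e : inner ℝ h.toL2 ((hφ n).memLp.toLp (φ n)) = ∫ x in Ext, φ n x * radial γ x := by
      rw [IsNice.toL2, inner_toLp_eq]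
      exact integral_congr_ae ((hφ n).memLp.coeFn_toLp.mono fun x hx => by simp only [hx])
    rw [e, eLpNorm_one_muExt]
    have hnn : ∀ᵐ x ∂volExt, 0 ≤ φ n x * radial γ x ∧
        φ n x * radial γ x ≤ (1 + Real.log ‖x‖) * radial γ x := by
      filter_upwards [ae_restrict_mem measurableSet_Ext] with x hx
      have hg0 := h.nonneg ‖x‖
      rcases le_or_gt ‖x‖ R' with hxR | hxR
      · exact ⟨mul_nonneg (hφ0 n x hx hxR).1 hg0,
          mul_le_mul_of_nonneg_right (hφ0 n x hx hxR).2 hg0⟩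
      · have : radial γ x = 0 := h.high _ (by linarith [t.2])
        simp [this]
    rw [ofReal_integral_eq_lintegral_ofReal (integrable_mul_volExt (hφ n).memLp
      h.isTest.isSmoothCpt.memLp) (hnn.mono fun x hx => hx.1)]
    refine lintegral_mono_ae ?_
    filter_upwards [hnn, ae_restrict_mem measurableSet_Ext] with x hx hxE
    have hx1 : 1 < ‖x‖ := hxE
    have h3 := Real.log_pos hx1
    rw [Real.enorm_eq_ofReal (show 0 ≤ radial γ x from h.nonneg ‖x‖), ← ENNReal.ofReal_mul (by linarith)]
    exact ENNReal.ofReal_le_ofReal hx.2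
  rw [eLpNorm_one_muExt]
  have hlim : ∀ᵐ x ∂volExt, ENNReal.ofReal (1 + Real.log ‖x‖) * ‖u x‖ₑ =
      liminf (fun n => ENNReal.ofReal (u x * φ n x)) atTop := by
    filter_upwards [hpos, ae_restrict_mem measurableSet_Ext] with x hx hxE
    have hx1 : 1 < ‖x‖ := hxE
    have h3 := Real.log_pos hx1
    refine (Tendsto.liminf_eq ?_).symm
    rw [Real.enorm_eq_ofReal hx.1, ← ENNReal.ofReal_mul (by linarith)]
    refine ENNReal.tendsto_ofReal ?_
    rcases lt_or_ge (R + t) ‖x‖ with hxs | hxs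
    · rw [hx.2 hxs]
      simp
    · simp_rw [hφx _ x hxE (by linarith : ‖x‖ ≤ R')]
      rw [mul_comm]
      have h4 : Tendsto (fun n : ℕ => ‖x‖ ^ (-((n : ℤ) + 1))) atTop (𝓝 0) := by
        have h5 : Tendsto (fun n : ℕ => (‖x‖⁻¹) ^ (n + 1)) atTop (𝓝 0) :=
          (tendsto_pow_atTop_nhds_zero_of_lt_one (by positivity)
            (inv_lt_one_of_one_lt₀ hx1)).comp (tendsto_add_atTop_nat 1)
        refine h5.congr fun n => ?_
        rw [zpow_neg, inv_pow]
        norm_cast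
      simpa using (h4.const_sub (1 + Real.log ‖x‖)).const_mul (u x)
  rw [lintegral_congr_ae hlim]
  refine (lintegral_liminf_le' fun n => ?_).trans ?_
  · exact ((Lp.aestronglyMeasurable u).aemeasurable.mul
      (hφ n).smooth.continuous.measurable.aemeasurable).ennreal_ofReal
  refine liminf_le_of_le (by isBoundedDefault) fun b hb => ?_
  obtain ⟨n, hn⟩ := hb.exists
  refine hn.trans ?_
  rw [← ofReal_integral_eq_lintegral_ofReal (integrable_mul_volExt (Lp.memLp u) (hφ n).memLp)]
  · rw [← inner_toLp_eq (hφ n).memLp u]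
    refine (ENNReal.ofReal_le_ofReal (key n)).trans ?_
    rw [ENNReal.ofReal_mul he]
    gcongr
    exact hgle n
  · filter_upwards [hpos, ae_restrict_mem measurableSet_Ext] with x hx hxE
    rcases lt_or_ge (R + t) ‖x‖ with hxs | hxs
    · have e := hx.2 hxs
      simp only [Pi.zero_apply]
      exact (mul_eq_zero_of_left e _).ge
    · exact mul_nonneg hx.1 (hφ0 n x hxE (by linarith)).1

end wave

/-! ### Restriction to balls -/

/-- The restriction of `g` to the ball of radius `R`. -/
def ballCut (R : ℝ) (g : L2) : L2 :=
  ((Lp.memLp g).indicator (Metric.isClosed_closedBall (x := (0 : Plane)) (ε := R)).measurableSet).toLp _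

theorem coeFn_ballCut (R : ℝ) (g : L2) :
    ballCut R g =ᵐ[volExt] (Metric.closedBall (0 : Plane) R).indicator g := MemLp.coeFn_toLp _

theorem IsRadial.ballCut {g : L2} (hg : IsRadial g) (R : ℝ) : IsRadial (ballCut R g) := by
  obtain ⟨f, hf, hgf⟩ := hg
  refine ⟨(Iic R).indicator f, hf.indicator measurableSet_Iic, ?_⟩
  filter_upwards [hgf, coeFn_ballCut R g] with x h1 h2
  rw [h2]
  by_cases hx : ‖x‖ ≤ R
  · rw [indicator_of_mem (by simpa using hx), indicator_of_mem (by simpa using hx), h1]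
  · rw [indicator_of_notMem (by simpa using hx), indicator_of_notMem (by simpa using hx)]

theorem ballCut_eq_zero (R : ℝ) (g : L2) : ∀ᵐ x ∂volExt, R < ‖x‖ → ballCut R g x = 0 := by
  filter_upwards [coeFn_ballCut R g] with x h1 hx
  rw [h1, indicator_of_notMem (by simpa using hx)]

theorem enorm_ballCut_le (R : ℝ) (g : L2) : ∀ᵐ x ∂volExt, ‖ballCut R g x‖ₑ ≤ ‖g x‖ₑ := by
  filter_upwards [coeFn_ballCut R g] with x h1
  rw [h1]
  exact enorm_indicator_le_enorm_self _ _

theorem tendsto_ballCut_apply (g : L2) :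
    ∀ᵐ x ∂volExt, Tendsto (fun n : ℕ => ballCut (n + 1) g x) atTop (𝓝 (g x)) := by
  filter_upwards [ae_all_iff.2 fun n : ℕ => coeFn_ballCut (n + 1) g] with x h1
  refine tendsto_const_nhds.congr' ?_
  obtain ⟨N, hN⟩ := exists_nat_ge ‖x‖
  filter_upwards [eventually_ge_atTop N] with n hn
  rw [h1, indicator_of_mem]
  have : (N : ℝ) ≤ n := by exact_mod_cast hn
  simp only [mem_closedBall_zero_iff]
  linarith

theorem tendsto_ballCut (g : L2) : Tendsto (fun n : ℕ => ballCut (n + 1) g) atTop (𝓝 g) := by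
  have h := tendsto_toLp_of_dominated (p := 2) (by simp) (fun n : ℕ => Lp.memLp (ballCut (n + 1) g))
    (Lp.memLp g) (Lp.memLp g).norm (.of_forall fun n => ?_) (tendsto_ballCut_apply g)
  · simpa only [Lp.toLp_coeFn] using h
  · filter_upwards [coeFn_ballCut (n + 1) g] with x h1
    rw [h1]
    by_cases hx : x ∈ Metric.closedBall (0 : Plane) (n + 1)
    · rw [indicator_of_mem hx]
      simp
    · rw [indicator_of_notMem hx]
      simp

theorem eLpNorm_muExt_mono {u v : Plane → ℝ} (h : ∀ᵐ x ∂volExt, ‖u x‖ₑ ≤ ‖v x‖ₑ) :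
    eLpNorm u 1 muExt ≤ eLpNorm v 1 muExt := by
  rw [eLpNorm_one_eq_lintegral_enorm, eLpNorm_one_eq_lintegral_enorm]
  exact lintegral_mono_ae (muExt_ac_volExt.ae_le h)

theorem aestronglyMeasurable_muExt (u : L2) : AEStronglyMeasurable u muExt :=
  (Lp.aestronglyMeasurable u).mono_ac muExt_ac_volExt

theorem tendsto_eLpNorm_sub_ballCut {g : L2} (hg : MemLp g 1 muExt) :
    Tendsto (fun n : ℕ => eLpNorm (g - ballCut (n + 1) g : L2) 1 muExt) atTop (𝓝 0) := by
  have e : ∀ n : ℕ, eLpNorm (g - ballCut (n + 1) g : L2) 1 muExt =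
      ∫⁻ x, ‖(g - ballCut (n + 1) g : L2) x‖ₑ ∂muExt := fun n => eLpNorm_one_eq_lintegral_enorm
  have hae : ∀ᵐ x ∂volExt, ∀ n : ℕ, (g - ballCut (n + 1) g : L2) x = g x - ballCut (n + 1) g x :=
    ae_all_iff.2 fun n => Lp.coeFn_sub _ _
  simp_rw [e]
  rw [← lintegral_zero (μ := muExt)]
  refine tendsto_lintegral_of_dominated_convergence' (fun x => ‖g x‖ₑ)
    (fun n => (aestronglyMeasurable_muExt _).enorm) (fun n => ?_) ?_ ?_
  · refine muExt_ac_volExt.ae_le ?_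
    filter_upwards [hae, coeFn_ballCut (n + 1) g] with x h1 h2
    rw [h1, h2]
    by_cases hx : x ∈ Metric.closedBall (0 : Plane) (n + 1)
    · rw [indicator_of_mem hx]
      simp
    · rw [indicator_of_notMem hx]
      simp
  · rw [← eLpNorm_one_eq_lintegral_enorm]
    exact hg.2.ne
  · refine muExt_ac_volExt.ae_le ?_
    filter_upwards [hae, tendsto_ballCut_apply g] with x h1 h2
    simp_rw [h1]
    simpa using (h2.const_sub (g x)).enorm

/-- On functions supported in a fixed ball the `L¹_{dμ}` norm is controlled by the `L²` norm. -/
theorem exists_eLpNorm_muExt_le (R : ℝ) : ∃ K : ℝ≥0, ∀ u : L2,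
    (∀ᵐ x ∂volExt, R < ‖x‖ → u x = 0) → eLpNorm u 1 muExt ≤ K * eLpNorm u 2 volExt := by
  set B := Metric.closedBall (0 : Plane) R with hB
  have hBm : MeasurableSet B := Metric.isClosed_closedBall.measurableSet
  have hfin : volExt B ≠ ⊤ := ((isCompact_closedBall (0 : Plane) R).measure_lt_top (μ := volExt)).ne
  have hfin' : (volExt.restrict B) univ ^ (1 / (1 : ℝ≥0∞).toReal - 1 / (2 : ℝ≥0∞).toReal) ≠ ⊤ := by
    rw [Measure.restrict_apply_univ]
    exact ENNReal.rpow_ne_top_of_nonneg (by norm_num) hfin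
  refine ⟨(ENNReal.ofReal (1 + Real.log R) *
    (volExt.restrict B) univ ^ (1 / (1 : ℝ≥0∞).toReal - 1 / (2 : ℝ≥0∞).toReal)).toNNReal,
    fun u hu => ?_⟩
  rw [ENNReal.coe_toNNReal (ENNReal.mul_ne_top ENNReal.ofReal_ne_top hfin'), eLpNorm_one_muExt]
  calc ∫⁻ x, ENNReal.ofReal (1 + Real.log ‖x‖) * ‖u x‖ₑ ∂volExt
      ≤ ∫⁻ x, B.indicator (fun x => ENNReal.ofReal (1 + Real.log R) * ‖u x‖ₑ) x ∂volExt := by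
        refine lintegral_mono_ae ?_
        filter_upwards [hu, ae_restrict_mem measurableSet_Ext] with x hx hxE
        have hx1 : 1 < ‖x‖ := hxE
        by_cases hxB : ‖x‖ ≤ R
        · rw [indicator_of_mem (by simpa [hB] using hxB)]
          gcongr
        · rw [hx (not_le.1 hxB)]
          simp
    _ = ENNReal.ofReal (1 + Real.log R) * eLpNorm u 1 (volExt.restrict B) := by
        rw [lintegral_indicator hBm, lintegral_const_mul' _ _ ENNReal.ofReal_ne_top,
          eLpNorm_one_eq_lintegral_enorm]
    _ ≤ ENNReal.ofReal (1 + Real.log R) * (eLpNorm u 2 (volExt.restrict B) *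
        (volExt.restrict B) univ ^ (1 / (1 : ℝ≥0∞).toReal - 1 / (2 : ℝ≥0∞).toReal)) := by
        gcongr
        exact eLpNorm_le_eLpNorm_mul_rpow_measure_univ (by norm_num)
          (Lp.aestronglyMeasurable u).restrict
    _ ≤ _ := by
        rw [mul_comm (eLpNorm _ _ _), ← mul_assoc]
        gcongr
        exact Measure.restrict_le_self

/-! ### The estimate for general radial data -/

section wave

variable {T : ℝ≥0 → Energy →L[ℝ] Energy}

/-- Mollified data converge in `L²`, which controls the left side by lower semicontinuity. Their
weighted `L¹` norms converge by dominated convergence on a fixed ball. -/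
theorem eLpNorm_solCLM_toLp_le (hT : IsC0Semigroup T) (hG : IsGenerator T waveOp) (t : ℝ≥0)
    {R C a b : ℝ} {f : ℝ → ℝ} (hf : Measurable f) (ha : 1 < a)
    (hb : b < R) (hR : 1 ≤ R) (h0 : ∀ r, 0 ≤ f r) (hC : ∀ r, f r ≤ C) (hlow : ∀ r < a, f r = 0)
    (hhigh : ∀ r, b < r → f r = 0) (hm : MemLp (radial f) 2 volExt) :
    eLpNorm (solCLM T t (hm.toLp _)) 1 muExt ≤
      ENNReal.ofReal (1 - Real.exp (-t)) * eLpNorm (radial f) 1 muExt := by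
  obtain ⟨γ, h, hγC, hlim, hL⟩ := toLp_mem_closure_nice hf ha hb hR h0 hC hlow hhigh hm
  refine eLpNorm_muExt_le_of_tendsto (((solCLM T t).continuous.tendsto _).comp hL) ?_
    fun n => (h n).eLpNorm_solCLM_le hT hG t
  refine ENNReal.Tendsto.const_mul ?_ (Or.inr ENNReal.ofReal_ne_top)
  simp_rw [eLpNorm_one_eq_lintegral_enorm]
  refine tendsto_lintegral_of_dominated_convergence'
    ((Metric.closedBall (0 : Plane) R).indicator fun _ => ENNReal.ofReal C)
    (fun n => (h n).isTest.isSmoothCpt.smooth.continuous.aestronglyMeasurable.enorm)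
    (fun n => .of_forall fun x => ?_) ?_ ?_
  · show ‖radial (γ n) x‖ₑ ≤ _
    by_cases hx : ‖x‖ ≤ R
    · rw [indicator_of_mem (by simpa using hx),
        Real.enorm_eq_ofReal (show 0 ≤ radial (γ n) x from (h n).nonneg ‖x‖)]
      exact ENNReal.ofReal_le_ofReal (hγC n ‖x‖)
    · rw [not_le] at hx
      rw [radial, (h n).high _ hx.le]
      simp
  · rw [lintegral_indicator_const Metric.isClosed_closedBall.measurableSet]
    exact ENNReal.mul_ne_top ENNReal.ofReal_ne_top (muExt_closedBall_lt_top R).ne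
  · exact muExt_ac_volExt.ae_le (hlim.mono fun x hx => hx.enorm)

/-- The truncations are dominated pointwise by `g`, so no limit is needed on the right side. -/
theorem eLpNorm_solCLM_le_of_mem_cone (hT : IsC0Semigroup T) (hG : IsGenerator T waveOp) (t : ℝ≥0)
    {R : ℝ} (hR : 1 ≤ R) {g : L2} (hg : g ∈ cone R) :
    eLpNorm (solCLM T t g) 1 muExt ≤
      ENNReal.ofReal (1 - Real.exp (-t)) * eLpNorm g 1 muExt := by
  obtain ⟨f, hf, hlim, hle⟩ := exists_tendsto_trunc hg
  refine eLpNorm_muExt_le_of_tendsto (((solCLM T t).continuous.tendsto _).comp hlim)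
    tendsto_const_nhds fun n => ?_
  have hn : (0 : ℝ) < 1 / ((n : ℝ) + 1) := by positivity
  refine (eLpNorm_solCLM_toLp_le hT hG t (R := R) (measurable_trunc (R := R) hf n)
    (a := 1 + 1 / ((n : ℝ) + 1)) (b := R - 1 / ((n : ℝ) + 1)) (by linarith) (by linarith) hR
    (trunc_nonneg n) (trunc_le_nat n)
    (fun r hr => indicator_of_notMem (fun h => absurd h.1 (not_le.2 hr)) _)
    (fun r hr => indicator_of_notMem (fun h => absurd h.2 (not_le.2 hr)) _)
    (memLp_radial_trunc hf n 2)).trans ?_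
  gcongr
  exact eLpNorm_muExt_mono (hle n)

theorem posPart_mem_cone {R : ℝ} {g : L2} (hg : IsRadial g)
    (hR : ∀ᵐ x ∂volExt, R < ‖x‖ → g x = 0) : Lp.posPart g ∈ cone R := by
  obtain ⟨f, hf, hgf⟩ := hg
  refine mem_cone.2 ⟨⟨fun r => max (f r) 0, hf.max measurable_const, ?_⟩, ?_⟩
  · filter_upwards [hgf, Lp.coeFn_posPart g] with x h1 h2
    rw [h2, h1]
  · filter_upwards [hR, Lp.coeFn_posPart g] with x h1 h2
    rw [h2]
    exact ⟨le_max_right _ _, fun h => by rw [h1 h, max_self]⟩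

theorem negPart_mem_cone {R : ℝ} {g : L2} (hg : IsRadial g)
    (hR : ∀ᵐ x ∂volExt, R < ‖x‖ → g x = 0) : Lp.negPart g ∈ cone R := by
  refine posPart_mem_cone ?_ ?_
  · exact (hg.smul_of_ae (-1) (k := (-g : L2)) (by simpa using Lp.coeFn_neg g))
  · filter_upwards [hR, Lp.coeFn_neg g] with x h1 h2 hx
    rw [h2, Pi.neg_apply, h1 hx, neg_zero]

theorem posPart_sub_negPart (g : L2) : Lp.posPart g - Lp.negPart g = g := by
  refine Lp.ext ?_
  filter_upwards [Lp.coeFn_sub (Lp.posPart g) (Lp.negPart g), Lp.coeFn_posPart g,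
    Lp.coeFn_negPart_eq_max g] with x h1 h2 h3
  rw [h1, Pi.sub_apply, h2, h3]
  rcases le_total 0 (g x) with h | h
  · rw [max_eq_left h, max_eq_right (by linarith), sub_zero]
  · rw [max_eq_right h, max_eq_left (by linarith)]
    ring

/-- Additivity on the two parts means that splitting a signed datum costs no constant. -/
theorem eLpNorm_posPart_add_negPart (g : L2) :
    eLpNorm (Lp.posPart g) 1 muExt + eLpNorm (Lp.negPart g) 1 muExt = eLpNorm g 1 muExt := by
  simp_rw [eLpNorm_one_eq_lintegral_enorm]
  rw [← lintegral_add_left' (aestronglyMeasurable_muExt _).enorm]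
  refine lintegral_congr_ae (muExt_ac_volExt.ae_le ?_)
  filter_upwards [Lp.coeFn_posPart g, Lp.coeFn_negPart_eq_max g] with x h2 h3
  rw [h2, h3]
  rcases le_total 0 (g x) with h | h
  · rw [max_eq_left h, max_eq_right (by linarith)]
    simp
  · rw [max_eq_right h, max_eq_left (by linarith)]
    simp

/-- Apply the invariance of the cones to the positive and negative parts separately and subtract. -/
theorem solCLM_eq_zero_of_gt (hT : IsC0Semigroup T) (hG : IsGenerator T waveOp) (t : ℝ≥0)
    {R : ℝ} (hR : 1 ≤ R) {g : L2} (hg : IsRadial g) (hgR : ∀ᵐ x ∂volExt, R < ‖x‖ → g x = 0) :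
    IsRadial (solCLM T t g) ∧ ∀ᵐ x ∂volExt, R + t < ‖x‖ → solCLM T t g x = 0 := by
  have h1 := mem_cone.1 (solCLM_mem_cone hT hG t hR (posPart_mem_cone hg hgR))
  have h2 := mem_cone.1 (solCLM_mem_cone hT hG t hR (negPart_mem_cone hg hgR))
  have e := Lp.coeFn_sub (solCLM T t (Lp.posPart g)) (solCLM T t (Lp.negPart g))
  rw [← map_sub, posPart_sub_negPart] at e
  constructor
  · refine h1.1.add_of_ae (h2.1.smul_of_ae (-1) (EventuallyEq.refl _ _)) ?_
    simpa [sub_eq_add_neg] using e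
  · filter_upwards [e, h1.2, h2.2] with x hx h3 h4 hxR
    rw [hx, Pi.sub_apply, h3.2 hxR, h4.2 hxR, sub_zero]

theorem IsRadial.solCLM (hT : IsC0Semigroup T) (hG : IsGenerator T waveOp) (t : ℝ≥0)
    {g : L2} (hg : IsRadial g) : IsRadial (solCLM T t g) := by
  refine isClosed_isRadial_L2.mem_of_tendsto
    (((ExteriorDampedWave.solCLM T t).continuous.tendsto _).comp (tendsto_ballCut g))
    (.of_forall fun n => ?_)
  exact (solCLM_eq_zero_of_gt hT hG t (by simp) (hg.ballCut _) (ballCut_eq_zero _ g)).1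

/-- The weighted `L¹` estimate for radial data. -/
theorem eLpNorm_solCLM_le (hT : IsC0Semigroup T) (hG : IsGenerator T waveOp) (t : ℝ≥0)
    {g : L2} (hg : IsRadial g) : eLpNorm (solCLM T t g) 1 muExt ≤
      ENNReal.ofReal (1 - Real.exp (-t)) * eLpNorm g 1 muExt := by
  refine eLpNorm_muExt_le_of_tendsto
    (((solCLM T t).continuous.tendsto _).comp (tendsto_ballCut g)) tendsto_const_nhds fun n => ?_
  refine le_trans ?_ (mul_le_mul_right (eLpNorm_muExt_mono (enorm_ballCut_le (n + 1) g)) _)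
  have hR : (1 : ℝ) ≤ n + 1 := by simp
  have hr := hg.ballCut (n + 1 : ℝ)
  have h0 := ballCut_eq_zero (n + 1) g
  set v := ballCut (n + 1) g
  have e : solCLM T t v = solCLM T t (Lp.posPart v) - solCLM T t (Lp.negPart v) := by
    rw [← map_sub, posPart_sub_negPart]
  rw [← eLpNorm_posPart_add_negPart v, mul_add]
  refine le_trans ?_ (add_le_add
    (eLpNorm_solCLM_le_of_mem_cone hT hG t hR (posPart_mem_cone hr h0))
    (eLpNorm_solCLM_le_of_mem_cone hT hG t hR (negPart_mem_cone hr h0)))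
  rw [Function.comp_apply, e, eLpNorm_congr_ae (muExt_ac_volExt.ae_le (Lp.coeFn_sub _ _))]
  exact eLpNorm_sub_le (aestronglyMeasurable_muExt _) (aestronglyMeasurable_muExt _) le_rfl

theorem memLp_solCLM (hT : IsC0Semigroup T) (hG : IsGenerator T waveOp) {g : L2}
    (hg : IsRadial g) (hg1 : MemLp g 1 muExt) (t : ℝ≥0) : MemLp (solCLM T t g) 1 muExt :=
  ⟨aestronglyMeasurable_muExt _, (eLpNorm_solCLM_le hT hG t hg).trans_lt
    (ENNReal.mul_lt_top ENNReal.ofReal_lt_top hg1.2)⟩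

theorem one_sub_exp_nonneg (t : ℝ≥0) : 0 ≤ 1 - Real.exp (-(t : ℝ)) := by
  have : Real.exp (-(t : ℝ)) ≤ 1 := Real.exp_le_one_iff.2 (by simp)
  linarith

theorem norm_toLp_solCLM_le (hT : IsC0Semigroup T) (hG : IsGenerator T waveOp) {g : L2}
    (hg : IsRadial g) (hg1 : MemLp g 1 muExt) (t : ℝ≥0) :
    ‖(memLp_solCLM hT hG hg hg1 t).toLp _‖ ≤ (1 - Real.exp (-(t : ℝ))) * ‖hg1.toLp g‖ := by
  rw [Lp.norm_toLp, Lp.norm_toLp, ← ENNReal.toReal_ofReal (one_sub_exp_nonneg t),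
    ← ENNReal.toReal_mul]
  exact ENNReal.toReal_mono (ENNReal.mul_lt_top ENNReal.ofReal_lt_top hg1.2).ne
    (eLpNorm_solCLM_le hT hG t hg)

/-- For `t < t₀ + 1` the solutions are all supported in the ball of radius `R + t₀ + 1`. There the
`L²` norm controls the weighted `L¹` norm, and `L²` continuity comes from the semigroup. -/
theorem continuous_toLp_solCLM_of_support (hT : IsC0Semigroup T) (hG : IsGenerator T waveOp)
    {R : ℝ} (hR : 1 ≤ R) {g : L2} (hg : IsRadial g) (hg1 : MemLp g 1 muExt)
    (hgR : ∀ᵐ x ∂volExt, R < ‖x‖ → g x = 0) :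
    Continuous fun t => (memLp_solCLM hT hG hg hg1 t).toLp _ := by
  refine continuous_iff_continuousAt.2 fun t₀ => ?_
  obtain ⟨K, hK⟩ := exists_eLpNorm_muExt_le (R + (t₀ + 1))
  refine tendsto_iff_norm_sub_tendsto_zero.2 ?_
  have hc := tendsto_iff_norm_sub_tendsto_zero.1 ((continuous_solCLM hT g).tendsto t₀)
  refine squeeze_zero' (.of_forall fun _ => norm_nonneg _) ?_
    (by simpa using hc.const_mul (K : ℝ))
  filter_upwards [Iio_mem_nhds (show t₀ < t₀ + 1 by simp)] with t ht
  have ht' : (t : ℝ) ≤ t₀ + 1 := by exact_mod_cast ht.le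
  rw [← MemLp.toLp_sub, Lp.norm_toLp, Lp.norm_def, ← ENNReal.coe_toReal, ← ENNReal.toReal_mul]
  refine ENNReal.toReal_mono (ENNReal.mul_ne_top ENNReal.coe_ne_top (Lp.eLpNorm_ne_top _)) ?_
  rw [← eLpNorm_congr_ae (muExt_ac_volExt.ae_le (Lp.coeFn_sub (solCLM T t g) (solCLM T t₀ g)))]
  refine hK _ ?_
  filter_upwards [Lp.coeFn_sub (solCLM T t g) (solCLM T t₀ g),
    (solCLM_eq_zero_of_gt hT hG t hR hg hgR).2, (solCLM_eq_zero_of_gt hT hG t₀ hR hg hgR).2]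
    with x h1 h2 h3 hx
  rw [h1, Pi.sub_apply, h2 (by linarith), h3 (by linarith), sub_zero]

/-- Restriction of the datum to balls converges in `L¹_{dμ}`, and the contraction estimate makes the
solutions converge uniformly in time. -/
theorem continuous_toLp_solCLM (hT : IsC0Semigroup T) (hG : IsGenerator T waveOp) {g : L2}
    (hg : IsRadial g) (hg1 : MemLp g 1 muExt) :
    Continuous fun t => (memLp_solCLM hT hG hg hg1 t).toLp _ := by
  have hgn : ∀ n : ℕ, IsRadial (ballCut (n + 1) g) := fun n => hg.ballCut _
  have hgn1 : ∀ n : ℕ, MemLp (ballCut (n + 1) g) 1 muExt := fun n =>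
    ⟨aestronglyMeasurable_muExt _, (eLpNorm_muExt_mono (enorm_ballCut_le _ g)).trans_lt hg1.2⟩
  have hunif : TendstoUniformly
      (fun (n : ℕ) t => (memLp_solCLM hT hG (hgn n) (hgn1 n) t).toLp _)
      (fun t => (memLp_solCLM hT hG hg hg1 t).toLp _) atTop := by
    refine Metric.tendstoUniformly_iff.2 fun ε hε => ?_
    have h0 := tendsto_eLpNorm_sub_ballCut hg1
    filter_upwards [h0.eventually_lt_const (ENNReal.ofReal_pos.2 hε)] with n hn t
    rw [dist_eq_norm, ← MemLp.toLp_sub, Lp.norm_toLp]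
    refine (ENNReal.toReal_lt_of_lt_ofReal ?_)
    refine lt_of_le_of_lt ?_ hn
    rw [← eLpNorm_congr_ae (muExt_ac_volExt.ae_le
      (Lp.coeFn_sub (solCLM T t g) (solCLM T t (ballCut (n + 1) g)))), ← map_sub]
    refine (eLpNorm_solCLM_le hT hG t ?_).trans ?_
    · exact hg.add_of_ae ((hgn n).smul_of_ae (-1) (EventuallyEq.refl _ _))
        (by simpa [sub_eq_add_neg] using Lp.coeFn_sub g (ballCut (n + 1) g))
    · refine mul_le_of_le_one_left' ?_
      rw [ENNReal.ofReal_le_one]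
      linarith [Real.exp_pos (-(t : ℝ))]
  exact hunif.continuous (.of_forall fun n =>
    continuous_toLp_solCLM_of_support hT hG (by simp) (hgn n) (hgn1 n) (ballCut_eq_zero _ g))

end wave

/-! ### Extension to radial functions in the weighted space -/

/-- The inclusion of `L²_rad ∩ L¹_{dμ}` into the radial functions in `L¹_{dμ}`. -/
def radIncl : radL2L1 →ₗ[ℝ] radL1 :=
  ((LinearMap.snd ℝ L2 L1mu).comp radL2L1.subtype).codRestrict radL1
    fun p => p.2.1.congr p.2.2.symm

theorem coe_radIncl (p : radL2L1) : (radIncl p : L1mu) = (p : L2 × L1mu).2 := rfl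

theorem exists_radL2L1 {f : ℝ → ℝ} (hf : Measurable f) (h2 : MemLp (radial f) 2 volExt)
    (h1 : MemLp (radial f) 1 muExt) : ∃ p : radL2L1, (p : L2 × L1mu).2 = h1.toLp _ := by
  refine ⟨⟨(h2.toLp _, h1.toLp _), (isRadial_radial hf).congr h2.coeFn_toLp, ?_⟩, rfl⟩
  have e : _ =ᵐ[volExt] _ := volExt_ac_muExt.ae_le h1.coeFn_toLp
  exact h2.coeFn_toLp.trans e.symm

/-- The `L²` class determines the `L¹_{dμ}` class, so linearity of `radSol` need be checked only in
the first component. -/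
theorem radL2L1_ext {p q : radL2L1} (h : (p : L2 × L1mu).1 = (q : L2 × L1mu).1) : p = q := by
  refine Subtype.ext (Prod.ext h (Lp.ext (muExt_ac_volExt.ae_le ?_)))
  have e := p.2.2
  rw [h] at e
  exact e.symm.trans q.2.2

theorem denseRange_radIncl : DenseRange radIncl := by
  rintro ⟨h, f, hf, hfh⟩
  -- Truncation in both height and radius gives bounded functions with bounded support, which lie in
  -- both spaces.
  set s : ℕ → Set ℝ := fun n => {r | |f r| ≤ n} ∩ Iic (n : ℝ) with hs
  have hsm : ∀ n, MeasurableSet (s n) := fun n =>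
    (measurableSet_le hf.abs measurable_const).inter measurableSet_Iic
  have hm : ∀ n, Measurable ((s n).indicator f) := fun n => hf.indicator (hsm n)
  have hbd : ∀ n x, ‖radial ((s n).indicator f) x‖ ≤
      ‖(Metric.closedBall (0 : Plane) n).indicator (fun _ => (n : ℝ)) x‖ := by
    intro n x
    rw [radial]
    by_cases hx : ‖x‖ ∈ s n
    · rw [indicator_of_mem hx, indicator_of_mem (by simpa using hx.2), Real.norm_natCast]
      exact hx.1
    · rw [indicator_of_notMem hx, norm_zero]
      exact norm_nonneg _
  have h2 : ∀ n, MemLp (radial ((s n).indicator f)) 2 volExt := fun n =>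
    (memLp_indicator_ball (n : ℝ) n).mono ((hm n).comp measurable_norm).aestronglyMeasurable
      (.of_forall (hbd n))
  have h1 : ∀ n, MemLp (radial ((s n).indicator f)) 1 muExt := fun n =>
    (memLp_indicator_const 1 Metric.isClosed_closedBall.measurableSet _
      (Or.inr (muExt_closedBall_lt_top n).ne)).mono
      ((hm n).comp measurable_norm).aestronglyMeasurable (.of_forall (hbd n))
  choose p hp using fun n => exists_radL2L1 (hm n) (h2 n) (h1 n)
  refine mem_closure_of_tendsto (f := fun n => radIncl (p n)) (b := atTop) ?_ (.of_forall fun n => ⟨p n, rfl⟩)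
  rw [tendsto_subtype_rng]
  simp only [coe_radIncl, hp]
  have hlim := tendsto_toLp_of_dominated (p := 1) (l := atTop) (by simp) h1 (Lp.memLp h)
    (Lp.memLp h).norm (.of_forall fun n => ?_) (muExt_ac_volExt.ae_le ?_)
  · simpa only [Lp.toLp_coeFn] using hlim
  · refine muExt_ac_volExt.ae_le ?_
    filter_upwards [hfh] with x hx
    rw [radial, hx]
    by_cases hxs : ‖x‖ ∈ s n
    · rw [indicator_of_mem hxs]
      simp
    · rw [indicator_of_notMem hxs]
      simp
  · filter_upwards [hfh] with x hx
    rw [hx]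
    refine tendsto_const_nhds.congr' ?_
    obtain ⟨N, hN⟩ := exists_nat_ge (max |f ‖x‖| ‖x‖)
    filter_upwards [eventually_ge_atTop N] with n hn
    have hNn : (N : ℝ) ≤ n := by exact_mod_cast hn
    have hmem : ‖x‖ ∈ s n :=
      ⟨(le_max_left _ _).trans (hN.trans hNn), (le_max_right _ _).trans (hN.trans hNn)⟩
    rw [radial, indicator_of_mem hmem]

section wave

variable {T : ℝ≥0 → Energy →L[ℝ] Energy}

theorem memLp_of_radL2L1 (p : radL2L1) : MemLp (p : L2 × L1mu).1 1 muExt :=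
  (memLp_congr_ae (muExt_ac_volExt.ae_le p.2.2)).2 (Lp.memLp _)

theorem toLp_memLp_of_radL2L1 (p : radL2L1) :
    (memLp_of_radL2L1 p).toLp _ = (p : L2 × L1mu).2 :=
  Lp.ext ((memLp_of_radL2L1 p).coeFn_toLp.trans (muExt_ac_volExt.ae_le p.2.2))

/-- The solution operator on `L²_rad ∩ L¹_{dμ}`. -/
def radSol (hT : IsC0Semigroup T) (hG : IsGenerator T waveOp) (t : ℝ≥0) :
    radL2L1 →ₗ[ℝ] radL2L1 where
  toFun p := ⟨(solCLM T t (p : L2 × L1mu).1,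
      (memLp_solCLM hT hG p.2.1 (memLp_of_radL2L1 p) t).toLp _),
    p.2.1.solCLM hT hG t, EventuallyEq.symm (volExt_ac_muExt.ae_le
      (memLp_solCLM hT hG p.2.1 (memLp_of_radL2L1 p) t).coeFn_toLp)⟩
  map_add' p q := radL2L1_ext (map_add (solCLM T t) (p : L2 × L1mu).1 (q : L2 × L1mu).1)
  map_smul' c p := radL2L1_ext (map_smul (solCLM T t) c (p : L2 × L1mu).1)

theorem norm_radIncl_radSol_le (hT : IsC0Semigroup T) (hG : IsGenerator T waveOp) (t : ℝ≥0)
    (p : radL2L1) :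
    ‖radIncl (radSol hT hG t p)‖ ≤ (1 - Real.exp (-(t : ℝ))) * ‖radIncl p‖ := by
  have h := norm_toLp_solCLM_le hT hG p.2.1 (memLp_of_radL2L1 p) t
  rwa [toLp_memLp_of_radL2L1] at h

theorem exists_continuous_radSol (hT : IsC0Semigroup T) (hG : IsGenerator T waveOp) (t : ℝ≥0) :
    ∃ P : radL2L1 →L[ℝ] radL2L1, ∀ p, P p = radSol hT hG t p := by
  refine ⟨(radSol hT hG t).mkContinuous (max ‖solCLM T t‖ 1) fun p => ?_, fun p => rfl⟩
  have h1 : ‖(p : L2 × L1mu).1‖ ≤ ‖p‖ := norm_fst_le (p : L2 × L1mu)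
  have h2 : ‖(p : L2 × L1mu).2‖ ≤ ‖p‖ := norm_snd_le (p : L2 × L1mu)
  refine max_le ?_ ?_
  · refine ((solCLM T t).le_opNorm _).trans ?_
    gcongr
    exact le_max_left _ _
  · refine (norm_radIncl_radSol_le hT hG t p).trans ?_
    gcongr
    · refine le_trans ?_ (le_max_right _ _)
      linarith [Real.exp_pos (-(t : ℝ))]
    · exact h2

theorem exists_extension (hT : IsC0Semigroup T) (hG : IsGenerator T waveOp) (t : ℝ≥0) :
    ∃ E : radL1 →L[ℝ] radL1, ‖E‖ ≤ 1 - Real.exp (-(t : ℝ)) ∧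
      ∀ (g : L2) (h : radL1), g =ᵐ[volExt] (h : L1mu) → (E h : L1mu) =ᵐ[volExt] solCLM T t g := by
  have : CompleteSpace radL1 := isClosed_radL1.completeSpace_coe
  have hb := norm_radIncl_radSol_le hT hG t
  refine ⟨(radIncl.comp (radSol hT hG t)).extendOfNorm radIncl,
    LinearMap.opNorm_extendOfNorm_le denseRange_radIncl (one_sub_exp_nonneg t) hb, fun g h hgh => ?_⟩
  -- A function in both spaces belongs to the dense domain, where the extension agrees with the
  -- original operator.
  let p : radL2L1 := ⟨(g, h), (IsRadial.congr h.2 hgh), hgh⟩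
  have hp : radIncl p = h := rfl
  rw [← hp, LinearMap.extendOfNorm_eq denseRange_radIncl ⟨_, hb⟩]
  exact (radSol hT hG t p).2.2.symm

end wave

/-! ### Generation of contraction semigroups on Hilbert spaces -/

/-- The (graph of the) linear operator `G` is single-valued, dissipative, and `c - G` is onto for
all `c > 0`. -/
structure IsMDissipative {X : Type*} [NormedAddCommGroup X] [InnerProductSpace ℝ X]
    (G : X → X → Prop) : Prop where
  add : ∀ {x y x' y'}, G x y → G x' y' → G (x + x') (y + y')
  smul : ∀ (c : ℝ) {x y}, G x y → G (c • x) (c • y)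
  eq_zero : ∀ {y}, G 0 y → y = 0
  inner_nonpos : ∀ {x y}, G x y → inner ℝ y x ≤ 0
  range : ∀ c : ℝ, 0 < c → ∀ z, ∃ x y, G x y ∧ c • x - y = z

namespace IsMDissipative

variable {X : Type*} [NormedAddCommGroup X] [InnerProductSpace ℝ X] {G : X → X → Prop}

theorem sub (h : IsMDissipative G) {x y x' y' : X} (h1 : G x y) (h2 : G x' y') :
    G (x - x') (y - y') := by
  simpa [sub_eq_add_neg] using h.add h1 (h.smul (-1) h2)

/-- Pair `c x - y` with `x`: dissipativity gives at least `c ‖x‖²`, and Cauchy–Schwarz removes one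
factor `‖x‖`. This is injectivity of `c - G` with a resolvent bound. -/
theorem mul_norm_le (h : IsMDissipative G) {x y : X} (hxy : G x y) (c : ℝ) :
    c * ‖x‖ ≤ ‖c • x - y‖ := by
  have h1 : c * ‖x‖ ^ 2 ≤ inner ℝ (c • x - y) x := by
    rw [inner_sub_left, real_inner_smul_left, real_inner_self_eq_norm_sq]
    linarith [h.inner_nonpos hxy]
  have h2 := h1.trans (real_inner_le_norm _ _)
  rcases (norm_nonneg x).eq_or_lt with h0 | h0
  · rw [← h0]
    simp
  · nlinarith

theorem eq_of_smul_sub_eq (h : IsMDissipative G) {x y x' y' : X} (h1 : G x y) (h2 : G x' y')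
    {c : ℝ} (hc : 0 < c) (e : c • x - y = c • x' - y') : x = x' := by
  have h3 := h.mul_norm_le (h.sub h1 h2) c
  have e' : c • (x - x') - (y - y') = 0 := by
    rw [smul_sub, sub_sub_sub_comm, e, sub_self]
  rw [e', norm_zero] at h3
  have : ‖x - x'‖ ≤ 0 := by nlinarith [norm_nonneg (x - x')]
  exact sub_eq_zero.1 (norm_le_zero_iff.1 this)

/-- The resolvent `(c - G)⁻¹`, as a function. -/
def resFun (h : IsMDissipative G) {c : ℝ} (hc : 0 < c) (z : X) : X := (h.range c hc z).choose

theorem resFun_spec (h : IsMDissipative G) {c : ℝ} (hc : 0 < c) (z : X) :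
    G (h.resFun hc z) (c • h.resFun hc z - z) := by
  obtain ⟨y, h1, h2⟩ := (h.range c hc z).choose_spec
  have e : c • h.resFun hc z - z = y := by
    rw [sub_eq_iff_eq_add, ← sub_eq_iff_eq_add']
    exact h2
  rwa [e]

theorem resFun_eq (h : IsMDissipative G) {c : ℝ} (hc : 0 < c) {x y : X} (hxy : G x y) :
    h.resFun hc (c • x - y) = x :=
  h.eq_of_smul_sub_eq (h.resFun_spec hc _) hxy hc (by abel)

/-- The resolvent `(c - G)⁻¹`. -/
def res (h : IsMDissipative G) {c : ℝ} (hc : 0 < c) : X →L[ℝ] X :=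
  LinearMap.mkContinuous
    { toFun := h.resFun hc
      map_add' := fun z w => by
        have := h.resFun_eq hc (h.add (h.resFun_spec hc z) (h.resFun_spec hc w))
        rw [← this]
        congr 1
        rw [smul_add]
        abel
      map_smul' := fun a z => by
        have := h.resFun_eq hc (h.smul a (h.resFun_spec hc z))
        rw [RingHom.id_apply, ← this]
        congr 1
        rw [smul_sub, smul_comm]
        abel } c⁻¹ fun z => by
    have h1 := h.mul_norm_le (h.resFun_spec hc z) c
    rw [sub_sub_cancel] at h1
    rw [inv_mul_eq_div, le_div_iff₀ hc, mul_comm]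
    exact h1

theorem res_spec (h : IsMDissipative G) {c : ℝ} (hc : 0 < c) (z : X) :
    G (h.res hc z) (c • h.res hc z - z) := h.resFun_spec hc z

theorem res_eq (h : IsMDissipative G) {c : ℝ} (hc : 0 < c) {x y : X} (hxy : G x y) :
    h.res hc (c • x - y) = x := h.resFun_eq hc hxy

theorem mul_norm_res_le (h : IsMDissipative G) {c : ℝ} (hc : 0 < c) (z : X) :
    c * ‖h.res hc z‖ ≤ ‖z‖ := by
  have h1 := h.mul_norm_le (h.res_spec hc z) c
  rwa [sub_sub_cancel] at h1

/-- The resolvent identity `R_c = R_d + (d - c) R_c R_d`, followed by the evaluation of `R_d` on the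
pair defining `R_c R_d z`. -/
theorem commute_res (h : IsMDissipative G) {c d : ℝ} (hc : 0 < c) (hd : 0 < d) :
    Commute (h.res hc) (h.res hd) := by
  ext z
  simp only [mul_apply_eq_comp]
  set w := h.res hd z with hw
  set a := h.res hc w with ha
  have h1 : G w (d • w - z) := h.res_spec hd z
  have h2 : G a (c • a - w) := h.res_spec hc w
  have h3 : h.res hc z = w + (d - c) • a := by
    rw [← h.res_eq hc (h.add h1 (h.smul (d - c) h2))]
    congr 1
    module
  have h4 := h.res_eq hd h2
  rw [h3]
  refine h4.symm.trans (congrArg _ ?_)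
  module

/-! ### Yosida approximations and density of the domain. -/

/-- The Yosida approximations. -/
def yosida (h : IsMDissipative G) (n : ℕ) : X →L[ℝ] X :=
  (n + 1 : ℝ) • ((n + 1 : ℝ) • h.res n.cast_add_one_pos - 1)

theorem yosida_apply (h : IsMDissipative G) (n : ℕ) (z : X) : h.yosida n z =
    (n + 1 : ℝ) • ((n + 1 : ℝ) • h.res n.cast_add_one_pos z - z) := rfl

theorem commute_yosida (h : IsMDissipative G) (n m : ℕ) : Commute (h.yosida n) (h.yosida m) := by
  have h1 := h.commute_res (n.cast_add_one_pos (α := ℝ)) (m.cast_add_one_pos (α := ℝ))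
  exact ((((h1.smul_left _).smul_right _).sub_right (Commute.one_right _)).sub_left
    ((Commute.one_left _))).smul_left _ |>.smul_right _

/-- With `c = n + 1`, `a` the resolvent of `z` and `b = c a - z` its image under `G`, one has `z = c
a - b`. Hence `⟨b, z⟩ = c ⟨b, a⟩ - ‖b‖² ≤ 0`. -/
theorem inner_yosida_nonpos (h : IsMDissipative G) (n : ℕ) (z : X) :
    inner ℝ (h.yosida n z) z ≤ 0 := by
  have hc : (0 : ℝ) < n + 1 := n.cast_add_one_pos
  have h1 := h.inner_nonpos (h.res_spec hc z)
  set a := h.res hc z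
  have e : z = (n + 1 : ℝ) • a - ((n + 1 : ℝ) • a - z) := by abel
  have h2 : inner ℝ ((n + 1 : ℝ) • a - z) z ≤ 0 := by
    nth_rewrite 2 [e]
    rw [inner_sub_right, real_inner_smul_right, real_inner_self_eq_norm_sq]
    nlinarith [sq_nonneg ‖(n + 1 : ℝ) • a - z‖]
  rw [yosida_apply, real_inner_smul_left]
  exact mul_nonpos_of_nonneg_of_nonpos hc.le h2

theorem yosida_eq (h : IsMDissipative G) (n : ℕ) {x y : X} (hxy : G x y) :
    h.yosida n x = (n + 1 : ℝ) • h.res n.cast_add_one_pos y := by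
  have hc : (0 : ℝ) < n + 1 := n.cast_add_one_pos
  have h1 := h.res_eq hc hxy
  rw [map_sub, map_smul, sub_eq_iff_eq_add] at h1
  rw [yosida_apply, h1]
  simp

/-- In a Hilbert space density is automatic. If `w` is orthogonal to the domain and `x - Gx = w`,
then `0 = ⟨w, x⟩ ≥ ‖x‖²`, so `x = 0`; single-valuedness at zero then gives `w = 0`. -/
theorem dense_domain [CompleteSpace X] (h : IsMDissipative G) : Dense {x | ∃ y, G x y} := by
  let D : Submodule ℝ X :=
    { carrier := {x | ∃ y, G x y}
      zero_mem' := by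
        obtain ⟨x, y, hxy, -⟩ := h.range 1 one_pos 0
        exact ⟨y - y, by simpa using h.sub hxy hxy⟩
      add_mem' := by
        rintro a b ⟨y, hy⟩ ⟨z, hz⟩
        exact ⟨_, h.add hy hz⟩
      smul_mem' := by
        rintro c a ⟨y, hy⟩
        exact ⟨_, h.smul c hy⟩ }
  have : Dense (D : Set X) := by
    rw [Submodule.dense_iff_topologicalClosure_eq_top, Submodule.topologicalClosure_eq_top_iff,
      Submodule.eq_bot_iff]
    intro w hw
    have h1 := h.res_spec one_pos w
    set x := h.res one_pos w
    have h2 : inner ℝ x w = 0 := (Submodule.mem_orthogonal D w).1 hw x ⟨_, h1⟩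
    have h3 := h.inner_nonpos h1
    rw [one_smul, inner_sub_left, real_inner_self_eq_norm_sq, real_inner_comm, h2] at h3
    have hx : x = 0 := by
      have : ‖x‖ = 0 := by nlinarith [norm_nonneg x]
      exact norm_eq_zero.1 this
    rw [hx] at h1
    simpa using h.eq_zero h1
  exact this

/-- On the domain, the difference from the identity is the resolvent of `y`, of norm at most `‖y‖ /
(n + 1)`. Density and the uniform bound do the rest. -/
theorem tendsto_smul_res [CompleteSpace X] (h : IsMDissipative G) (z : X) :
    Tendsto (fun n : ℕ => (n + 1 : ℝ) • h.res n.cast_add_one_pos z) atTop (𝓝 z) := by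
  have hle : ∀ (n : ℕ) (w : X), ‖(n + 1 : ℝ) • h.res n.cast_add_one_pos w‖ ≤ ‖w‖ := fun n w => by
    rw [norm_smul, Real.norm_of_nonneg n.cast_add_one_pos.le]
    exact h.mul_norm_res_le _ w
  have hD : ∀ x y : X, G x y →
      Tendsto (fun n : ℕ => (n + 1 : ℝ) • h.res n.cast_add_one_pos x) atTop (𝓝 x) := by
    intro x y hxy
    rw [tendsto_iff_norm_sub_tendsto_zero]
    refine squeeze_zero (fun _ => norm_nonneg _) (fun n => ?_)
      ((tendsto_one_div_add_atTop_nhds_zero_nat (𝕜 := ℝ)).mul_const ‖y‖ |>.trans_eq (by simp))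
    have hc : (0 : ℝ) < n + 1 := n.cast_add_one_pos
    have h1 := h.res_eq hc hxy
    rw [map_sub, map_smul, sub_eq_iff_eq_add] at h1
    rw [h1, add_sub_cancel_left, one_div, inv_mul_eq_div, le_div_iff₀ hc, mul_comm]
    exact h.mul_norm_res_le hc y
  rw [Metric.tendsto_atTop]
  intro ε hε
  obtain ⟨x, ⟨y, hxy⟩, hx⟩ := h.dense_domain.exists_dist_lt z (ε := ε / 3) (by positivity)
  obtain ⟨N, hN⟩ := (Metric.tendsto_atTop.1 (hD x y hxy)) (ε / 3) (by positivity)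
  refine ⟨N, fun n hn => ?_⟩
  have h1 := hle n (z - x)
  have h2 := hN n hn
  rw [map_sub, smul_sub] at h1
  rw [dist_eq_norm] at hx h2 ⊢
  calc ‖(n + 1 : ℝ) • h.res n.cast_add_one_pos z - z‖
      = ‖((n + 1 : ℝ) • h.res n.cast_add_one_pos z - (n + 1 : ℝ) • h.res n.cast_add_one_pos x) +
        ((n + 1 : ℝ) • h.res n.cast_add_one_pos x - x) - (z - x)‖ := by congr 1; abel
    _ ≤ ‖z - x‖ + ‖(n + 1 : ℝ) • h.res n.cast_add_one_pos x - x‖ + ‖z - x‖ := by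
        refine (norm_sub_le _ _).trans (add_le_add_left ((norm_add_le _ _).trans ?_) _)
        exact add_le_add_left h1 _
    _ < ε := by linarith

theorem tendsto_yosida [CompleteSpace X] (h : IsMDissipative G) {x y : X} (hxy : G x y) :
    Tendsto (fun n => h.yosida n x) atTop (𝓝 y) := by
  simp_rw [h.yosida_eq _ hxy]
  exact h.tendsto_smul_res y

/-! ### The semigroup as a limit of exponentials. -/

/-- The semigroup generated by a Yosida approximation. -/
def approx (h : IsMDissipative G) (n : ℕ) (t : ℝ) : X →L[ℝ] X := NormedSpace.exp (t • h.yosida n)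

theorem approx_zero (h : IsMDissipative G) (n : ℕ) : h.approx n 0 = 1 := by simp [approx]

theorem commute_approx (h : IsMDissipative G) (n m : ℕ) (t : ℝ) :
    Commute (h.approx n t) (h.yosida m) :=
  ((h.commute_yosida n m).smul_left t).exp_left

variable [CompleteSpace X]

theorem hasDerivAt_approx (h : IsMDissipative G) (n : ℕ) (t : ℝ) (x : X) :
    HasDerivAt (fun t => h.approx n t x) (h.approx n t (h.yosida n x)) t := by
  have := (hasDerivAt_exp_smul_const (𝕂 := ℝ) (h.yosida n) t).clm_apply (hasDerivAt_const t x)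
  simpa [approx] using this

theorem approx_add (h : IsMDissipative G) (n : ℕ) (s t : ℝ) :
    h.approx n (s + t) = h.approx n s * h.approx n t := by
  rw [approx, add_smul]
  refine NormedSpace.exp_add_of_commute_of_mem_ball (𝕂 := ℝ)
    (((Commute.refl _).smul_left s).smul_right t) ?_ ?_ <;>
  exact (NormedSpace.expSeries_radius_eq_top ℝ (X →L[ℝ] X)).symm ▸ edist_lt_top _ _

/-- The squared norm along the flow is nonincreasing, by dissipativity of the Yosida approximation.
-/
theorem norm_approx_le (h : IsMDissipative G) (n : ℕ) {t : ℝ} (ht : 0 ≤ t) (x : X) :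
    ‖h.approx n t x‖ ≤ ‖x‖ := by
  have hd : ∀ s, HasDerivAt (fun s => ‖h.approx n s x‖ ^ 2)
      (2 * inner ℝ (h.approx n s x) (h.approx n s (h.yosida n x))) s :=
    fun s => (h.hasDerivAt_approx n s x).norm_sq
  have hanti : Antitone fun s => ‖h.approx n s x‖ ^ 2 := by
    refine antitone_of_deriv_nonpos (fun s => (hd s).differentiableAt) fun s => ?_
    rw [(hd s).deriv]
    have e : h.approx n s (h.yosida n x) = h.yosida n (h.approx n s x) :=
      congrArg (fun A : X →L[ℝ] X => A x) (h.commute_approx n n s).eq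
    rw [e, real_inner_comm]
    linarith [h.inner_yosida_nonpos n (h.approx n s x)]
  have h1 := hanti ht
  simp only [approx_zero, one_apply_eq_self] at h1
  exact (pow_le_pow_iff_left₀ (norm_nonneg _) (norm_nonneg _) two_ne_zero).1 h1

/-- Interpolate between the flows by `s ↦ e^{sA_n} e^{(t-s)A_m} x`. Since everything commutes, its
derivative is two contractions applied to `A_n x - A_m x`. -/
theorem norm_approx_sub_le (h : IsMDissipative G) (n m : ℕ) {t : ℝ} (ht : 0 ≤ t) (x : X) :
    ‖h.approx n t x - h.approx m t x‖ ≤ t * ‖h.yosida n x - h.yosida m x‖ := by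
  have hd : ∀ s ∈ Icc 0 t, HasDerivWithinAt (fun s => h.approx n s (h.approx m (t - s) x))
      (h.approx n s (h.approx m (t - s) (h.yosida n x - h.yosida m x))) (Icc 0 t) s := by
    intro s _
    have h1 := hasDerivAt_exp_smul_const (𝕂 := ℝ) (h.yosida n) s
    have h2 : HasDerivAt (fun s => h.approx m (t - s) x) (-h.approx m (t - s) (h.yosida m x)) s := by
      simpa [Function.comp_def] using
        (h.hasDerivAt_approx m (t - s) x).scomp s ((hasDerivAt_id s).const_sub t)
    have h3 := h1.clm_apply h2
    have e : h.yosida n (h.approx m (t - s) x) = h.approx m (t - s) (h.yosida n x) :=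
      (congrArg (fun A : X →L[ℝ] X => A x) (h.commute_approx m n (t - s)).eq).symm
    have e2 : (NormedSpace.exp (s • h.yosida n) * h.yosida n) (h.approx m (t - s) x) +
        NormedSpace.exp (s • h.yosida n) (-h.approx m (t - s) (h.yosida m x)) =
        h.approx n s (h.approx m (t - s) (h.yosida n x - h.yosida m x)) := by
      rw [mul_apply_eq_comp, e, map_neg, map_sub, map_sub, ← sub_eq_add_neg]
      rfl
    rw [e2] at h3
    exact h3.hasDerivWithinAt
  have := norm_image_sub_le_of_norm_deriv_le_segment' hd (C := ‖h.yosida n x - h.yosida m x‖)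
    (fun s hs => (h.norm_approx_le n hs.1 _).trans (h.norm_approx_le m (by linarith [hs.2]) _))
    t (right_mem_Icc.2 ht)
  simp only [sub_self, approx_zero, sub_zero, one_apply_eq_self] at this
  rwa [mul_comm]

theorem cauchySeq_approx (h : IsMDissipative G) {t : ℝ} (ht : 0 ≤ t) (x : X) :
    CauchySeq fun n => h.approx n t x := by
  rw [Metric.cauchySeq_iff]
  intro ε hε
  obtain ⟨x', ⟨y, hxy⟩, hx⟩ := h.dense_domain.exists_dist_lt x (ε := ε / 4) (by positivity)
  obtain ⟨N, hN⟩ := Metric.cauchySeq_iff.1 (h.tendsto_yosida hxy).cauchySeq (ε / (2 * (t + 1)))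
    (by positivity)
  refine ⟨N, fun n hn m hm => ?_⟩
  have h1 := hN n hn m hm
  have h2 := h.norm_approx_sub_le n m ht x'
  have h3 := h.norm_approx_le n ht (x - x')
  have h4 := h.norm_approx_le m ht (x - x')
  rw [map_sub] at h3 h4
  rw [dist_eq_norm] at hx h1 ⊢
  have h5 : t * ‖h.yosida n x' - h.yosida m x'‖ ≤ ε / 2 := by
    calc t * ‖h.yosida n x' - h.yosida m x'‖ ≤ (t + 1) * (ε / (2 * (t + 1))) := by
          gcongr
          linarith
      _ = ε / 2 := by field_simp
  calc ‖h.approx n t x - h.approx m t x‖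
      = ‖(h.approx n t x - h.approx n t x') + (h.approx n t x' - h.approx m t x') -
        (h.approx m t x - h.approx m t x')‖ := by congr 1; abel
    _ ≤ ‖x - x'‖ + ε / 2 + ‖x - x'‖ := by
        refine (norm_sub_le _ _).trans (add_le_add ((norm_add_le _ _).trans ?_) h4)
        exact add_le_add h3 (h2.trans h5)
    _ < ε := by linarith

theorem exists_tendsto_approx (h : IsMDissipative G) (t : ℝ≥0) (x : X) :
    ∃ y, Tendsto (fun n => h.approx n t x) atTop (𝓝 y) :=
  cauchySeq_tendsto_of_complete (h.cauchySeq_approx t.2 x)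

/-- The semigroup generated by `G`. -/
def sg (h : IsMDissipative G) (t : ℝ≥0) : X →L[ℝ] X :=
  LinearMap.mkContinuous
    { toFun := fun x => (h.exists_tendsto_approx t x).choose
      map_add' := fun x y => tendsto_nhds_unique (h.exists_tendsto_approx t (x + y)).choose_spec (by
        simpa using (h.exists_tendsto_approx t x).choose_spec.add
          (h.exists_tendsto_approx t y).choose_spec)
      map_smul' := fun c x => tendsto_nhds_unique (h.exists_tendsto_approx t (c • x)).choose_spec (by
        simpa using (h.exists_tendsto_approx t x).choose_spec.const_smul c) } 1 fun x => by
    rw [one_mul]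
    exact le_of_tendsto' (h.exists_tendsto_approx t x).choose_spec.norm
      fun n => h.norm_approx_le n t.2 x

theorem tendsto_approx (h : IsMDissipative G) (t : ℝ≥0) (x : X) :
    Tendsto (fun n => h.approx n t x) atTop (𝓝 (h.sg t x)) :=
  (h.exists_tendsto_approx t x).choose_spec

theorem norm_sg_le (h : IsMDissipative G) (t : ℝ≥0) (x : X) : ‖h.sg t x‖ ≤ ‖x‖ :=
  le_of_tendsto' (h.tendsto_approx t x).norm fun n => h.norm_approx_le n t.2 x

theorem norm_approx_sub_sg_le (h : IsMDissipative G) (n : ℕ) (t : ℝ≥0) {x y : X} (hxy : G x y) :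
    ‖h.approx n t x - h.sg t x‖ ≤ t * ‖h.yosida n x - y‖ :=
  le_of_tendsto_of_tendsto' ((h.tendsto_approx t x).const_sub _).norm
    (((h.tendsto_yosida hxy).const_sub _).norm.const_mul _) fun m => h.norm_approx_sub_le n m t.2 x

/-- The approximations converge locally uniformly in time. -/
theorem eventually_norm_approx_sub_sg_le (h : IsMDissipative G) (x : X) (τ : ℝ≥0) {ε : ℝ}
    (hε : 0 < ε) : ∀ᶠ n in atTop, ∀ t ≤ τ, ‖h.approx n t x - h.sg t x‖ ≤ ε := by
  obtain ⟨x', ⟨y, hxy⟩, hx⟩ := h.dense_domain.exists_dist_lt x (ε := ε / 4) (by positivity)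
  have h1 : Tendsto (fun n => (τ : ℝ) * ‖h.yosida n x' - y‖) atTop (𝓝 0) := by
    simpa using ((tendsto_iff_norm_sub_tendsto_zero.1 (h.tendsto_yosida hxy))).const_mul (τ : ℝ)
  filter_upwards [h1.eventually_lt_const (show 0 < ε / 2 by positivity)] with n hn t ht
  have h2 := h.norm_approx_sub_sg_le n t hxy
  have h3 := h.norm_approx_le n t.2 (x - x')
  have h4 := h.norm_sg_le t (x - x')
  have ht' : (t : ℝ) ≤ τ := by exact_mod_cast ht
  have h5 : (t : ℝ) * ‖h.yosida n x' - y‖ ≤ τ * ‖h.yosida n x' - y‖ := by gcongr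
  rw [map_sub] at h3 h4
  rw [dist_eq_norm] at hx
  calc ‖h.approx n t x - h.sg t x‖
      = ‖(h.approx n t x - h.approx n t x') + (h.approx n t x' - h.sg t x') -
        (h.sg t x - h.sg t x')‖ := by congr 1; abel
    _ ≤ ‖x - x'‖ + ε / 2 + ‖x - x'‖ := by
        refine (norm_sub_le _ _).trans (add_le_add ((norm_add_le _ _).trans ?_) h4)
        exact add_le_add h3 (by linarith)
    _ ≤ ε := by linarith

theorem isC0Semigroup_sg (h : IsMDissipative G) : IsC0Semigroup h.sg where
  zero := by
    ext x
    refine tendsto_nhds_unique (h.tendsto_approx 0 x) ?_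
    simp [approx_zero]
  add s t := by
    ext x
    refine tendsto_nhds_unique (h.tendsto_approx (s + t) x) ?_
    have h1 : Tendsto (fun n => h.approx n s (h.approx n t x - h.sg t x)) atTop (𝓝 0) :=
      squeeze_zero_norm (fun n => h.norm_approx_le n s.2 _)
        (tendsto_iff_norm_sub_tendsto_zero.1 (h.tendsto_approx t x))
    have h2 := h1.add (h.tendsto_approx s (h.sg t x))
    rw [zero_add] at h2
    refine h2.congr fun n => ?_
    rw [NNReal.coe_add, approx_add, map_sub, sub_add_cancel]
    rfl
  continuous x := by
    have hu : TendstoLocallyUniformly (fun n (t : ℝ≥0) => h.approx n t x) (fun t => h.sg t x)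
        atTop := by
      rw [Metric.tendstoLocallyUniformly_iff]
      intro ε hε t
      refine ⟨Iio (t + 1), Iio_mem_nhds (by simp), ?_⟩
      filter_upwards [h.eventually_norm_approx_sub_sg_le x (t + 1) (half_pos hε)] with n hn s hs
      rw [dist_comm, dist_eq_norm]
      linarith [hn s (le_of_lt hs)]
    refine hu.continuous (.of_forall fun n => ?_)
    exact (continuous_iff_continuousAt.2 fun s => (h.hasDerivAt_approx n s x).continuousAt).comp
      NNReal.continuous_coe

/-- That elements of `G` have the right derivative follows from the mean value inequality for the
approximate flows. Conversely, `G` admits no proper extension by the generator, because `1 - G` is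
onto and the generator is dissipative. -/
theorem isGenerator_sg (h : IsMDissipative G) : IsGenerator h.sg G := by
  have hdir : ∀ x y, G x y →
      Tendsto (fun s : ℝ≥0 => (s : ℝ)⁻¹ • (h.sg s x - x)) (𝓝[>] 0) (𝓝 y) := by
    intro x y hxy
    rw [Metric.tendsto_nhds]
    intro ε hε
    have hc := (h.isC0Semigroup_sg.continuous y).tendsto 0
    rw [h.isC0Semigroup_sg.zero, Metric.tendsto_nhds_nhds] at hc
    obtain ⟨δ, hδ, hc⟩ := hc (ε / 4) (by positivity)
    have hlt : ∀ᶠ s : ℝ≥0 in 𝓝[>] 0, dist s 0 < δ :=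
      nhdsWithin_le_nhds (Metric.ball_mem_nhds 0 hδ)
    filter_upwards [hlt, self_mem_nhdsWithin] with s hs hs0
    have hs0' : (0 : ℝ) < s := hs0
    have hbound : ‖h.sg s x - x - (s : ℝ) • y‖ ≤ 3 * (ε / 4) * s := by
      have hlim : Tendsto (fun n => ‖h.approx n s x - x - (s : ℝ) • y‖) atTop
          (𝓝 ‖h.sg s x - x - (s : ℝ) • y‖) :=
        (((h.tendsto_approx s x).sub_const _).sub_const _).norm
      refine le_of_tendsto hlim ?_
      filter_upwards [h.eventually_norm_approx_sub_sg_le y s (show 0 < ε / 4 by positivity),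
        (tendsto_iff_norm_sub_tendsto_zero.1 (h.tendsto_yosida hxy)).eventually_lt_const
          (show 0 < ε / 4 by positivity)] with n hn1 hn2
      have hd : ∀ r ∈ Icc (0 : ℝ) s, HasDerivWithinAt (fun r => h.approx n r x - r • y)
          (h.approx n r (h.yosida n x) - (1 : ℝ) • y) (Icc 0 s) r := fun r _ =>
        ((h.hasDerivAt_approx n r x).sub ((hasDerivAt_id r).smul_const y)).hasDerivWithinAt
      -- The three quarters of `ε` account for replacing `A_n x` by `y`, the approximate flow of `y`
      -- by its limit, and the semigroup at `y` by `y`.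
      have hb := norm_image_sub_le_of_norm_deriv_le_segment' hd (C := 3 * (ε / 4)) (fun r hr => ?_)
        s (right_mem_Icc.2 hs0'.le)
      · simp only [approx_zero, zero_smul, sub_zero, one_apply_eq_self] at hb
        rwa [sub_right_comm]
      · lift r to ℝ≥0 using hr.1
        have hr2 : r ≤ s := by exact_mod_cast hr.2.le
        have e1 := h.norm_approx_le n r.2 (h.yosida n x - y)
        have e2 := hn1 r hr2
        have e3 := hc (x := r) (lt_of_le_of_lt (by simpa [NNReal.dist_eq] using hr2) hs)
        rw [dist_eq_norm, ContinuousLinearMap.id_apply] at e3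
        rw [map_sub] at e1
        calc ‖h.approx n r (h.yosida n x) - (1 : ℝ) • y‖
            = ‖(h.approx n r (h.yosida n x) - h.approx n r y) + (h.approx n r y - h.sg r y) +
              (h.sg r y - y)‖ := by rw [one_smul]; congr 1; abel
          _ ≤ ε / 4 + ε / 4 + ε / 4 := by
              refine (norm_add_le _ _).trans (add_le_add ((norm_add_le _ _).trans ?_) e3.le)
              exact add_le_add (e1.trans hn2.le) e2
          _ = 3 * (ε / 4) := by ring
    have e : (s : ℝ)⁻¹ • (h.sg s x - x) - y = (s : ℝ)⁻¹ • (h.sg s x - x - (s : ℝ) • y) := by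
      rw [smul_sub _ (h.sg s x - x), inv_smul_smul₀ hs0'.ne']
    rw [dist_eq_norm, e, norm_smul, norm_inv, Real.norm_of_nonneg hs0'.le, inv_mul_eq_div]
    calc ‖h.sg s x - x - (s : ℝ) • y‖ / s ≤ 3 * (ε / 4) := by rwa [div_le_iff₀ hs0']
      _ < ε := by linarith
  intro x y
  refine ⟨hdir x y, fun hlim => ?_⟩
  -- Choose an element of `G` with the same value of `1 - G`. Then `y - y' = x - x'`, and
  -- dissipativity of the difference quotients forces `x = x'`.
  obtain ⟨x', y', hxy', e⟩ := h.range 1 one_pos ((1 : ℝ) • x - y)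
  rw [one_smul, one_smul] at e
  have h1 := hlim.sub (hdir x' y' hxy')
  have e1 : y - y' = x - x' := by
    rw [sub_eq_sub_iff_add_eq_add, add_comm y, add_comm x] 
    rw [sub_eq_sub_iff_add_eq_add] at e
    rw [e]
    abel
  have h2 : inner ℝ (y - y') (x - x') ≤ 0 := by
    refine le_of_tendsto (h1.inner tendsto_const_nhds) ?_
    filter_upwards [self_mem_nhdsWithin] with s hs0
    have hs0' : (0 : ℝ) < s := hs0
    rw [← smul_sub, real_inner_smul_left]
    refine mul_nonpos_of_nonneg_of_nonpos (by positivity) ?_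
    have e2 : h.sg s x - x - (h.sg s x' - x') = h.sg s (x - x') - (x - x') := by
      rw [map_sub]
      abel
    rw [e2, inner_sub_left, real_inner_self_eq_norm_sq]
    have h3 := real_inner_le_norm (h.sg s (x - x')) (x - x')
    have h4 := h.norm_sg_le s (x - x')
    nlinarith [norm_nonneg (x - x')]
  rw [e1, real_inner_self_eq_norm_sq] at h2
  have h5 : x - x' = 0 := by
    have : ‖x - x'‖ = 0 := by nlinarith [norm_nonneg (x - x')]
    exact norm_eq_zero.1 this
  rw [h5] at e1
  rw [sub_eq_zero.1 h5, sub_eq_zero.1 e1]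
  exact hxy'

/-- Operators `G` such that `G - 1` is m-dissipative generate strongly continuous semigroups. -/
theorem exists_semigroup {G : X → X → Prop} (h : IsMDissipative fun x y => G x (y + x)) :
    ∃ T : ℝ≥0 → X →L[ℝ] X, IsC0Semigroup T ∧ IsGenerator T G := by
  have hS := h.isC0Semigroup_sg
  -- Adding the identity to the generator multiplies the contraction semigroup by `e^t`.
  refine ⟨fun t => Real.exp t • h.sg t, ⟨by simp [hS.zero], fun s t => ?_, fun x => ?_⟩,
    fun x y => ?_⟩
  · ext x
    simp [hS.add, Real.exp_add, smul_smul, mul_comm]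
  · exact (Real.continuous_exp.comp NNReal.continuous_coe).smul (hS.continuous x)
  · have h1 := h.isGenerator_sg x (y - x)
    simp only [sub_add_cancel] at h1
    rw [h1]
    have hexp : Tendsto (fun s : ℝ≥0 => Real.exp s) (𝓝[>] 0) (𝓝 1) := by
      have := (Real.continuous_exp.comp NNReal.continuous_coe).tendsto 0
      simp only [Function.comp_apply, NNReal.coe_zero, Real.exp_zero] at this
      exact this.mono_left nhdsWithin_le_nhds
    have hexp' : Tendsto (fun s : ℝ≥0 => (s : ℝ)⁻¹ * (Real.exp s - 1)) (𝓝[>] 0) (𝓝 1) := by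
      have h2 := hasDerivAt_iff_tendsto_slope.1 (Real.hasDerivAt_exp 0)
      rw [Real.exp_zero] at h2
      have h3 : Tendsto (fun s : ℝ≥0 => (s : ℝ)) (𝓝[>] 0) (𝓝[≠] 0) := by
        refine tendsto_nhdsWithin_iff.2 ⟨?_, ?_⟩
        · exact (NNReal.continuous_coe.tendsto 0).mono_left nhdsWithin_le_nhds
        · filter_upwards [self_mem_nhdsWithin] with s hs
          have : (0 : ℝ) < s := hs
          exact this.ne'
      refine (h2.comp h3).congr fun s => ?_
      simp [slope_def_field, div_eq_inv_mul]
    have hexp'' : Tendsto (fun s : ℝ≥0 => (Real.exp s)⁻¹) (𝓝[>] 0) (𝓝 1) := by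
      simpa using hexp.inv₀ one_ne_zero
    constructor
    · intro hl
      have h4 := (hexp.smul hl).add (hexp'.smul_const x)
      rw [one_smul, one_smul, sub_add_cancel] at h4
      refine h4.congr fun s => ?_
      simp only [smul_apply]
      module
    · intro hl
      have h4 := hexp''.smul (hl.sub (hexp'.smul_const x))
      rw [one_smul, one_smul] at h4
      refine h4.congr fun s => ?_
      have he : Real.exp (s : ℝ) ≠ 0 := (Real.exp_pos _).ne'
      rw [inv_smul_eq_iff₀ he]
      simp only [smul_apply]
      module

end IsMDissipative

/-! ### Second derivatives on the whole plane -/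

theorem partialD_mul {φ ψ : Plane → ℝ} {x : Plane} (hφ : DifferentiableAt ℝ φ x)
    (hψ : DifferentiableAt ℝ ψ x) (i : Fin 2) :
    partialD i (fun x => φ x * ψ x) x = partialD i φ x * ψ x + φ x * partialD i ψ x := by
  rw [partialD, fderiv_fun_mul hφ hψ]
  simp [partialD]
  ring

theorem partialD_add {φ ψ : Plane → ℝ} {x : Plane} (hφ : DifferentiableAt ℝ φ x)
    (hψ : DifferentiableAt ℝ ψ x) (i : Fin 2) :
    partialD i (fun x => φ x + ψ x) x = partialD i φ x + partialD i ψ x := by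
  rw [partialD, fderiv_fun_add hφ hψ]
  simp [partialD]

theorem partialD_congr {φ ψ : Plane → ℝ} {x : Plane} (h : φ =ᶠ[𝓝 x] ψ) (i : Fin 2) :
    partialD i φ =ᶠ[𝓝 x] partialD i ψ := by
  filter_upwards [h.eventuallyEq_nhds] with y hy
  rw [partialD, hy.fderiv_eq, partialD]

theorem contDiff_partialD {φ : Plane → ℝ} (h : ContDiff ℝ ∞ φ) (i : Fin 2) :
    ContDiff ℝ ∞ (partialD i φ) :=
  (h.fderiv_right (m := ∞) (by simp)).clm_apply contDiff_const

theorem partialD_partialD_mul {φ ψ : Plane → ℝ} (hφ : ContDiff ℝ ∞ φ) (hψ : ContDiff ℝ ∞ ψ)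
    (i : Fin 2) (x : Plane) :
    partialD i (partialD i fun x => φ x * ψ x) x =
      partialD i (partialD i φ) x * ψ x + 2 * (partialD i φ x * partialD i ψ x) +
        φ x * partialD i (partialD i ψ) x := by
  have d : ∀ {f : Plane → ℝ}, ContDiff ℝ ∞ f → ∀ y, DifferentiableAt ℝ f y := fun h y =>
    h.differentiable (by simp) y
  have e : partialD i (fun x => φ x * ψ x) =
      fun x => partialD i φ x * ψ x + φ x * partialD i ψ x :=
    funext fun y => partialD_mul (d hφ y) (d hψ y) i
  have hφ' := contDiff_partialD hφ i
  have hψ' := contDiff_partialD hψ i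
  rw [e, partialD_add (d (hφ'.mul hψ) x) (d (hφ.mul hψ') x), partialD_mul (d hφ' x) (d hψ x),
    partialD_mul (d hφ x) (d hψ' x)]
  ring

theorem partialD_comp_smul (c : ℝ) (φ : Plane → ℝ) (i : Fin 2) :
    partialD i (fun x => φ (c • x)) = fun x => c * partialD i φ (c • x) := by
  ext x
  rw [partialD, fderiv_comp_smul]
  simp [partialD]

theorem partialD_const_mul (c : ℝ) (φ : Plane → ℝ) (i : Fin 2) :
    partialD i (fun x => c * φ x) = fun x => c * partialD i φ x := by
  ext x
  have : (fun x => c * φ x) = c • φ := rfl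
  rw [partialD, this, fderiv_const_smul_field]
  simp [partialD]

/-! ### Elliptic regularity on the plane by Fourier analysis. -/

open scoped SchwartzMap LineDeriv Laplacian

/-- Extends the identity from compactly supported to Schwartz test functions, using dilated cutoffs
`χ(c x)` with `c → 0`. Every derivative falling on the cutoff gains a factor `c ≤ 1`, so one
Schwartz-type majorant `B` serves all `c`. -/
theorem integral_mul_lap_schwartz {v F : Plane → ℝ} (hv : MemLp v 2 volume) (hF : MemLp F 2 volume)
    (h : ∀ φ : Plane → ℝ, IsSmoothCpt φ → ∫ x, v x * lap φ x = ∫ x, F x * φ x)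
    (g : 𝓢(Plane, ℝ)) : ∫ x, v x * lap g x = ∫ x, F x * g x := by
  let χ : ContDiffBump (0 : Plane) := ⟨1, 2, one_pos, one_lt_two⟩
  have hχs : ContDiff ℝ ∞ χ := χ.contDiff
  have hχ : IsSmoothCpt χ := ⟨hχs, χ.hasCompactSupport⟩
  have hbd : ∀ {f : Plane → ℝ}, IsSmoothCpt f → ∃ K, 0 ≤ K ∧ ∀ x, |f x| ≤ K := fun {f} hf => by
    obtain ⟨K, hK⟩ := hf.compact.exists_bound_of_continuous hf.smooth.continuous
    exact ⟨K, (norm_nonneg _).trans (hK 0), hK⟩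
  let G : Fin 2 → 𝓢(Plane, ℝ) := fun i => ∂_{basisVec i} g
  let H : Fin 2 → 𝓢(Plane, ℝ) := fun i => ∂_{basisVec i} (G i)
  have eG : ∀ i, partialD i g = G i := fun i => rfl
  have eH : ∀ i, partialD i (G i) = H i := fun i => rfl
  let c : ℕ → ℝ := fun n => 1 / ((n : ℝ) + 1)
  have hc0 : ∀ n, 0 < c n := fun n => by positivity
  have hc1 : ∀ n, c n ≤ 1 := fun n => by
    rw [div_le_one (by positivity)]
    linarith [n.cast_nonneg (α := ℝ)]
  have hc : Tendsto c atTop (𝓝 0) := tendsto_one_div_add_atTop_nhds_zero_nat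
  have hcx : ∀ x : Plane, Tendsto (fun n => c n • x) atTop (𝓝 0) := fun x => by
    simpa using hc.smul_const x
  let ζ : ℕ → Plane → ℝ := fun n x => χ (c n • x) * g x
  have hζ : ∀ n, IsSmoothCpt (ζ n) := fun n => by
    refine ⟨(hχs.comp (contDiff_const_smul (c n))).mul (g.smooth _), HasCompactSupport.mul_right ?_⟩
    exact χ.hasCompactSupport.comp_smul (hc0 n).ne'
  obtain ⟨K0, hK0, hχ0⟩ := hbd hχ
  choose K1 hK1 hχ1 using fun i => hbd (hχ.partialD i)
  choose K2 hK2 hχ2 using fun i => hbd ((hχ.partialD i).partialD i)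
  have hform : ∀ n i x, partialD i (partialD i (ζ n)) x =
      c n * (c n * partialD i (partialD i χ) (c n • x)) * g x +
        2 * (c n * partialD i χ (c n • x) * G i x) + χ (c n • x) * H i x := by
    intro n i x
    have e := partialD_partialD_mul (φ := fun x => χ (c n • x))
      (hχs.comp (contDiff_const_smul (c n))) (g.smooth _) i x
    rwa [partialD_comp_smul, partialD_const_mul, partialD_comp_smul, eG, eH] at e
  let B : Plane → ℝ := fun x => ∑ i, (K2 i * |g x| + 2 * (K1 i * |G i x|) + K0 * |H i x|)
  have hB : MemLp B 2 volume := by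
    refine memLp_finsetSum _ fun i _ => ?_
    exact (((g.memLp 2).abs.const_mul _).add (((((G i).memLp 2).abs.const_mul _)).const_mul _)).add
      (((H i).memLp 2).abs.const_mul _)
  have h1 : Tendsto (fun n => ∫ x, v x * lap (ζ n) x) atTop (𝓝 (∫ x, v x * lap g x)) := by
    refine tendsto_integral_of_dominated_convergence (fun x => |v x| * B x) (fun n => ?_) ?_
      (fun n => .of_forall fun x => ?_) (.of_forall fun x => ?_)
    · exact hv.1.mul (hζ n).lap.smooth.continuous.aestronglyMeasurable
    · exact hv.abs.integrable_mul hB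
    · rw [norm_mul]
      refine mul_le_mul_of_nonneg_left ?_ (norm_nonneg _)
      refine (norm_sum_le _ _).trans (Finset.sum_le_sum fun i _ => ?_)
      rw [hform]
      have a2 := hχ2 i (c n • x)
      have a1 := hχ1 i (c n • x)
      have a0 := hχ0 (c n • x)
      have hcc : |c n| ≤ 1 := by rw [abs_of_pos (hc0 n)]; exact hc1 n
      refine (norm_add₃_le).trans ?_
      simp only [norm_mul, Real.norm_eq_abs, abs_two]
      have b2 : |c n| * (|c n| * |partialD i (partialD i χ) (c n • x)|) ≤ 1 * (1 * K2 i) := by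
        gcongr
      have b1 : |c n| * |partialD i χ (c n • x)| ≤ 1 * K1 i := by gcongr
      rw [one_mul, one_mul] at b2
      rw [one_mul] at b1
      gcongr
    · refine Tendsto.const_mul _ ?_
      refine tendsto_finsetSum _ fun i _ => ?_
      simp_rw [hform]
      have l2 : Tendsto (fun n => c n * (c n * partialD i (partialD i χ) (c n • x)) * g x) atTop
          (𝓝 (0 * (0 * partialD i (partialD i χ) 0) * g x)) :=
        ((hc.mul (hc.mul (((((hχ.partialD i).partialD i).smooth.continuous.tendsto 0)).comp
          (hcx x)))).mul_const _)
      have l1 : Tendsto (fun n => 2 * (c n * partialD i χ (c n • x) * G i x)) atTop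
          (𝓝 (2 * (0 * partialD i χ 0 * G i x))) :=
        ((hc.mul ((((hχ.partialD i).smooth.continuous.tendsto 0)).comp (hcx x))).mul_const _).const_mul _
      have l0 : Tendsto (fun n => χ (c n • x) * H i x) atTop (𝓝 (χ 0 * H i x)) :=
        ((hχs.continuous.tendsto 0).comp (hcx x)).mul_const _
      have e1 : χ (0 : Plane) = 1 := χ.eventuallyEq_one.eq_of_nhds
      have := (l2.add l1).add l0
      rw [eG, eH]
      simpa [e1] using this
  have h2 : Tendsto (fun n => ∫ x, F x * ζ n x) atTop (𝓝 (∫ x, F x * g x)) := by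
    refine tendsto_integral_of_dominated_convergence (fun x => |F x| * (K0 * |g x|)) (fun n => ?_) ?_
      (fun n => .of_forall fun x => ?_) (.of_forall fun x => ?_)
    · exact hF.1.mul (hζ n).smooth.continuous.aestronglyMeasurable
    · exact hF.abs.integrable_mul ((g.memLp 2).abs.const_mul _)
    · rw [norm_mul, norm_mul]
      exact mul_le_mul_of_nonneg_left (mul_le_mul_of_nonneg_right (hχ0 _) (norm_nonneg _))
        (norm_nonneg _)
    · have l0 : Tendsto (fun n => χ (c n • x) * g x) atTop (𝓝 (χ 0 * g x)) :=
        ((hχs.continuous.tendsto 0).comp (hcx x)).mul_const _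
      rw [show χ (0 : Plane) = 1 from χ.eventuallyEq_one.eq_of_nhds, one_mul] at l0
      exact l0.const_mul _
  refine tendsto_nhds_unique h1 (h2.congr fun n => ?_)
  exact (h (ζ n) (hζ n)).symm

/-- The complexification of a real square integrable function. -/
def toComplexL2 {v : Plane → ℝ} (hv : MemLp v 2 volume) : Lp ℂ 2 (volume : Measure Plane) :=
  hv.ofReal.toLp (fun x => (v x : ℂ))

theorem toComplexL2_apply {v : Plane → ℝ} (hv : MemLp v 2 volume) (g : 𝓢(Plane, ℂ)) :
    (toComplexL2 hv : 𝓢'(Plane, ℂ)) g =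
      ((∫ x, v x * (g x).re : ℝ) : ℂ) + ((∫ x, v x * (g x).im : ℝ) : ℂ) * Complex.I := by
  rw [Lp.toTemperedDistribution_apply]
  have hi : Integrable fun x => (v x : ℂ) * g x := hv.ofReal.integrable_mul (g.memLp 2)
  have e : ∫ x, g x • toComplexL2 hv x = ∫ x, (v x : ℂ) * g x := by
    refine integral_congr_ae ?_
    filter_upwards [(hv.ofReal (K := ℂ)).coeFn_toLp] with x hx
    have hx' : toComplexL2 hv x = (v x : ℂ) := hx
    rw [hx', smul_eq_mul, mul_comm]
  rw [e]
  refine Complex.ext ?_ ?_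
  · have := integral_re hi
    simp only [RCLike.re_eq_complex_re, Complex.re_ofReal_mul] at this
    simp [← this]
  · have := integral_im hi
    simp only [RCLike.im_eq_complex_im, Complex.im_ofReal_mul] at this
    simp [← this]

theorem partialD_clm_comp (L : ℂ →L[ℝ] ℝ) (g : 𝓢(Plane, ℂ)) (i : Fin 2) :
    partialD i (fun x => L (g x)) = fun x => L ((∂_{basisVec i} g) x) := by
  ext x
  have h := L.hasFDerivAt.comp x (g.differentiableAt (x := x)).hasFDerivAt
  rw [partialD]
  exact (congrArg (fun A : Plane →L[ℝ] ℝ => A (basisVec i)) h.fderiv)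

theorem lap_clm_comp (L : ℂ →L[ℝ] ℝ) (g : 𝓢(Plane, ℂ)) (x : Plane) :
    lap (fun x => L (g x)) x = L ((Δ g) x) := by
  rw [SchwartzMap.laplacian_eq_sum (EuclideanSpace.basisFun (Fin 2) ℝ), lap]
  simp only [partialD_clm_comp, sum_apply, map_sum, EuclideanSpace.basisFun_apply]

/-- Square integrable functions on the plane with square integrable distributional Laplacian have
square integrable second derivatives. -/
theorem exists_second_partial {v F : Plane → ℝ} (hv : MemLp v 2 volume) (hF : MemLp F 2 volume)
    (h : ∀ φ : Plane → ℝ, IsSmoothCpt φ → ∫ x, v x * lap φ x = ∫ x, F x * φ x) (i j : Fin 2) :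
    ∃ q : Plane → ℝ, MemLp q 2 volume ∧ ∀ φ : Plane → ℝ, IsSmoothCpt φ →
      ∫ x, v x * partialD i (partialD j φ) x = ∫ x, q x * φ x := by
  have hS := integral_mul_lap_schwartz hv hF h
  have hΔ : Δ (toComplexL2 hv : 𝓢'(Plane, ℂ)) = (toComplexL2 hF : 𝓢'(Plane, ℂ)) := by
    ext g
    rw [TemperedDistribution.laplacian_apply_apply, toComplexL2_apply, toComplexL2_apply]
    have e : ∀ L : ℂ →L[ℝ] ℝ, ∫ x, v x * L ((Δ g) x) = ∫ x, F x * L (g x) := fun L => by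
      simp_rw [← lap_clm_comp]
      exact hS (g.postcompCLM L)
    have e1 := e Complex.reCLM
    have e2 := e Complex.imCLM
    simp only [Complex.reCLM_apply, Complex.imCLM_apply] at e1 e2
    rw [e1, e2]
  have hsob : TemperedDistribution.MemSobolev 2 2 (toComplexL2 hv : 𝓢'(Plane, ℂ)) := by
    -- The Bessel potential of order two is multiplication by `1 + |ξ|²` on the Fourier side, while
    -- `Δ` is multiplication by `-(2π)² |ξ|²`.
    refine ⟨toComplexL2 hv - ((2 * Real.pi) ^ 2 : ℝ)⁻¹ • toComplexL2 hF, ?_⟩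
    set f : 𝓢'(Plane, ℂ) := (toComplexL2 hv : 𝓢'(Plane, ℂ))
    have e1 : TemperedDistribution.besselPotential Plane ℂ 2 f =
        f + TemperedDistribution.fourierMultiplierCLM ℂ (fun x => Complex.ofReal (‖x‖ ^ 2)) f := by
      rw [TemperedDistribution.besselPotential, TemperedDistribution.fourierMultiplierCLM_apply,
        TemperedDistribution.fourierMultiplierCLM_apply]
      have e2 : (fun x : Plane => (((1 + ‖x‖ ^ 2) ^ ((2 : ℝ) / 2) : ℝ) : ℂ)) =
          (fun _ => 1) + fun x : Plane => Complex.ofReal (‖x‖ ^ 2) := by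
        ext x
        simp
      rw [e2, TemperedDistribution.smulLeftCLM_add (by fun_prop) (by fun_prop), add_apply,
        TemperedDistribution.smulLeftCLM_const, one_smul, FourierTransform.fourierInv_add,
        FourierTransform.fourierInv_fourier_eq]
    have e3 := TemperedDistribution.laplacian_eq_fourierMultiplierCLM f
    rw [hΔ] at e3
    have hpi : ((2 * Real.pi) ^ 2 : ℝ) ≠ 0 := by positivity
    rw [e1, ← Lp.toTemperedDistributionCLM_apply, map_sub, ContinuousLinearMap.map_smul_of_tower,
      Lp.toTemperedDistributionCLM_apply, Lp.toTemperedDistributionCLM_apply, e3, smul_smul,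
      mul_neg, inv_mul_cancel₀ hpi]
    simp [f]
  have hs1 := (hsob.lineDerivOp (m := basisVec i)).lineDerivOp (m := basisVec j)
  rw [show (2 : ℝ) - 1 - 1 = 0 by norm_num, TemperedDistribution.memSobolev_zero_iff] at hs1
  obtain ⟨w, hw⟩ := hs1
  refine ⟨fun x => (w x).re, (Lp.memLp w).re, fun φ hφ => ?_⟩
  let g : 𝓢(Plane, ℂ) := HasCompactSupport.toSchwartzMap (f := fun x => (φ x : ℂ))
    (hφ.compact.comp_left (g := fun r : ℝ => (r : ℂ)) (by simp))
    (Complex.ofRealCLM.contDiff.comp hφ.smooth)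
  have hg := congrArg (fun D : 𝓢'(Plane, ℂ) => D g) hw
  simp only [TemperedDistribution.lineDerivOp_apply_apply, map_neg, neg_neg] at hg
  rw [toComplexL2_apply, Lp.toTemperedDistribution_apply] at hg
  have hre := congrArg Complex.re hg
  have e1 : ∀ x, φ x = Complex.reCLM (g x) := fun x => rfl
  have e2 : φ = fun x => Complex.reCLM (g x) := funext e1
  have e3 : ∫ x, v x * partialD i (partialD j φ) x =
      ∫ x, v x * ((∂_{basisVec i} (∂_{basisVec j} g)) x).re := by
    rw [e2, partialD_clm_comp, partialD_clm_comp]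
    rfl
  have hi : Integrable fun x => g x • w x := (g.memLp 2).integrable_mul (Lp.memLp w)
  have e4 := integral_re hi
  simp only [RCLike.re_eq_complex_re] at e4
  rw [← e4] at hre
  simp only [Complex.add_re, Complex.ofReal_re, Complex.re_ofReal_mul, Complex.I_re, mul_zero,
    add_zero] at hre
  rw [e3, hre]
  refine integral_congr_ae (.of_forall fun x => ?_)
  have e5 : g x = (φ x : ℂ) := rfl
  simp [e5, mul_comm]

/-! ### Inversion in the unit circle -/

/-- Inversion in the unit circle. -/
def inv (y : Plane) : Plane := (‖y‖ ^ 2)⁻¹ • y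

theorem norm_inv (y : Plane) : ‖inv y‖ = ‖y‖⁻¹ := by
  rcases eq_or_ne y 0 with rfl | hy
  · simp [inv]
  · have : ‖y‖ ≠ 0 := norm_ne_zero_iff.2 hy
    rw [inv, norm_smul, _root_.norm_inv, norm_pow, norm_norm]
    field_simp

theorem inv_inv (y : Plane) : inv (inv y) = y := by
  rcases eq_or_ne y 0 with rfl | hy
  · simp [inv]
  · have : ‖y‖ ≠ 0 := norm_ne_zero_iff.2 hy
    rw [inv, norm_inv, inv, smul_smul]
    have e : ((‖y‖⁻¹ ^ 2)⁻¹ * (‖y‖ ^ 2)⁻¹) = 1 := by field_simp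
    rw [e, one_smul]

theorem inv_of_norm_eq_one {y : Plane} (hy : ‖y‖ = 1) : inv y = y := by simp [inv, hy]

/-- The derivative of the inversion. -/
def invDeriv (y : Plane) : Plane →L[ℝ] Plane :=
  (‖y‖ ^ 2)⁻¹ • ContinuousLinearMap.id ℝ Plane -
    ((2 * ((‖y‖ ^ 2)⁻¹ * (‖y‖ ^ 2)⁻¹)) • innerSL ℝ y).smulRight y

theorem hasFDerivAt_normSqInv {y : Plane} (hy : y ≠ 0) :
    HasFDerivAt (fun y : Plane => (‖y‖ ^ 2)⁻¹)
      (-(2 * ((‖y‖ ^ 2)⁻¹ * (‖y‖ ^ 2)⁻¹)) • innerSL ℝ y) y := by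
  have h0 : ‖y‖ ^ 2 ≠ 0 := by positivity
  have h := (hasDerivAt_inv h0).comp_hasFDerivAt y (hasStrictFDerivAt_norm_sq y).hasFDerivAt
  refine h.congr_fderiv ?_
  ext v
  simp
  field_simp

theorem hasFDerivAt_inv {y : Plane} (hy : y ≠ 0) : HasFDerivAt inv (invDeriv y) y := by
  have h : HasFDerivAt inv _ y := (hasFDerivAt_normSqInv hy).smul (hasFDerivAt_id y)
  refine h.congr_fderiv ?_
  ext v i
  simp [invDeriv]
  ring

theorem norm_sq_eq (y : Plane) : ‖y‖ ^ 2 = y 0 ^ 2 + y 1 ^ 2 := by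
  rw [EuclideanSpace.norm_sq_eq, Fin.sum_univ_two]
  simp

/-- The derivative is `|y|^{-2}` times a reflection, so its determinant is `-|y|^{-4}`. -/
theorem abs_det_invDeriv {y : Plane} (hy : y ≠ 0) : |(invDeriv y).det| = (‖y‖ ^ 4)⁻¹ := by
  have h0 : ‖y‖ ^ 2 ≠ 0 := by positivity
  have e : (invDeriv y).det = -(‖y‖ ^ 4)⁻¹ := by
    have h1 : ((invDeriv y : Plane →L[ℝ] Plane) : Plane →ₗ[ℝ] Plane).det = _ :=
      (LinearMap.det_toMatrix (EuclideanSpace.basisFun (Fin 2) ℝ).toBasis _).symm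
    rw [ContinuousLinearMap.det, h1, Matrix.det_fin_two]
    simp only [LinearMap.toMatrix_apply, OrthonormalBasis.coe_toBasis, EuclideanSpace.basisFun_apply,
      OrthonormalBasis.coe_toBasis_repr_apply, EuclideanSpace.basisFun_repr,
      ContinuousLinearMap.coe_coe, invDeriv]
    simp [EuclideanSpace.inner_single_right]
    have e4 : ‖y‖ ^ 4 = (‖y‖ ^ 2) ^ 2 := by ring
    rw [e4]
    have hn := norm_sq_eq y
    generalize ‖y‖ ^ 2 = N at *
    field_simp
    rw [hn]
    ring
  rw [e, abs_neg, abs_of_nonneg (by positivity)]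

theorem partialD_comp_inv {Φ : Plane → ℝ} (hΦ : Differentiable ℝ Φ) {y : Plane} (hy : y ≠ 0)
    (i : Fin 2) : partialD i (fun y => Φ (inv y)) y =
      (‖y‖ ^ 2)⁻¹ * partialD i Φ (inv y) - 2 * ((‖y‖ ^ 2)⁻¹ * (‖y‖ ^ 2)⁻¹) * y i *
        (y 0 * partialD 0 Φ (inv y) + y 1 * partialD 1 Φ (inv y)) := by
  have h : HasFDerivAt (fun y => Φ (inv y)) _ y :=
    (hΦ (inv y)).hasFDerivAt.comp y (hasFDerivAt_inv hy)
  have hd : ∀ v : Plane, v = v 0 • basisVec 0 + v 1 • basisVec 1 := fun v => by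
    ext k
    fin_cases k <;> simp
  have hy' : fderiv ℝ Φ (inv y) y = y 0 * partialD 0 Φ (inv y) + y 1 * partialD 1 Φ (inv y) :=
    (congrArg (fderiv ℝ Φ (inv y)) (hd y)).trans (by simp [partialD])
  rw [partialD, h.fderiv]
  simp only [ContinuousLinearMap.comp_apply, invDeriv]
  simp [EuclideanSpace.inner_single_right, hy', partialD]

/-- Conformal covariance of the Laplacian in two dimensions, with no first-order term: the conformal
factor of the inversion is `|y|^{-2}`. The computation is the chain rule together with symmetry of
the mixed derivatives. -/
theorem lap_comp_inv {Φ : Plane → ℝ} (hΦ : ContDiff ℝ ∞ Φ) {y : Plane} (hy : y ≠ 0) :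
    lap (fun y => Φ (inv y)) y = (‖y‖ ^ 4)⁻¹ * lap Φ (inv y) := by
  have hΦd : ∀ j, Differentiable ℝ (partialD j Φ) := fun j =>
    (contDiff_partialD hΦ j).differentiable (by simp)
  have hev : ∀ i, partialD i (fun y => Φ (inv y)) =ᶠ[𝓝 y] fun y =>
      (‖y‖ ^ 2)⁻¹ * partialD i Φ (inv y) + -2 * ((‖y‖ ^ 2)⁻¹ * (‖y‖ ^ 2)⁻¹ * y i *
        (y 0 * partialD 0 Φ (inv y) + y 1 * partialD 1 Φ (inv y))) := fun i => by
    filter_upwards [isOpen_ne.mem_nhds hy] with z hz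
    rw [partialD_comp_inv (hΦ.differentiable (by simp)) hz]
    ring
  have hA : ∀ j, DifferentiableAt ℝ (fun y => partialD j Φ (inv y)) y := fun j =>
    (hΦd j (inv y)).comp y (hasFDerivAt_inv hy).differentiableAt
  have hN : DifferentiableAt ℝ (fun y : Plane => (‖y‖ ^ 2)⁻¹) y :=
    (hasFDerivAt_normSqInv hy).differentiableAt
  have hc : ∀ j, DifferentiableAt ℝ (fun y : Plane => y j) y := fun j =>
    (EuclideanSpace.proj j : Plane →L[ℝ] ℝ).differentiableAt
  have pN : ∀ i, partialD i (fun y : Plane => (‖y‖ ^ 2)⁻¹) y =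
      -(2 * ((‖y‖ ^ 2)⁻¹ * (‖y‖ ^ 2)⁻¹)) * y i := fun i => by
    rw [partialD, (hasFDerivAt_normSqInv hy).fderiv]
    simp [EuclideanSpace.inner_single_right]
  have pc : ∀ i j : Fin 2, partialD i (fun y : Plane => y j) y = if i = j then 1 else 0 := by
    intro i j
    have h : HasFDerivAt (fun y : Plane => y j) (EuclideanSpace.proj j : Plane →L[ℝ] ℝ) y :=
      (EuclideanSpace.proj j : Plane →L[ℝ] ℝ).hasFDerivAt
    rw [partialD, h.fderiv]
    simp [eq_comm]
  have hsymm : partialD 1 (partialD 0 Φ) (inv y) = partialD 0 (partialD 1 Φ) (inv y) := by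
    have h2 : ContDiffAt ℝ 2 Φ (inv y) := (hΦ.of_le (by norm_cast)).contDiffAt
    have hs := h2.isSymmSndFDerivAt (by simp) (basisVec 0) (basisVec 1)
    have hdd : DifferentiableAt ℝ (fderiv ℝ Φ) (inv y) :=
      (hΦ.fderiv_right (m := ∞) (by simp)).differentiable (by simp) _
    have e : ∀ i j, partialD i (partialD j Φ) (inv y) =
        fderiv ℝ (fderiv ℝ Φ) (inv y) (basisVec i) (basisVec j) := fun i j => by
      have : HasFDerivAt (partialD j Φ) _ (inv y) := hdd.hasFDerivAt.clm_apply
        (hasFDerivAt_const (basisVec j) (inv y))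
      rw [partialD, this.fderiv]
      simp
    rw [e, e]
    exact hs.symm
  have hq := ((hc 0).fun_mul (hA 0)).fun_add ((hc 1).fun_mul (hA 1))
  have hNN := hN.fun_mul hN
  have pA : ∀ i j, partialD i (fun y => partialD j Φ (inv y)) y = _ := fun i j =>
    partialD_comp_inv (hΦd j) hy i
  have key : ∀ i, partialD i (partialD i fun y => Φ (inv y)) y =
      partialD i (fun y : Plane => (‖y‖ ^ 2)⁻¹) y * partialD i Φ (inv y) +
        (‖y‖ ^ 2)⁻¹ * partialD i (fun y => partialD i Φ (inv y)) y +
      -2 * (((partialD i (fun y : Plane => (‖y‖ ^ 2)⁻¹) y * (‖y‖ ^ 2)⁻¹ +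
          (‖y‖ ^ 2)⁻¹ * partialD i (fun y : Plane => (‖y‖ ^ 2)⁻¹) y) * y i +
          (‖y‖ ^ 2)⁻¹ * (‖y‖ ^ 2)⁻¹ * partialD i (fun y : Plane => y i) y) *
          (y 0 * partialD 0 Φ (inv y) + y 1 * partialD 1 Φ (inv y)) +
        (‖y‖ ^ 2)⁻¹ * (‖y‖ ^ 2)⁻¹ * y i *
          (partialD i (fun y : Plane => y 0) y * partialD 0 Φ (inv y) +
            y 0 * partialD i (fun y => partialD 0 Φ (inv y)) y +
            (partialD i (fun y : Plane => y 1) y * partialD 1 Φ (inv y) +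
              y 1 * partialD i (fun y => partialD 1 Φ (inv y)) y))) := fun i => by
    rw [(partialD_congr (hev i) i).eq_of_nhds, partialD_add (hN.fun_mul (hA i))
      (((hNN.fun_mul (hc i)).fun_mul hq).const_mul (-2)), partialD_mul hN (hA i),
      partialD_const_mul]
    beta_reduce
    rw [partialD_mul (hNN.fun_mul (hc i)) hq, partialD_mul hNN (hc i),
      partialD_mul hN hN, partialD_add ((hc 0).fun_mul (hA 0)) ((hc 1).fun_mul (hA 1)),
      partialD_mul (hc 0) (hA 0), partialD_mul (hc 1) (hA 1)]
  rw [lap, lap, Fin.sum_univ_two, Fin.sum_univ_two, key, key]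
  simp only [pA, pN, pc]
  have e4 : ‖y‖ ^ 4 = (‖y‖ ^ 2) ^ 2 := by ring
  have h0 : ‖y‖ ^ 2 ≠ 0 := by positivity
  have hn := norm_sq_eq y
  rw [e4]
  simp only [hsymm]
  clear key pA pN hNN hN hev
  generalize ‖y‖ ^ 2 = N at *
  simp
  field_simp
  rw [hn]
  ring

/-! ### Reflection of functions into the disc -/

/-- The punctured open unit disc. -/
def disc : Set Plane := {x | 0 < ‖x‖ ∧ ‖x‖ < 1}

theorem measurableSet_disc : MeasurableSet disc :=
  ((isOpen_lt continuous_const continuous_norm).inter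
    (isOpen_lt continuous_norm continuous_const)).measurableSet

theorem image_inv_Ext : inv '' Ext = disc := by
  ext x
  constructor
  · rintro ⟨y, hy, rfl⟩
    have hy1 : 1 < ‖y‖ := hy
    rw [disc, mem_ofPred_eq, norm_inv]
    exact ⟨by positivity, inv_lt_one_of_one_lt₀ hy1⟩
  · rintro ⟨h0, h1⟩
    refine ⟨inv x, ?_, inv_inv x⟩
    rw [Ext, mem_ofPred_eq, norm_inv]
    exact (one_lt_inv₀ h0).2 h1

theorem injOn_inv : InjOn inv Ext := (Function.LeftInverse.injective inv_inv).injOn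

theorem measurable_inv : Measurable inv :=
  (measurable_norm.pow_const 2).inv.smul measurable_id

theorem setIntegral_disc (k : Plane → ℝ) :
    ∫ x in disc, k x = ∫ y in Ext, (‖y‖ ^ 4)⁻¹ * k (inv y) := by
  rw [← image_inv_Ext, integral_image_eq_integral_abs_det_fderiv_smul volume measurableSet_Ext
    (fun y hy => (hasFDerivAt_inv (Ext.ne_zero hy)).hasFDerivWithinAt) injOn_inv]
  refine setIntegral_congr_fun measurableSet_Ext fun y hy => ?_
  simp only [abs_det_invDeriv (Ext.ne_zero hy), smul_eq_mul]

theorem integrableOn_disc (k : Plane → ℝ) :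
    IntegrableOn k disc ↔ IntegrableOn (fun y => (‖y‖ ^ 4)⁻¹ * k (inv y)) Ext := by
  rw [← image_inv_Ext, integrableOn_image_iff_integrableOn_abs_det_fderiv_smul volume
    measurableSet_Ext (fun y hy => (hasFDerivAt_inv (Ext.ne_zero hy)).hasFDerivWithinAt) injOn_inv]
  refine integrableOn_congr_fun (fun y hy => ?_) measurableSet_Ext
  simp only [abs_det_invDeriv (Ext.ne_zero hy), smul_eq_mul]

/-- The transpose of the composition with the inversion. -/
def refl (h : Plane → ℝ) : Plane → ℝ := disc.indicator fun x => (‖x‖ ^ 4)⁻¹ * h (inv x)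

/-- The change of variables leaves the weight `|y|^4` on `h²`, which is bounded because `h` vanishes
for `|y| ≥ R`. -/
theorem memLp_refl {h : Plane → ℝ} (hm : Measurable h) (h2 : MemLp h 2 volExt) {R : ℝ}
    (hR : ∀ y, R ≤ ‖y‖ → h y = 0) : MemLp (refl h) 2 volume := by
  have hmeas : Measurable fun x : Plane => (‖x‖ ^ 4)⁻¹ * h (inv x) :=
    (measurable_norm.pow_const 4).inv.mul (hm.comp measurable_inv)
  rw [refl, memLp_indicator_iff_restrict measurableSet_disc,
    memLp_two_iff_integrable_sq hmeas.aestronglyMeasurable]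
  refine (integrableOn_disc _).2 ?_
  have h3 : Integrable (fun y => R ^ 4 * h y ^ 2) volExt := h2.integrable_sq.const_mul _
  refine h3.mono' ?_ ?_
  · exact ((measurable_norm.pow_const 4).inv.mul
      ((hmeas.comp measurable_inv).pow_const 2)).aestronglyMeasurable
  · filter_upwards [ae_restrict_mem measurableSet_Ext] with y hy
    have hy1 : 1 < ‖y‖ := hy
    have hy0 : ‖y‖ ≠ 0 := by positivity
    rw [inv_inv, norm_inv]
    have e : (‖y‖ ^ 4)⁻¹ * ((‖y‖⁻¹ ^ 4)⁻¹ * h y) ^ 2 = ‖y‖ ^ 4 * h y ^ 2 := by field_simp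
    rw [e, Real.norm_of_nonneg (by positivity)]
    rcases le_or_gt R ‖y‖ with hc | hc
    · rw [hR y hc]
      simp
    · gcongr

/-- The factor `|x|^{-4}` in `refl` cancels the Jacobian of the inversion. -/
theorem integral_refl_mul (h Φ : Plane → ℝ) :
    ∫ x, refl h x * Φ x = ∫ y in Ext, h y * Φ (inv y) := by
  have e : ∀ x, refl h x * Φ x = disc.indicator (fun x => (‖x‖ ^ 4)⁻¹ * h (inv x) * Φ x) x :=
    fun x => by
      by_cases hx : x ∈ disc
      · rw [refl, indicator_of_mem hx, indicator_of_mem hx]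
      · rw [refl, indicator_of_notMem hx, indicator_of_notMem hx, zero_mul]
  simp_rw [e]
  rw [integral_indicator measurableSet_disc, setIntegral_disc]
  refine setIntegral_congr_fun measurableSet_Ext fun y hy => ?_
  have hy0 : ‖y‖ ≠ 0 := norm_ne_zero_iff.2 (Ext.ne_zero hy)
  simp only [inv_inv, norm_inv]
  field_simp

/-! ### Regularity of weak solutions -/

/-- The cutoff function used in the reflection argument. -/
def eta : Plane → ℝ := radial fun r => innerCutoff r * outerCutoff 2 r

theorem isSmoothCpt_eta : IsSmoothCpt eta := (isProfile_cutoff 2).isSmoothCpt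

theorem eta_of_norm_eq_one {x : Plane} (hx : ‖x‖ = 1) : eta x = 1 := by
  rw [eta, radial, innerCutoff_of_ge (by linarith), outerCutoff_of_le (by linarith), one_mul]

theorem eta_of_three_le {x : Plane} (hx : 3 ≤ ‖x‖) : eta x = 0 := by
  rw [eta, radial, outerCutoff_of_ge (by linarith), mul_zero]

theorem partialD_eq_zero_of_gt {φ : Plane → ℝ} {R : ℝ} (h : ∀ x, R < ‖x‖ → φ x = 0) (i : Fin 2)
    (x : Plane) (hx : R < ‖x‖) : partialD i φ x = 0 := by
  have : φ =ᶠ[𝓝 x] fun _ => 0 := by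
    filter_upwards [(isOpen_lt continuous_const continuous_norm).mem_nhds hx] with y hy
    exact h y hy
  rw [partialD, this.fderiv_eq]
  simp

theorem eta_of_three_lt (x : Plane) (hx : 3 < ‖x‖) : eta x = 0 := eta_of_three_le hx.le

theorem lap_eta_of_three_lt (x : Plane) (hx : 3 < ‖x‖) : lap eta x = 0 :=
  Finset.sum_eq_zero fun i _ =>
    partialD_eq_zero_of_gt (partialD_eq_zero_of_gt eta_of_three_lt i) i x hx

/-- The pull-back of `Φ` under the inversion, cut off near the origin. -/
def pull (Φ : Plane → ℝ) : Plane → ℝ := fun y => innerCutoff ‖y‖ * Φ (inv y)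

theorem pull_eq {Φ : Plane → ℝ} {y : Plane} (hy : 3 / 4 ≤ ‖y‖) : pull Φ y = Φ (inv y) := by
  rw [pull, innerCutoff_of_ge hy, one_mul]

theorem contDiff_pull {Φ : Plane → ℝ} (hΦ : ContDiff ℝ ∞ Φ) : ContDiff ℝ ∞ (pull Φ) := by
  refine contDiff_iff_contDiffAt.2 fun y => ?_
  rcases lt_or_ge ‖y‖ (1 / 2) with hy | hy
  · have : pull Φ =ᶠ[𝓝 y] fun _ => 0 := by
      filter_upwards [(isOpen_lt continuous_norm continuous_const).mem_nhds hy] with z hz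
      rw [pull, innerCutoff_of_le (le_of_lt hz), zero_mul]
    exact contDiffAt_const.congr_of_eventuallyEq this
  · have hy0 : y ≠ 0 := by
      rintro rfl
      norm_num at hy
    have h1 : ContDiffAt ℝ ∞ inv y :=
      ((contDiffAt_id.norm_sq ℝ).inv (by simpa using hy0)).smul contDiffAt_id
    exact (contDiff_innerCutoff.contDiffAt.comp y (contDiffAt_norm ℝ hy0)).mul
      (hΦ.contDiffAt.comp y h1)

theorem lap_congr {φ ψ : Plane → ℝ} {x : Plane} (h : φ =ᶠ[𝓝 x] ψ) : lap φ x = lap ψ x :=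
  Finset.sum_congr rfl fun i _ => (partialD_congr (partialD_congr h i) i).eq_of_nhds

theorem lap_pull {Φ : Plane → ℝ} (hΦ : ContDiff ℝ ∞ Φ) {y : Plane} (hy : y ∈ Ext) :
    lap (pull Φ) y = (‖y‖ ^ 4)⁻¹ * lap Φ (inv y) := by
  rw [← lap_comp_inv hΦ (Ext.ne_zero hy)]
  refine lap_congr ?_
  filter_upwards [isOpen_Ext.mem_nhds hy] with z hz
  have hz1 : 1 < ‖z‖ := hz
  exact pull_eq (by linarith)

theorem IsSmoothCpt.mul_smooth {φ ψ : Plane → ℝ} (hφ : IsSmoothCpt φ) (hψ : ContDiff ℝ ∞ ψ) :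
    IsSmoothCpt (fun x => φ x * ψ x) := ⟨hφ.smooth.mul hψ, hφ.compact.mul_right⟩

theorem IsSmoothCpt.sub {φ ψ : Plane → ℝ} (hφ : IsSmoothCpt φ) (hψ : IsSmoothCpt ψ) :
    IsSmoothCpt (fun x => φ x - ψ x) :=
  ⟨hφ.smooth.sub hψ.smooth, by
    have h := hφ.compact.add hψ.compact.neg
    rwa [← sub_eq_add_neg] at h⟩

theorem lap_sub {φ ψ : Plane → ℝ} (hφ : IsSmoothCpt φ) (hψ : IsSmoothCpt ψ) (x : Plane) :
    lap (fun x => φ x - ψ x) x = lap φ x - lap ψ x := by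
  have e : ∀ {a b : Plane → ℝ}, IsSmoothCpt a → IsSmoothCpt b → ∀ i,
      partialD i (fun x => a x - b x) = fun x => partialD i a x - partialD i b x := by
    intro a b ha hb i
    ext y
    rw [partialD, fderiv_fun_sub (ha.differentiable y) (hb.differentiable y)]
    rfl
  simp only [lap]
  rw [← Finset.sum_sub_distrib]
  refine Finset.sum_congr rfl fun i _ => ?_
  rw [e hφ hψ, e (hφ.partialD i) (hψ.partialD i)]

theorem IsSmoothCpt.memLp_mul {a u : Plane → ℝ} (ha : IsSmoothCpt a) (hu : MemLp u 2 volExt) :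
    MemLp (fun x => a x * u x) 2 volExt := by
  obtain ⟨K, hK⟩ := ha.compact.exists_bound_of_continuous ha.smooth.continuous
  refine hu.of_le_mul (c := K) (ha.smooth.continuous.aestronglyMeasurable.mul hu.1)
    (.of_forall fun x => ?_)
  rw [norm_mul]
  exact mul_le_mul_of_nonneg_right (hK x) (norm_nonneg _)

/-- The extension of `u` to the plane by odd reflection. -/
def oddExt (u : L2) : Plane → ℝ := fun x =>
  Ext.indicator u x - refl (fun y => (‖y‖ ^ 4)⁻¹ * (eta y * u y)) x

/-- The reflected part of the Laplacian of the odd extension. -/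
def lower (w : WithLp 2 (L2 × L2Vec)) (f : L2) : Plane → ℝ := fun y =>
  eta y * f y + (2 * ∑ i, partialD i eta y * w.snd y i + lap eta y * w.fst y)

/-- The Laplacian of the odd extension. -/
def oddLap (w : WithLp 2 (L2 × L2Vec)) (f : L2) : Plane → ℝ := fun x =>
  Ext.indicator f x - refl (lower w f) x

theorem memLp_indicator_Ext (u : L2) : MemLp (Ext.indicator u) 2 volume :=
  (memLp_indicator_iff_restrict measurableSet_Ext).2 (Lp.memLp u)

theorem measurable_coe (u : L2) : Measurable u := (Lp.stronglyMeasurable u).measurable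

theorem memLp_refl_mul (u : L2) :
    MemLp (refl fun y => (‖y‖ ^ 4)⁻¹ * (eta y * u y)) 2 volume := by
  refine memLp_refl (R := 3) ?_ ?_ fun y hy => ?_
  · exact (measurable_norm.pow_const 4).inv.mul
      (isSmoothCpt_eta.smooth.continuous.measurable.mul (measurable_coe u))
  · have h := isSmoothCpt_eta.memLp_mul (Lp.memLp u)
    refine h.mono ((measurable_norm.pow_const 4).inv.aestronglyMeasurable.mul h.1) ?_
    filter_upwards [ae_restrict_mem measurableSet_Ext] with y hy
    have hy1 : 1 < ‖y‖ := hy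
    rw [norm_mul]
    refine mul_le_of_le_one_left (norm_nonneg _) ?_
    rw [Real.norm_of_nonneg (by positivity)]
    exact inv_le_one_of_one_le₀ (one_le_pow₀ hy1.le)
  · rw [eta_of_three_le hy]
    simp

theorem memLp_oddExt (u : L2) : MemLp (oddExt u) 2 volume :=
  (memLp_indicator_Ext u).sub (memLp_refl_mul u)

theorem memLp_partialD_eta_mul (w : WithLp 2 (L2 × L2Vec)) (i : Fin 2) :
    MemLp (fun y => partialD i eta y * w.snd y i) 2 volExt :=
  (isSmoothCpt_eta.partialD i).memLp_mul (memLp_coord (Lp.memLp w.snd) i)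

theorem memLp_refl_lower (w : WithLp 2 (L2 × L2Vec)) (f : L2) :
    MemLp (refl (lower w f)) 2 volume := by
  refine memLp_refl (R := 4) ?_ ?_ fun y hy => ?_
  · have hw : ∀ i : Fin 2, Measurable fun y => w.snd y i := fun i =>
      (EuclideanSpace.proj i : Plane →L[ℝ] ℝ).continuous.measurable.comp
        (Lp.stronglyMeasurable w.snd).measurable
    refine (isSmoothCpt_eta.smooth.continuous.measurable.mul (measurable_coe f)).add
      ((measurable_const.mul (Finset.measurable_fun_sum _ fun i _ => ?_)).add
        (isSmoothCpt_eta.lap.smooth.continuous.measurable.mul (measurable_coe w.fst)))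
    exact (isSmoothCpt_eta.partialD i).smooth.continuous.measurable.mul (hw i)
  · exact (isSmoothCpt_eta.memLp_mul (Lp.memLp f)).add
      (((memLp_finsetSum _ fun i _ => memLp_partialD_eta_mul w i).const_mul 2).add
        (isSmoothCpt_eta.lap.memLp_mul (Lp.memLp w.fst)))
  · have h3 : 3 < ‖y‖ := by linarith
    have e := fun i => partialD_eq_zero_of_gt eta_of_three_lt i y h3
    simp [lower, eta_of_three_lt y h3, lap_eta_of_three_lt y h3, e]

theorem memLp_oddLap (w : WithLp 2 (L2 × L2Vec)) (f : L2) : MemLp (oddLap w f) 2 volume :=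
  (memLp_indicator_Ext f).sub (memLp_refl_lower w f)

theorem integral_sub_refl {u : L2} {h Φ : Plane → ℝ} (hΦ : IsSmoothCpt Φ)
    (hh : MemLp (refl h) 2 volume) :
    ∫ x, (Ext.indicator u x - refl h x) * Φ x =
      (∫ x in Ext, u x * Φ x) - ∫ y in Ext, h y * Φ (inv y) := by
  have hΦ2 : MemLp Φ 2 volume := hΦ.smooth.continuous.memLp_of_hasCompactSupport hΦ.compact
  have e : ∫ x in Ext, u x * Φ x = ∫ x, Ext.indicator u x * Φ x := by
    rw [← integral_indicator measurableSet_Ext]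
    refine integral_congr_ae (.of_forall fun x => ?_)
    by_cases hx : x ∈ Ext
    · simp only [indicator_of_mem hx]
    · simp only [indicator_of_notMem hx, zero_mul]
  rw [e, ← integral_refl_mul]
  simp_rw [sub_mul]
  exact integral_sub ((memLp_indicator_Ext u).integrable_mul hΦ2) (hh.integrable_mul hΦ2)

/-- The product rule arranged so that the middle term is a divergence. Integrated against `u`, it
needs only one derivative of `u`, which is available in `H_0^1`. -/
theorem mul_lap {φ ψ : Plane → ℝ} (hφ : ContDiff ℝ ∞ φ) (hψ : ContDiff ℝ ∞ ψ) (x : Plane) :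
    φ x * lap ψ x = lap (fun y => φ y * ψ y) x -
      2 * ∑ i, partialD i (fun y => partialD i φ y * ψ y) x + lap φ x * ψ x := by
  have d : ∀ {f : Plane → ℝ}, ContDiff ℝ ∞ f → ∀ y, DifferentiableAt ℝ f y := fun h y =>
    h.differentiable (by simp) y
  simp only [lap, partialD_partialD_mul hφ hψ,
    fun i => partialD_mul (d (contDiff_partialD hφ i) x) (d hψ x) i, Fin.sum_univ_two]
  ring

/-- A weak solution of the Dirichlet problem, extended by odd reflection, solves the Poisson
equation in the plane. -/
theorem integral_oddExt_mul_lap {w : WithLp 2 (L2 × L2Vec)} (hw : w ∈ H10) {f : L2}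
    (h : ∀ φ : Plane → ℝ, IsSmoothCpt φ → (∀ x, ‖x‖ = 1 → φ x = 0) →
      ∫ x in Ext, w.fst x * lap φ x = ∫ x in Ext, f x * φ x)
    {Φ : Plane → ℝ} (hΦ : IsSmoothCpt Φ) :
    ∫ x, oddExt w.fst x * lap Φ x = ∫ x, oddLap w f x * Φ x := by
  have hP := contDiff_pull hΦ.smooth
  have hΘ : IsSmoothCpt fun y => eta y * pull Φ y := isSmoothCpt_eta.mul_smooth hP
  have hα : ∀ i, IsSmoothCpt fun y => partialD i eta y * pull Φ y := fun i =>
    (isSmoothCpt_eta.partialD i).mul_smooth hP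
  have hβ : IsSmoothCpt fun y => lap eta y * pull Φ y := isSmoothCpt_eta.lap.mul_smooth hP
  have hu := Lp.memLp w.fst
  have hpull : ∀ y ∈ Ext, Φ (inv y) = pull Φ y := fun y hy => by
    have hy1 : 1 < ‖y‖ := hy
    exact (pull_eq (by linarith)).symm
  have i1 := integrable_mul_volExt hu hΘ.lap.memLp
  have i2 := fun i => integrable_mul_volExt hu ((hα i).partialD i).memLp
  have i3 := integrable_mul_volExt hu hβ.memLp
  -- Conformal covariance turns `|y|^{-4} (ΔΦ)(inv y)` into the Laplacian of `pull Φ`. Commuting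
  -- `eta` with this Laplacian produces the lower-order terms collected in `lower`.
  have e1 : ∫ y in Ext, (‖y‖ ^ 4)⁻¹ * (eta y * w.fst y) * lap Φ (inv y) =
      (∫ y in Ext, w.fst y * lap (fun y => eta y * pull Φ y) y) +
        2 * (∑ i, ∫ y in Ext, w.snd y i * (partialD i eta y * pull Φ y)) +
        ∫ y in Ext, w.fst y * (lap eta y * pull Φ y) := by
    have e : ∀ i, ∫ y in Ext, w.snd y i * (partialD i eta y * pull Φ y) =
        -∫ y in Ext, w.fst y * partialD i (fun y => partialD i eta y * pull Φ y) y := fun i => by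
      rw [H10.integral_fst_mul_partialD hw (hα i) i, neg_neg]
    have i4 : Integrable (fun y => w.fst y * lap (fun y => eta y * pull Φ y) y -
        2 * ∑ i, w.fst y * partialD i (fun y => partialD i eta y * pull Φ y) y) volExt :=
      i1.sub ((integrable_finsetSum _ fun i _ => i2 i).const_mul 2)
    simp_rw [e]
    rw [Finset.sum_neg_distrib, mul_neg, ← sub_eq_add_neg, ← integral_finsetSum _ fun i _ => i2 i,
      ← integral_const_mul, ← integral_sub i1 ((integrable_finsetSum _ fun i _ => i2 i).const_mul 2),
      ← integral_add i4 i3]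
    refine setIntegral_congr_fun measurableSet_Ext fun y hy => ?_
    have e2 := mul_lap isSmoothCpt_eta.smooth hP y
    rw [lap_pull hΦ.smooth hy] at e2
    simp only [← Finset.mul_sum]
    linear_combination w.fst y * e2
  have e3 : ∫ y in Ext, lower w f y * Φ (inv y) =
      (∫ y in Ext, f y * (eta y * pull Φ y)) +
        2 * (∑ i, ∫ y in Ext, w.snd y i * (partialD i eta y * pull Φ y)) +
        ∫ y in Ext, w.fst y * (lap eta y * pull Φ y) := by
    have j1 := integrable_mul_volExt (Lp.memLp f) hΘ.memLp
    have j2 := fun i => integrable_mul_volExt (memLp_coord (Lp.memLp w.snd) i) (hα i).memLp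
    rw [← integral_finsetSum _ fun i _ => j2 i, ← integral_const_mul,
      ← integral_add j1 ((integrable_finsetSum _ fun i _ => j2 i).const_mul 2),
      ← integral_add (j1.fun_add ((integrable_finsetSum _ fun i _ => j2 i).const_mul 2)) i3]
    refine setIntegral_congr_fun measurableSet_Ext fun y hy => ?_
    simp only [lower, hpull y hy, Fin.sum_univ_two]
    ring
  -- The heart of the reflection: the inversion fixes the unit circle and `eta = 1` there, so `Φ -
  -- eta · pull Φ` vanishes on the circle and is admissible in the weak Dirichlet problem for
  -- arbitrary `Φ`.
  have e4 := h _ (hΦ.sub hΘ) fun x hx => by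
    rw [eta_of_norm_eq_one hx, pull_eq (by linarith), inv_of_norm_eq_one hx, one_mul, sub_self]
  simp only [lap_sub hΦ hΘ, mul_sub] at e4
  rw [integral_sub (integrable_mul_volExt hu hΦ.lap.memLp) i1,
    integral_sub (integrable_mul_volExt (Lp.memLp f) hΦ.memLp)
      (integrable_mul_volExt (Lp.memLp f) hΘ.memLp)] at e4
  have e5 := integral_sub_refl (u := w.fst) hΦ.lap (memLp_refl_mul w.fst)
  have e6 := integral_sub_refl (u := f) hΦ (memLp_refl_lower w f)
  simp only [oddExt, oddLap]
  rw [e5, e6, e1, e3]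
  linarith

theorem oddExt_eq {u : L2} {x : Plane} (hx : x ∈ Ext) : oddExt u x = u x := by
  have hx1 : 1 < ‖x‖ := hx
  have : x ∉ disc := fun h => by linarith [h.2]
  rw [oddExt, refl, indicator_of_mem hx, indicator_of_notMem this, sub_zero]

theorem IsTest.partialD {φ : Plane → ℝ} (h : IsTest φ) (i : Fin 2) : IsTest (partialD i φ) :=
  ⟨(h.isSmoothCpt.partialD i).smooth, (h.isSmoothCpt.partialD i).compact,
    (tsupport_fderiv_apply_subset ℝ (basisVec i)).trans h.supp⟩

theorem integral_oddExt_mul (u : L2) {φ : Plane → ℝ} (hφ : IsTest φ) :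
    ∫ x, oddExt u x * φ x = ∫ x in Ext, u x * φ x := by
  rw [← setIntegral_Ext_eq fun x hx => by rw [hφ.eq_zero hx, mul_zero]]
  exact setIntegral_congr_fun measurableSet_Ext fun x hx => by simp only [oddExt_eq hx]

/-- Weak solutions of the Dirichlet problem are in `H²`. -/
theorem h2Laplacian_of_weak {w : WithLp 2 (L2 × L2Vec)} (hw : w ∈ H10) {f : L2}
    (h : ∀ φ : Plane → ℝ, IsSmoothCpt φ → (∀ x, ‖x‖ = 1 → φ x = 0) →
      ∫ x in Ext, w.fst x * lap φ x = ∫ x in Ext, f x * φ x) : H2Laplacian w.fst f := by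
  -- The odd extension has square integrable second derivatives on the whole plane, and it agrees
  -- with `w.fst` on `Ext`.
  choose q hq hqφ using exists_second_partial (memLp_oddExt w.fst) (memLp_oddLap w f)
    fun φ hφ => integral_oddExt_mul_lap hw h hφ
  have hq' : ∀ i j, MemLp (q i j) 2 volExt := fun i j => (hq i j).restrict Ext
  have hp : ∀ i, MemLp (fun x => w.snd x i) 2 volExt := fun i => memLp_coord (Lp.memLp w.snd) i
  have hqE : ∀ i j, ∀ φ : Plane → ℝ, IsTest φ →
      ∫ x in Ext, (hq' i j).toLp _ x * φ x = ∫ x in Ext, w.fst x * partialD i (partialD j φ) x := by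
    intro i j φ hφ
    rw [← integral_oddExt_mul _ ((hφ.partialD j).partialD i), hqφ i j φ hφ.isSmoothCpt,
      ← setIntegral_Ext_eq fun x hx => by rw [hφ.eq_zero hx, mul_zero]]
    exact integral_congr_ae ((hq' i j).coeFn_toLp.mono fun x hx => by simp only [hx])
  have hpE : ∀ i, ∀ φ : Plane → ℝ, IsTest φ →
      ∫ x in Ext, (hp i).toLp _ x * φ x = -∫ x in Ext, w.fst x * partialD i φ x := by
    intro i φ hφ
    rw [H10.integral_fst_mul_partialD hw hφ.isSmoothCpt i, neg_neg]
    exact integral_congr_ae ((hp i).coeFn_toLp.mono fun x hx => by simp only [hx])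
  refine ⟨fun i => (hp i).toLp _, fun i j => (hq' i j).toLp _, fun i φ hφ => ?_,
    fun i j φ hφ => ?_, ?_⟩
  · rw [hpE i φ hφ, neg_neg]
    rfl
  · rw [hqE i j φ hφ]
    exact hpE i _ (hφ.partialD j)
  · refine Lp.ext (L2.ae_eq_of_forall_test (Lp.memLp f) (Lp.memLp _) fun φ hφ => ?_)
    have hφ2 := hφ.isSmoothCpt.memLp
    have e : ∫ x in Ext, (∑ i, (hq' i i).toLp (q i i) : L2) x * φ x =
        ∑ i, ∫ x in Ext, (hq' i i).toLp (q i i) x * φ x := by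
      simp only [← inner_toLp_eq hφ2, inner_sum]
    rw [e, Finset.sum_congr rfl fun i _ => hqE i i φ hφ,
      ← h φ hφ.isSmoothCpt fun x hx => hφ.eq_zero fun hx' => by
        have : 1 < ‖x‖ := hx'
        linarith,
      ← integral_finsetSum _ fun i _ => integrable_mul_volExt (Lp.memLp w.fst)
        ((hφ.partialD i).partialD i).isSmoothCpt.memLp]
    simp only [lap, Finset.mul_sum]

/-! ### Generation of the wave semigroup -/

theorem hasWeakPartial_iff {i : Fin 2} {u v : L2} : HasWeakPartial i u v ↔
    ∀ (φ : Plane → ℝ) (hφ : IsTest φ),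
      inner ℝ ((hφ.isSmoothCpt.partialD i).memLp.toLp _) u =
        -inner ℝ (hφ.isSmoothCpt.memLp.toLp φ) v := by
  simp only [inner_toLp_eq]
  rfl

theorem HasWeakPartial.add {i : Fin 2} {u v u' v' : L2} (h : HasWeakPartial i u v)
    (h' : HasWeakPartial i u' v') : HasWeakPartial i (u + u') (v + v') := by
  rw [hasWeakPartial_iff] at *
  intro φ hφ
  rw [inner_add_right, inner_add_right, h φ hφ, h' φ hφ, neg_add]

theorem HasWeakPartial.smul (c : ℝ) {i : Fin 2} {u v : L2} (h : HasWeakPartial i u v) :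
    HasWeakPartial i (c • u) (c • v) := by
  rw [hasWeakPartial_iff] at *
  intro φ hφ
  rw [real_inner_smul_right, real_inner_smul_right, h φ hφ, mul_neg]

theorem H2Laplacian.add {u f u' f' : L2} (h : H2Laplacian u f) (h' : H2Laplacian u' f') :
    H2Laplacian (u + u') (f + f') := by
  obtain ⟨p, q, hp, hq, rfl⟩ := h
  obtain ⟨p', q', hp', hq', rfl⟩ := h'
  exact ⟨p + p', q + q', fun i => (hp i).add (hp' i), fun i j => (hq i j).add (hq' i j),
    Finset.sum_add_distrib.symm⟩

theorem H2Laplacian.smul (c : ℝ) {u f : L2} (h : H2Laplacian u f) :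
    H2Laplacian (c • u) (c • f) := by
  obtain ⟨p, q, hp, hq, rfl⟩ := h
  exact ⟨c • p, c • q, fun i => (hp i).smul c, fun i j => (hq i j).smul c, Finset.smul_sum⟩

theorem H2Laplacian.eq_zero {f : L2} (h : H2Laplacian 0 f) : f = 0 := by
  refine Lp.ext (L2.ae_eq_of_forall_test (Lp.memLp f) (Lp.memLp _) fun φ hφ => ?_)
  have h1 := H2Laplacian.integral_mul_lap (w := 0) H10.zero_mem h hφ.isSmoothCpt hφ.pair_mem
  refine h1.trans ?_
  rw [← inner_toLp_eq hφ.isSmoothCpt.memLp, ← inner_toLp_eq hφ.isSmoothCpt.lap.memLp, inner_zero_right]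
  exact inner_zero_right _

/-- The stored gradient is the weak gradient, hence determined by the function. -/
theorem H10.eq_zero_of_toL2 {u : H10} (h : H10.toL2 u = 0) : u = 0 := by
  have h1 : (u : WithLp 2 (L2 × L2Vec)).fst = 0 := h
  have h2 : (u : WithLp 2 (L2 × L2Vec)).snd = 0 := by
    have key : ∀ i, (fun x => (u : WithLp 2 (L2 × L2Vec)).snd x i) =ᵐ[volExt] fun _ => 0 := by
      intro i
      refine L2.ae_eq_of_forall_test (memLp_coord (Lp.memLp _) i) MemLp.zero' fun φ hφ => ?_
      have h3 := H10.integral_fst_mul_partialD u.2 hφ.isSmoothCpt i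
      rw [h1, ← inner_toLp_eq (hφ.isSmoothCpt.partialD i).memLp, inner_zero_right] at h3
      simp only [zero_mul, integral_zero]
      linarith
    refine Lp.ext ?_
    filter_upwards [key 0, key 1, Lp.coeFn_zero Plane 2 volExt] with x h0 h1 h2
    rw [h2]
    ext i
    fin_cases i
    · exact h0
    · exact h1
  refine Subtype.ext (WithLp.ofLp_injective 2 (Prod.ext h1 h2))

/-- The gradient as a bounded operator on `H_0^1`. -/
def gradCLM : H10 →L[ℝ] L2Vec := (WithLp.sndL 2 ℝ L2 L2Vec).comp H10.subtypeL

theorem H10.inner_eq (u w : H10) :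
    inner ℝ u w = inner ℝ (toL2CLM u) (toL2CLM w) + inner ℝ (gradCLM u) (gradCLM w) := rfl

theorem Energy.inner_eq (x y : Energy) :
    inner ℝ x y = inner ℝ x.fst y.fst + inner ℝ x.snd y.snd := rfl

theorem inner_L2Vec (a b : L2Vec) : inner ℝ a b = ∑ i, ∫ x in Ext, a x i * b x i := by
  rw [L2.inner_def, ← integral_finsetSum _ fun i _ =>
    integrable_mul_volExt (memLp_coord (Lp.memLp a) i) (memLp_coord (Lp.memLp b) i)]
  simp only [PiLp.inner_apply, RCLike.inner_apply, conj_trivial, mul_comm]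

theorem H2Laplacian.inner_toL2CLM {u : H10} {f : L2} (h : H2Laplacian (toL2CLM u) f) (w : H10) :
    inner ℝ f (toL2CLM w) = -inner ℝ (gradCLM w) (gradCLM u) := by
  obtain ⟨p, q, hp, hq, hf⟩ := h
  have h1 := H2Laplacian.integral_mul_fst hq hf w.2
  rw [real_inner_comm, inner_eq_integral, inner_L2Vec]
  refine h1.trans (congrArg Neg.neg (Finset.sum_congr rfl fun i _ => integral_congr_ae ?_))
  filter_upwards [(hp i).eq_snd u.2] with x hx
  rw [hx]
  rfl

/-- Variational solutions of the Dirichlet problem. -/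
theorem exists_weak_solution {k : ℝ} (hk : 0 < k) (h : L2) : ∃ u : H10, ∀ w : H10,
    k * inner ℝ (toL2CLM u) (toL2CLM w) + inner ℝ (gradCLM u) (gradCLM w) =
      inner ℝ h (toL2CLM w) := by
  -- Lax–Milgram; coercivity holds with constant `min k 1` because `k > 0` controls the `L²` part of
  -- the norm.
  let B : H10 →L[ℝ] H10 →L[ℝ] ℝ := k • (innerSL ℝ).bilinearComp toL2CLM toL2CLM +
    (innerSL ℝ).bilinearComp gradCLM gradCLM
  have hB : ∀ u w, B u w =
    k * inner ℝ (toL2CLM u) (toL2CLM w) + inner ℝ (gradCLM u) (gradCLM w) := fun u w => rfl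
  have hc : IsCoercive B := by
    refine ⟨min k 1, lt_min hk one_pos, fun u => ?_⟩
    rw [hB, mul_assoc, ← sq, ← real_inner_self_eq_norm_sq, H10.inner_eq, mul_add]
    have h1 : 0 ≤ inner ℝ (toL2CLM u) (toL2CLM u) := real_inner_self_nonneg
    have h2 : 0 ≤ inner ℝ (gradCLM u) (gradCLM u) := real_inner_self_nonneg
    nlinarith [min_le_left k 1, min_le_right k 1]
  refine ⟨hc.continuousLinearEquivOfBilin.symm (ContinuousLinearMap.adjoint toL2CLM h),
    fun w => ?_⟩
  rw [← hB, ← hc.continuousLinearEquivOfBilin_apply, ContinuousLinearEquiv.apply_symm_apply,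
    ContinuousLinearMap.adjoint_inner_left]

/-- Smooth functions vanishing on the circle lie in `H_0^1`, so the variational solution satisfies
the hypothesis of `h2Laplacian_of_weak`. -/
theorem exists_h2Laplacian {k : ℝ} (hk : 0 < k) (h : L2) :
    ∃ u : H10, H2Laplacian (H10.toL2 u) (k • H10.toL2 u - h) := by
  obtain ⟨u, hu⟩ := exists_weak_solution hk h
  refine ⟨u, h2Laplacian_of_weak u.2 fun φ hφ h0 => ?_⟩
  have h1 := hu ⟨hφ.pair, pair_mem_H10 hφ h0⟩
  have e1 : ∀ a : L2, ∫ x in Ext, a x * φ x = inner ℝ a (toL2CLM ⟨hφ.pair, pair_mem_H10 hφ h0⟩) :=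
    fun a => by
      rw [real_inner_comm, ← inner_toLp_eq hφ.memLp]
      rfl
  rw [e1, inner_sub_left, ← h1, real_inner_smul_left]
  have e2 : inner ℝ (gradCLM u) (gradCLM ⟨hφ.pair, pair_mem_H10 hφ h0⟩) =
      -∫ x in Ext, (u : WithLp 2 (L2 × L2Vec)).fst x * lap φ x := by
    have e3 : ∫ x in Ext, (u : WithLp 2 (L2 × L2Vec)).fst x * lap φ x =
        ∑ i, ∫ x in Ext, (u : WithLp 2 (L2 × L2Vec)).fst x * partialD i (partialD i φ) x := by
      rw [← integral_finsetSum _ fun i _ =>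
        integrable_mul_volExt (Lp.memLp _) ((hφ.partialD i).partialD i).memLp]
      simp only [lap, Finset.mul_sum]
    rw [e3, inner_L2Vec, ← Finset.sum_neg_distrib]
    refine Finset.sum_congr rfl fun i _ => ?_
    rw [H10.integral_fst_mul_partialD u.2 (hφ.partialD i) i, neg_neg]
    refine integral_congr_ae ?_
    filter_upwards [hφ.memLp_gradient.coeFn_toLp] with x hx
    rw [← gradient_apply, ← hx]
    rfl
  rw [e2]
  simp only [toL2CLM_apply]
  ring

theorem waveOp_add {x y x' y' : Energy} (h : waveOp x y) (h' : waveOp x' y') :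
    waveOp (x + x') (y + y') := by
  obtain ⟨h1, f, hf, h2⟩ := h
  obtain ⟨h1', f', hf', h2'⟩ := h'
  refine ⟨congrArg₂ (· + ·) h1 h1', f + f', hf.add hf', ?_⟩
  change y.snd + y'.snd = f + f' - (x.snd + x'.snd)
  rw [h2, h2']
  abel

theorem waveOp_smul (c : ℝ) {x y : Energy} (h : waveOp x y) : waveOp (c • x) (c • y) := by
  obtain ⟨h1, f, hf, h2⟩ := h
  refine ⟨congrArg (c • ·) h1, c • f, hf.smul c, ?_⟩
  change c • y.snd = c • f - c • x.snd
  rw [h2, smul_sub]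

/-- The gradient terms cancel, leaving `⟨u, v⟩ - ‖v‖²`. The term `⟨u, v⟩`, present because the full
`H¹` norm is used, is at most `(‖u‖² + ‖v‖²)/2`; this is why the identity is subtracted from the
operator. -/
theorem inner_waveOp_le {x y : Energy} (h : waveOp x y) : inner ℝ y x ≤ inner ℝ x x := by
  obtain ⟨h1, f, hf, h2⟩ := h
  have h3 := hf.inner_toL2CLM (u := x.fst) y.fst
  rw [← toL2CLM_apply] at h1
  rw [Energy.inner_eq, Energy.inner_eq, H10.inner_eq, H10.inner_eq, h2, inner_sub_left, h1]
  rw [h1] at h3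
  have h4 : 0 ≤ inner ℝ (x.snd - toL2CLM x.fst) (x.snd - toL2CLM x.fst) := real_inner_self_nonneg
  rw [inner_sub_left, inner_sub_right, inner_sub_right, real_inner_comm x.snd (toL2CLM x.fst)] at h4
  have h5 : 0 ≤ inner ℝ (gradCLM x.fst) (gradCLM x.fst) := real_inner_self_nonneg
  have h6 : 0 ≤ inner ℝ x.snd x.snd := real_inner_self_nonneg
  have h7 : 0 ≤ inner ℝ (toL2CLM x.fst) (toL2CLM x.fst) := real_inner_self_nonneg
  linarith

theorem isMDissipative_waveOp : IsMDissipative fun x y : Energy => waveOp x (y + x) where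
  add {x y x' y'} h h' := by
    have := waveOp_add h h'
    rwa [add_add_add_comm] at this
  smul c {x y} h := by
    have := waveOp_smul c h
    rwa [smul_add] at this
  eq_zero {y} h := by
    rw [add_zero] at h
    obtain ⟨h1, f, hf, h2⟩ := h
    have hf0 : f = 0 := hf.eq_zero
    refine WithLp.ofLp_injective 2 (Prod.ext (H10.eq_zero_of_toL2 h1) ?_)
    refine h2.trans ?_
    rw [hf0]
    exact sub_zero 0
  inner_nonpos {x y} h := by
    have := inner_waveOp_le h
    rw [inner_add_left] at this
    linarith
  range c hc z := by
    -- Eliminating the velocity `v = (c + 1) u - z₁` from `(c + 2) v - Δu = z₂` leaves a single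
    -- Helmholtz-type equation for `u`.
    obtain ⟨u, hu⟩ := exists_h2Laplacian (k := (c + 2) * (c + 1)) (by positivity)
      ((c + 2) • H10.toL2 z.fst + z.snd)
    let x : Energy := WithLp.toLp 2 (u, (c + 1) • H10.toL2 u - H10.toL2 z.fst)
    refine ⟨x, c • x - z, ⟨?_, _, hu, ?_⟩, sub_sub_cancel _ _⟩
    · change c • H10.toL2 u - H10.toL2 z.fst + H10.toL2 u = (c + 1) • H10.toL2 u - H10.toL2 z.fst
      module
    · change c • ((c + 1) • H10.toL2 u - H10.toL2 z.fst) - z.snd +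
          ((c + 1) • H10.toL2 u - H10.toL2 z.fst) = ((c + 2) * (c + 1)) • H10.toL2 u -
          ((c + 2) • H10.toL2 z.fst + z.snd) - ((c + 1) • H10.toL2 u - H10.toL2 z.fst)
      module

theorem exists_semigroup_waveOp :
    ∃ T : ℝ≥0 → Energy →L[ℝ] Energy, IsC0Semigroup T ∧ IsGenerator T waveOp :=
  isMDissipative_waveOp.exists_semigroup

/-- Existence rules out the default value in `semigroupOf`. The estimates hold for any semigroup
with this generator, so the choice made there is immaterial. -/
theorem semigroupOf_waveOp :
    IsC0Semigroup (semigroupOf waveOp) ∧ IsGenerator (semigroupOf waveOp) waveOp := by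
  rw [semigroupOf, dif_pos exists_semigroup_waveOp]
  exact exists_semigroup_waveOp.choose_spec

end ExteriorDampedWave

end

theorem lemma3p3 :
    (∀ (g : L2) (_ : IsRadial g) (hg : MemLp g 1 muExt),
      ∃ hS : ∀ t : ℝ≥0, MemLp (solMap t g) 1 muExt,
        Continuous (fun t : ℝ≥0 => (hS t).toLp (solMap t g)) ∧
        ∀ t : ℝ≥0, ‖(hS t).toLp (solMap t g)‖ ≤ (1 - Real.exp (-(t : ℝ))) * ‖hg.toLp g‖) ∧
    (∀ t : ℝ≥0, ∃ P : radL2L1 →L[ℝ] radL2L1,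
      ∀ g : radL2L1, (P g : L2 × L1mu).1 = solMap t (g : L2 × L1mu).1) ∧
    (∀ t : ℝ≥0, ∃ E : radL1 →L[ℝ] radL1, ‖E‖ ≤ 1 - Real.exp (-(t : ℝ)) ∧
      ∀ (g : L2) (h : radL1), g =ᵐ[volExt] (h : L1mu) →
        (E h : L1mu) =ᵐ[volExt] solMap t g) := by
  obtain ⟨hT, hG⟩ := semigroupOf_waveOp
  refine ⟨fun g hg hg1 => ⟨memLp_solCLM hT hG hg hg1, continuous_toLp_solCLM hT hG hg hg1,
    norm_toLp_solCLM_le hT hG hg hg1⟩, fun t => ?_, fun t => exists_extension hT hG t⟩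
  obtain ⟨P, hP⟩ := exists_continuous_radSol hT hG t
  exact ⟨P, fun g => by rw [hP]; rfl⟩
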